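/- Let $0<\alpha<1$. Let $S^1=\mathbb R/\mathbb Z$ and let $f=f_\alpha:S^1\to S^1$ be the intermittent circle map $$f(x)=\begin{cases} x(1+2^{\alpha}x^{\alpha}), & 0\le x<\tfrac12,\\ x-2^{\alpha}(1-x)^{\alpha+1}, & \tfrac12\le x\le 1\end{cases}\pmod 1 .$$ Let $M=S^1\times\mathbb D$, with $\mathbb D$ the closed unit disk of $\mathbb R^2$, let $\pi:M\to S^1$ be the projection, and let $F=F_\alpha:M\to M$ be the solenoid map with intermittency (which is injective), $$F(x,y,z)=\Bigl(f(x),\ \tfrac12\cos(2\pi x)+\tfrac15 y,\ \tfrac12\sin(2\pi x)+\tfrac15 z\Bigr).$$ An SRB measure of $f$ is an $f$-invariant Borel probability measure on $S^1$ that is absolutely continuous with respect to Lebesgue measure. For a point $p$ in $\bigcap_n F^n(M)$ let $W^u(p)$ be its unstable manifold, the set of all $q\in\bigcap_n F^n(M)$ for which there are $C$ and $r\in(0,1)$ with $d(F^{-n}p,F^{-n}q)\le C r^n$ for all $n\ge 0$. An SRB measure of $F$ is an $F$-invariant Borel probability measure $\nu$ on $M$ for which there is a measurable partition $\xi$ of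 $M$, subordinate to the unstable manifolds (for $\nu$-almost every $p$ the element $\xi(p)$ containing $p$ lies in $W^u(p)$ and contains an arc of which $p$ is an interior point), such that for $\nu$-almost every $p$ the conditional measure of $\nu$ on $\xi(p)$ is absolutely continuous with respect to Lebesgue measure (one-dimensional Hausdorff measure) on $W^u(p)$. Proposition. If $\mu$ is an SRB measure of $f$ and $\eta$ is an $F$-invariant Borel measure on $M$ with $\pi_*\eta=\mu$, then $\eta$ is an SRB measure of $F$, and it is the only one. -/

import Mathlib

open MeasureTheory ProbabilityTheory Filter Topology Set
open scoped MeasureTheory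

noncomputable section

/-! ### The intermittent circle map and the solenoid with intermittency -/

/-- The circle `ℝ / ℤ`. -/
abbrev Circle1 : Type := AddCircle (1 : ℝ)

/-- The formula of the intermittent map with parameter `α` on the fundamental domain `[0, 1)`. -/
def intermittentFormula (α : ℝ) (x : ℝ) : ℝ :=
  if x < 1 / 2 then x * (1 + (2 : ℝ) ^ α * x ^ α)
  else x - (2 : ℝ) ^ α * (1 - x) ^ (α + 1)

/-- The intermittent circle map `f_α : ℝ / ℤ → ℝ / ℤ`. -/
def intermittentMap (α : ℝ) : Circle1 → Circle1 :=
  AddCircle.liftIco 1 0 (fun x : ℝ => (intermittentFormula α x : Circle1))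

/-- The closed unit disk; the point with coordinates `(y, z)` is the complex number `y + i z`. -/
abbrev UnitDisk : Type := Metric.closedBall (0 : ℂ) 1

/-- The solid torus. -/
abbrev SolidTorus : Type := Circle1 × UnitDisk

/-- The function `x ↦ cos (2 π x)` on the circle. -/
def circleCos : Circle1 → ℝ := AddCircle.liftIco 1 0 (fun x : ℝ => Real.cos (2 * Real.pi * x))

/-- The function `x ↦ sin (2 π x)` on the circle. -/
def circleSin : Circle1 → ℝ := AddCircle.liftIco 1 0 (fun x : ℝ => Real.sin (2 * Real.pi * x))

theorem circleCos_sq_add_circleSin_sq (x : Circle1) : circleCos x ^ 2 + circleSin x ^ 2 = 1 := by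
  simp only [circleCos, circleSin, AddCircle.liftIco, Function.comp]
  exact Real.cos_sq_add_sin_sq _

/-- The fibre map `(y, z) ↦ (cos (2 π x) / 2 + y / 5, sin (2 π x) / 2 + z / 5)`. -/
def fibreFormula (x : Circle1) (w : ℂ) : ℂ :=
  ⟨(1 / 2) * circleCos x + (1 / 5) * w.re, (1 / 2) * circleSin x + (1 / 5) * w.im⟩

theorem fibreFormula_mem (x : Circle1) (w : UnitDisk) :
    fibreFormula x w ∈ Metric.closedBall (0 : ℂ) 1 := by
  have hw : ‖(w : ℂ)‖ ≤ 1 := mem_closedBall_zero_iff.mp w.2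
  have hc : ‖(⟨circleCos x, circleSin x⟩ : ℂ)‖ = 1 := by
    have h := circleCos_sq_add_circleSin_sq x
    rw [Complex.norm_def, Complex.normSq_mk, ← sq, ← sq, h, Real.sqrt_one]
  have hf : fibreFormula x w
      = (1 / 2 : ℝ) • (⟨circleCos x, circleSin x⟩ : ℂ) + (1 / 5 : ℝ) • (w : ℂ) := by
    apply Complex.ext <;> simp [fibreFormula]
  rw [mem_closedBall_zero_iff, hf]
  refine (norm_add_le _ _).trans ?_
  rw [norm_smul, norm_smul, hc, Real.norm_of_nonneg (by norm_num),
    Real.norm_of_nonneg (by norm_num)]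
  linarith

/-- The solenoid map with intermittency, a skew product over `intermittentMap α`. -/
def solenoidMap (α : ℝ) : SolidTorus → SolidTorus :=
  fun p => (intermittentMap α p.1, ⟨fibreFormula p.1 p.2, fibreFormula_mem p.1 p.2⟩)

/-! ### SRB measures -/

/-- SRB measures of a circle map: absolutely continuous invariant probability measures. -/
structure IsCircleSRB (T : Circle1 → Circle1) (μ : Measure Circle1) : Prop where
  isProb : IsProbabilityMeasure μ
  invariant : MeasurePreserving T μ μ
  absCont : μ ≪ volume

section Unstable

variable {X : Type*} [MetricSpace X]

/-- `u` is a full backward orbit of `x`: `u 0 = x` and `T (u (n + 1)) = u n`. For an injective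
map there is at most one, namely `u n = T⁻ⁿ x`. -/
def IsBackwardOrbit (T : X → X) (x : X) (u : ℕ → X) : Prop :=
  u 0 = x ∧ ∀ n, T (u (n + 1)) = u n

/-- The unstable manifold of `x`: the points `y` whose backward orbit approaches that of `x`
exponentially fast, i.e. `limsup (1/n) log d(T⁻ⁿ x, T⁻ⁿ y) < 0`. -/
def unstableManifold (T : X → X) (x : X) : Set X :=
  {y | ∃ u v : ℕ → X, IsBackwardOrbit T x u ∧ IsBackwardOrbit T y v ∧
    ∃ C r : ℝ, 0 < r ∧ r < 1 ∧ ∀ n, dist (u n) (v n) ≤ C * r ^ n}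

/-- `x` lies in the interior of an arc that is contained in `S`. For a subset `S` of a
one-dimensional unstable manifold of `x` this says that `S` is a neighbourhood of `x` in it. -/
def ContainsArcThrough (S : Set X) (x : X) : Prop :=
  ∃ γ : ℝ → X, ContinuousOn γ (Icc (-1) 1) ∧ InjOn γ (Icc (-1) 1) ∧ γ 0 = x ∧
    ∀ t ∈ Icc (-1 : ℝ) 1, γ t ∈ S

variable [MeasurableSpace X]

/-- The measurable partition into the level sets of `φ` is subordinate (`ν`-almost everywhere) to
the one-dimensional unstable manifolds of `T`. -/
structure IsSubordinateToUnstable (T : X → X) (ν : Measure X) (φ : X → ℝ) : Prop where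
  measurable : Measurable φ
  subset : ∀ᵐ x ∂ν, φ ⁻¹' {φ x} ⊆ unstableManifold T x
  arc : ∀ᵐ x ∂ν, ContainsArcThrough (φ ⁻¹' {φ x}) x

/-- `κ` is the system of conditional (probability) measures of `ν` on the partition into the level
sets of `φ`; the conditional measure on the element that contains `x` is `κ (φ x)`. -/
structure IsConditionalSystem (ν : Measure X) (φ : X → ℝ) (κ : Kernel ℝ X) : Prop where
  isMarkov : IsMarkovKernel κ
  disintegrates : (ν.map φ).bind κ = ν
  concentrated : ∀ᵐ x ∂ν, κ (φ x) (φ ⁻¹' {φ x})ᶜ = 0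

/-- `ν` is a Sinai-Ruelle-Bowen measure of the injective map `T` with one-dimensional unstable
manifolds: an invariant probability measure for which almost every point has a (nondegenerate)
unstable manifold, and whose conditional measures on these are absolutely continuous with respect
to Lebesgue measure (arc length, i.e. one-dimensional Hausdorff measure) on them. -/
structure IsSRB [BorelSpace X] (T : X → X) (ν : Measure X) : Prop where
  isProb : IsProbabilityMeasure ν
  invariant : MeasurePreserving T ν ν
  absCont : ∃ (φ : X → ℝ) (κ : Kernel ℝ X),
    IsSubordinateToUnstable T ν φ ∧ IsConditionalSystem ν φ κ ∧
      ∀ᵐ x ∂ν, κ (φ x) ≪ (μH[1]).restrict (unstableManifold T x)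

end Unstable

end

open MeasureTheory ProbabilityTheory Filter Topology Set
open scoped MeasureTheory ENNReal NNReal
noncomputable section

/-! ### Cross ratios -/

/-! The fibres of the skew product `F` contract by 1/5, so for large `n` a continuous observable
composed with `F^n` almost depends on the base point only; an invariant measure of `F` is therefore
determined by its projection (`eq_of_map_fst_eq`). What remains concerns the base map and the
unstable direction.

Distortion. Since `α < 1`, the branches of `f` have positive concave derivative, a condition of
negative Schwarzian type. They expand cross ratios, so all compositions of inverse branches contract
them (`contractsCrossRatio_invBranches`). As in the Koebe principle, this controls such a
composition on `[ε, 1 - ε]` uniformly in its length and in the choice of branches, although `f` is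
not uniformly expanding. An integrable density is almost constant on cylinders of large order, so
the control passes from Lebesgue measure to absolutely continuous measures. The lower bound
(`measure_mul_volume_le`) makes every nonzero finite absolutely continuous invariant measure of `f`
equivalent to Lebesgue measure, whence ergodicity and uniqueness of the SRB measure of `f`. The
upper bound (`measure_pastWord_iterate_le`) says that, given the past symbols, the present base
point has a density of at most `4 / ε ^ 2` on `[ε, 1 - ε]`.

The lift `η` is SRB. Partition by the infinite itinerary of the backward orbit: an element is the
graph over `(0, 1)` of a convergent series (`attractorPoint`). By invariance the upper bound for
finite pasts holds for the full past under `η`, so the law of (past, base point) is absolutely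
continuous with respect to a product with Lebesgue measure
(`map_pastSymbols_prodMk_absolutelyContinuous`), and almost every conditional measure projects to an
absolutely continuous measure. The elements lie in unstable manifolds because the backward orbit of
a typical point returns with positive frequency to a region away from the neutral point, and each
return contracts by a fixed factor (`ae_mem_unstableManifold`).

Uniqueness. An unstable manifold is covered by countably many forward images of Lipschitz graphs
over subsets of the circle, so an SRB measure of `F` projects to an SRB measure of `f`
(`IsSRB.isCircleSRB_map_fst`). That projection is unique and determines the measure. -/

/-- `f` does not increase the cross ratio `|ad| |bc| / (|ab| |cd|)` of four points of `s`. -/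
def ContractsCrossRatio (f : ℝ → ℝ) (s : Set ℝ) : Prop :=
  ∀ a ∈ s, ∀ b ∈ s, ∀ c ∈ s, ∀ d ∈ s, a < b → b < c → c < d →
    (f d - f a) * (f c - f b) * ((b - a) * (d - c)) ≤
      (f b - f a) * (f d - f c) * ((d - a) * (c - b))

theorem ContractsCrossRatio.comp {f g : ℝ → ℝ} {s t : Set ℝ} (hf : ContractsCrossRatio f t)
    (hg : ContractsCrossRatio g s) (hmaps : MapsTo g s t) (hmono : StrictMonoOn g s)
    (hmono' : StrictMonoOn f t) : ContractsCrossRatio (f ∘ g) s := by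
  intro a ha b hb c hc d hd hab hbc hcd
  have hab' := hmono ha hb hab
  have hbc' := hmono hb hc hbc
  have hcd' := hmono hc hd hcd
  have h1 := hf _ (hmaps ha) _ (hmaps hb) _ (hmaps hc) _ (hmaps hd) hab' hbc' hcd'
  have h2 := hg a ha b hb c hc d hd hab hbc hcd
  simp only [Function.comp]
  have p1 : 0 < (g b - g a) * (g d - g c) := mul_pos (by linarith) (by linarith)
  have q1 : 0 < (b - a) * (d - c) := mul_pos (by linarith) (by linarith)
  have hM : 0 < (f (g b) - f (g a)) * (f (g d) - f (g c)) :=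
    mul_pos (sub_pos.2 (hmono' (hmaps ha) (hmaps hb) hab'))
      (sub_pos.2 (hmono' (hmaps hc) (hmaps hd) hcd'))
  refine le_of_mul_le_mul_right ?_ p1
  calc _ = (f (g d) - f (g a)) * (f (g c) - f (g b)) * ((g b - g a) * (g d - g c))
        * ((b - a) * (d - c)) := by ring
    _ ≤ (f (g b) - f (g a)) * (f (g d) - f (g c)) * ((g d - g a) * (g c - g b))
        * ((b - a) * (d - c)) := mul_le_mul_of_nonneg_right h1 q1.le
    _ = (f (g b) - f (g a)) * (f (g d) - f (g c)) * ((g d - g a) * (g c - g b)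
        * ((b - a) * (d - c))) := by ring
    _ ≤ (f (g b) - f (g a)) * (f (g d) - f (g c)) * ((g b - g a) * (g d - g c)
        * ((d - a) * (c - b))) := mul_le_mul_of_nonneg_left h2 hM.le
    _ = _ := by ring

/-- The trapezoid rule underestimates the integral of a concave derivative. -/
theorem trapezoid_le_sub_of_concaveOn_deriv {f f' : ℝ → ℝ} {s : Set ℝ}
    (hf : ∀ x ∈ s, HasDerivAt f (f' x) x) (hc : ConcaveOn ℝ s f') {x y : ℝ} (hx : x ∈ s)
    (hy : y ∈ s) (hxy : x < y) : (f' x + f' y) / 2 * (y - x) ≤ f y - f x := by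
  have hsub : Icc x y ⊆ s := hc.1.ordConnected.out hx hy
  set k := (f' y - f' x) / (y - x) with hk
  have hk' : k * (y - x) = f' y - f' x := div_mul_cancel₀ _ (by linarith)
  -- The subtracted term is a primitive of the chord of `f'` over `[x, y]`, with slope `k`;
  -- concavity puts `f'` above its chord.
  have hmono : MonotoneOn (fun t => f t - (f' x * t + k * (t - x) ^ 2 / 2)) (Icc x y) := by
    have hd : ∀ t ∈ Icc x y, HasDerivAt (fun t => f t - (f' x * t + k * (t - x) ^ 2 / 2))
        (f' t - (f' x + k * (t - x))) t := by
      intro t ht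
      have h1 : HasDerivAt (fun t => f' x * t + k * (t - x) ^ 2 / 2)
          (f' x * 1 + k * (2 * (t - x) ^ 1 * 1) / 2) t :=
        ((hasDerivAt_id t).const_mul _).add
          (((((hasDerivAt_id t).sub_const x).pow 2).const_mul k).div_const 2)
      convert! (hf t (hsub ht)).sub h1 using 1
      ring
    apply monotoneOn_of_deriv_nonneg (convex_Icc x y)
    · exact fun t ht => (hd t ht).continuousAt.continuousWithinAt
    · exact fun t ht => (hd t (interior_subset ht)).differentiableAt.differentiableWithinAt
    · intro t ht
      have ht' := interior_subset ht
      rw [(hd t ht').deriv, sub_nonneg]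
      have hw : ((y - t) / (y - x)) + ((t - x) / (y - x)) = 1 := by
        rw [← add_div, div_eq_one_iff_eq (by linarith)]; ring
      have h := hc.2 hx hy (div_nonneg (by linarith [ht'.2]) (by linarith))
        (div_nonneg (by linarith [ht'.1]) (by linarith)) hw
      simp only [smul_eq_mul] at h
      have e1 : (y - t) / (y - x) * x + (t - x) / (y - x) * y = t := by
        have : y - x ≠ 0 := by linarith
        field_simp; ring
      have e2 : (y - t) / (y - x) * f' x + (t - x) / (y - x) * f' y = f' x + k * (t - x) := by
        have : y - x ≠ 0 := by linarith
        rw [hk]; field_simp; ring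
      rwa [e1, e2] at h
  have h := hmono (left_mem_Icc.2 hxy.le) (right_mem_Icc.2 hxy.le) hxy.le
  simp only at h
  have e3 : k * (y - x) ^ 2 = (f' y - f' x) * (y - x) := by rw [sq, ← mul_assoc, hk']
  rw [e3] at h
  nlinarith

/-- The geometric mean of the two derivatives is at most their arithmetic mean, which the trapezoid
rule bounds by the mean slope. Equivalently, the mixed derivative of `log ((f y - f x) / (y - x))`
is nonpositive, which is the infinitesimal form of expanding cross ratios. -/
theorem deriv_mul_deriv_le_of_concaveOn_deriv {f f' : ℝ → ℝ} {s : Set ℝ}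
    (hf : ∀ x ∈ s, HasDerivAt f (f' x) x) (hc : ConcaveOn ℝ s f') (hpos : ∀ x ∈ s, 0 < f' x)
    {x y : ℝ} (hx : x ∈ s) (hy : y ∈ s) (hxy : x < y) :
    f' x * f' y * (y - x) ^ 2 ≤ (f y - f x) ^ 2 := by
  have h := trapezoid_le_sub_of_concaveOn_deriv hf hc hx hy hxy
  have h0 : 0 ≤ (f' x + f' y) / 2 * (y - x) :=
    mul_nonneg (by linarith [hpos x hx, hpos y hy]) (by linarith)
  calc f' x * f' y * (y - x) ^ 2 ≤ ((f' x + f' y) / 2 * (y - x)) ^ 2 := by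
        rw [mul_pow]
        exact mul_le_mul_of_nonneg_right (by nlinarith [sq_nonneg (f' x - f' y)]) (sq_nonneg _)
    _ ≤ _ := pow_le_pow_left₀ h0 h 2

/-- A function with positive concave derivative expands cross ratios. -/
theorem crossRatio_le_of_concaveOn_deriv {f f' : ℝ → ℝ} {s : Set ℝ}
    (hf : ∀ x ∈ s, HasDerivAt f (f' x) x) (hc : ConcaveOn ℝ s f') (hpos : ∀ x ∈ s, 0 < f' x)
    (hmono : StrictMonoOn f s)
    {a b c d : ℝ} (ha : a ∈ s) (hd : d ∈ s) (hab : a < b) (hbc : b < c) (hcd : c < d) :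
    (f b - f a) * (f d - f c) * ((d - a) * (c - b)) ≤
      (f d - f a) * (f c - f b) * ((b - a) * (d - c)) := by
  have hsub : Icc a d ⊆ s := hc.1.ordConnected.out ha hd
  -- The logarithm of the ratio of the two cross ratios is the integral of the mixed derivative over
  -- `[a, b] × [c, d]`. This is the integration in `x`; `hψ` performs the one in `y`.
  have hθ : ∀ y ∈ Ioc b d, f' y / (f y - f b) - 1 / (y - b) ≤ f' y / (f y - f a) - 1 / (y - a) := by
    intro y hy
    have hys : y ∈ s := hsub ⟨by linarith [hy.1], hy.2⟩
    have hderiv : ∀ x ∈ Icc a b, HasDerivAt (fun x => f' y / (f y - f x) - 1 / (y - x))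
        (f' y * f' x / (f y - f x) ^ 2 - 1 / (y - x) ^ 2) x := by
      intro x hx
      have hxs : x ∈ s := hsub ⟨hx.1, by linarith [hx.2]⟩
      have hlt : f x < f y := hmono hxs hys (by linarith [hx.2, hy.1])
      have hne : f y - f x ≠ 0 := by linarith
      have hne' : y - x ≠ 0 := by linarith [hx.2, hy.1]
      have h1 := (hasDerivAt_const x (f' y)).div ((hf x hxs).const_sub (f y)) hne
      have h2 := (hasDerivAt_const x (1 : ℝ)).div ((hasDerivAt_id' x).const_sub y) hne'
      convert! h1.sub h2 using 1
      ring
    have hanti : AntitoneOn (fun x => f' y / (f y - f x) - 1 / (y - x)) (Icc a b) := by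
      apply antitoneOn_of_deriv_nonpos (convex_Icc a b)
      · exact fun t ht => (hderiv t ht).continuousAt.continuousWithinAt
      · exact fun t ht => (hderiv t (interior_subset ht)).differentiableAt.differentiableWithinAt
      · intro x hx
        have hx' := interior_subset hx
        have hxs : x ∈ s := hsub ⟨hx'.1, by linarith [hx'.2]⟩
        have hxy : x < y := by linarith [hx'.2, hy.1]
        have hlt : f x < f y := hmono hxs hys hxy
        have h := deriv_mul_deriv_le_of_concaveOn_deriv hf hc hpos hxs hys hxy
        rw [(hderiv x hx').deriv, sub_nonpos,
          div_le_div_iff₀ (pow_pos (by linarith) 2) (pow_pos (by linarith) 2)]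
        linarith
    exact hanti (left_mem_Icc.2 hab.le) (right_mem_Icc.2 hab.le) hab.le
  have hs : ∀ t ∈ Icc a d, t ∈ s := fun t ht => hsub ht
  have hψ : MonotoneOn (fun t => Real.log (f t - f a) - Real.log (t - a)
      - (Real.log (f t - f b) - Real.log (t - b))) (Icc c d) := by
    have hderiv : ∀ t ∈ Icc c d, HasDerivAt (fun t => Real.log (f t - f a) - Real.log (t - a)
        - (Real.log (f t - f b) - Real.log (t - b)))
        (f' t / (f t - f a) - 1 / (t - a) - (f' t / (f t - f b) - 1 / (t - b))) t := by
      intro t ht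
      have hts : t ∈ s := hsub ⟨by linarith [ht.1], ht.2⟩
      have hbs : b ∈ s := hsub ⟨by linarith, by linarith⟩
      have l1 : f a < f t := hmono ha hts (by linarith [ht.1])
      have l2 : f b < f t := hmono hbs hts (by linarith [ht.1])
      exact ((((hf t hts).sub_const _).log (by linarith)).sub
        (((hasDerivAt_id t).sub_const a).log (by simp; linarith [ht.1]))).sub
        ((((hf t hts).sub_const _).log (by linarith)).sub
        (((hasDerivAt_id t).sub_const b).log (by simp; linarith [ht.1])))
    apply monotoneOn_of_deriv_nonneg (convex_Icc c d)
    · exact fun t ht => (hderiv t ht).continuousAt.continuousWithinAt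
    · exact fun t ht => (hderiv t (interior_subset ht)).differentiableAt.differentiableWithinAt
    · intro t ht
      have ht' := interior_subset ht
      rw [(hderiv t ht').deriv, sub_nonneg]
      exact hθ t ⟨by linarith [ht'.1], ht'.2⟩
  have h := hψ (left_mem_Icc.2 hcd.le) (right_mem_Icc.2 hcd.le) hcd.le
  have hbs : b ∈ s := hsub ⟨by linarith, by linarith⟩
  have hcs : c ∈ s := hsub ⟨by linarith, by linarith⟩
  have m1 := hmono ha hbs hab
  have m2 := hmono hbs hcs hbc
  have m3 := hmono hcs hd hcd
  simp only at h
  have pos : ∀ {u v : ℝ}, u < v → v - u ≠ 0 := fun h => by linarith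
  have h' : Real.log ((f c - f a) * (c - b) * ((f d - f b) * (d - a))) ≤
      Real.log ((f d - f a) * (d - b) * ((f c - f b) * (c - a))) := by
    rw [Real.log_mul, Real.log_mul, Real.log_mul, Real.log_mul, Real.log_mul, Real.log_mul]
    · linarith
    all_goals
      first
      | exact pos (by linarith)
      | exact mul_ne_zero (pos (by linarith)) (pos (by linarith))
  have h2 := (Real.log_le_log_iff (mul_pos (mul_pos (by linarith) (by linarith))
    (mul_pos (by linarith) (by linarith))) (mul_pos (mul_pos (by linarith) (by linarith))
    (mul_pos (by linarith) (by linarith)))).1 h'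
  nlinarith

/-! ### The two branches of the intermittent map and their inverses -/

/-- The formula `x + 2^α x^(α + 1)` of the branch of the intermittent map at its neutral point. -/
def neutralBranch (α x : ℝ) : ℝ := x + 2 ^ α * x ^ (α + 1)

section Branches

variable {α : ℝ}

theorem two_rpow_mul_half_rpow (α : ℝ) : (2 : ℝ) ^ α * (1 / 2 : ℝ) ^ α = 1 := by
  rw [← Real.mul_rpow (by norm_num) (by norm_num)]; norm_num

theorem neutralBranch_zero (hα0 : 0 < α) : neutralBranch α 0 = 0 := by
  simp [neutralBranch, Real.zero_rpow (by linarith : α + 1 ≠ 0)]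

theorem neutralBranch_half (α : ℝ) : neutralBranch α (1 / 2) = 1 := by
  rw [neutralBranch, Real.rpow_add_one (by norm_num), ← mul_assoc, two_rpow_mul_half_rpow]
  norm_num

theorem hasDerivAt_neutralBranch (hα0 : 0 < α) (x : ℝ) :
    HasDerivAt (neutralBranch α) (1 + 2 ^ α * ((α + 1) * x ^ α)) x := by
  have h := (Real.hasDerivAt_rpow_const (x := x) (p := α + 1) (Or.inr (by linarith))).const_mul
    ((2 : ℝ) ^ α)
  rw [add_sub_cancel_right] at h
  exact (hasDerivAt_id x).add h

theorem continuous_neutralBranch (hα0 : 0 < α) : Continuous (neutralBranch α) :=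
  continuous_iff_continuousAt.2 fun x => (hasDerivAt_neutralBranch hα0 x).continuousAt

/-- From `y^(α+1) - x^(α+1) = y^α (y - x) + (y^α - x^α) x`. Only the larger endpoint has to be at
distance `m` from the neutral point. Thus `m` may be the length of an interval, or the distance of
just one of two orbits. -/
theorem le_neutralBranch_sub (hα0 : 0 < α) {m x y : ℝ} (hx : 0 ≤ x) (hxy : x ≤ y) (hm : 0 ≤ m)
    (hmy : m ≤ y) : (1 + 2 ^ α * m ^ α) * (y - x) ≤ neutralBranch α y - neutralBranch α x := by
  have hy := hx.trans hxy
  have h1 : x ^ α ≤ y ^ α := Real.rpow_le_rpow hx hxy hα0.le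
  have h2 : m ^ α ≤ y ^ α := Real.rpow_le_rpow hm hmy hα0.le
  have hc : (0 : ℝ) < 2 ^ α := by positivity
  have e : ∀ z : ℝ, 0 ≤ z → z ^ (α + 1) = z ^ α * z := fun z hz =>
    Real.rpow_add_one' hz (by linarith)
  have h3 : m ^ α * (y - x) ≤ y ^ (α + 1) - x ^ (α + 1) := by
    rw [e x hx, e y hy]
    nlinarith [mul_le_mul_of_nonneg_right h1 hx,
      mul_le_mul_of_nonneg_right h2 (sub_nonneg.2 hxy)]
  unfold neutralBranch
  nlinarith [mul_le_mul_of_nonneg_left h3 hc.le]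

theorem neutralBranch_sub_le (hα0 : 0 < α) (hα1 : α < 1) {x y : ℝ} (hx : 0 ≤ x) (hxy : x ≤ y)
    (hy : y ≤ 1 / 2) : neutralBranch α y - neutralBranch α x ≤ 3 * (y - x) := by
  refine (convex_Icc (0 : ℝ) (1 / 2)).image_sub_le_mul_sub_of_deriv_le
    (continuous_neutralBranch hα0).continuousOn
    (fun z _ => (hasDerivAt_neutralBranch hα0 z).differentiableAt.differentiableWithinAt)
    (fun z hz => ?_) x ⟨hx, hxy.trans hy⟩ y ⟨hx.trans hxy, hy⟩ hxy
  have hz' := interior_subset hz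
  rw [(hasDerivAt_neutralBranch hα0 z).deriv]
  -- The derivative is `1 + (α + 1) (2z)^α`, with `2z ≤ 1` and `α + 1 ≤ 2`; hence the constant 3.
  have h : z ^ α ≤ (1 / 2) ^ α := Real.rpow_le_rpow hz'.1 hz'.2 hα0.le
  have h2 := mul_le_mul_of_nonneg_left h (by positivity : (0 : ℝ) ≤ 2 ^ α)
  rw [two_rpow_mul_half_rpow] at h2
  have h3 : 0 ≤ (2 : ℝ) ^ α * z ^ α := mul_nonneg (by positivity) (Real.rpow_nonneg hz'.1 _)
  nlinarith

theorem strictMonoOn_neutralBranch (hα0 : 0 < α) : StrictMonoOn (neutralBranch α) (Ici 0) := by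
  intro x hx y _ hxy
  have := le_neutralBranch_sub hα0 hx hxy.le le_rfl (le_trans hx hxy.le)
  rw [Real.zero_rpow hα0.ne', mul_zero, add_zero, one_mul] at this
  linarith

/-- The derivative `1 + 2^α (α + 1) x^α` is concave because the exponent is at most 1. This is where
the distortion argument depends on `α < 1`. -/
theorem neutralBranch_crossRatio_le (hα0 : 0 < α) (hα1 : α < 1) {a b c d : ℝ} (ha : 0 < a)
    (hab : a < b) (hbc : b < c) (hcd : c < d) :
    (neutralBranch α b - neutralBranch α a) * (neutralBranch α d - neutralBranch α c)
      * ((d - a) * (c - b)) ≤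
    (neutralBranch α d - neutralBranch α a) * (neutralBranch α c - neutralBranch α b)
      * ((b - a) * (d - c)) := by
  refine crossRatio_le_of_concaveOn_deriv (s := Ioi 0)
    (fun x _ => hasDerivAt_neutralBranch hα0 x) ?_ (fun x hx => ?_)
    ((strictMonoOn_neutralBranch hα0).mono Ioi_subset_Ici_self) ha
    (by simp only [mem_Ioi]; linarith) hab hbc hcd
  · have h := ((Real.concaveOn_rpow hα0.le hα1.le).subset Ioi_subset_Ici_self
      (convex_Ioi 0)).smul (by positivity : (0 : ℝ) ≤ 2 ^ α * (α + 1))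
    have h2 := h.add_const 1
    convert! h2 using 2 with x
    simp only [Pi.add_apply, smul_eq_mul]; ring
  · have := Real.rpow_pos_of_pos hx α
    positivity

/-- The domains `[0, 1/2)` and `[1/2, 1)` of the two branches. -/
def half (b : Bool) : Set ℝ := if b then Ico (1 / 2) 1 else Ico 0 (1 / 2)

/-- The index of the branch whose domain contains a given point. -/
def halfSymbol (x : ℝ) : Bool := decide (1 / 2 ≤ x)

theorem half_subset (b : Bool) : half b ⊆ Ico 0 1 := by
  cases b
  · exact Ico_subset_Ico_right (by norm_num)
  · exact Ico_subset_Ico_left (by norm_num)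

theorem mem_half_halfSymbol {x : ℝ} (hx : x ∈ Ico (0 : ℝ) 1) : x ∈ half (halfSymbol x) := by
  by_cases h : 1 / 2 ≤ x
  · simp only [halfSymbol, h, decide_true, half]
    exact ⟨h, hx.2⟩
  · simp only [halfSymbol, h, decide_false, half]
    exact ⟨hx.1, not_le.1 h⟩

theorem halfSymbol_eq_of_mem {x : ℝ} {b : Bool} (hx : x ∈ half b) : halfSymbol x = b := by
  cases b
  · simpa [halfSymbol] using hx.2
  · simpa [halfSymbol] using hx.1

theorem measurable_halfSymbol : Measurable halfSymbol := by
  refine measurable_to_bool ?_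
  have : halfSymbol ⁻¹' {true} = Ici (1 / 2) := by ext x; simp [halfSymbol]
  rw [this]; exact measurableSet_Ici

theorem intermittentFormula_of_mem_half_false (hα0 : 0 < α) {x : ℝ} (hx : x ∈ half false) :
    intermittentFormula α x = neutralBranch α x := by
  rw [intermittentFormula, if_pos hx.2, neutralBranch, Real.rpow_add_one' hx.1 (by linarith)]
  ring

theorem intermittentFormula_of_mem_half_true {x : ℝ} (hx : x ∈ half true) :
    intermittentFormula α x = 1 - neutralBranch α (1 - x) := by
  rw [intermittentFormula, if_neg (not_lt.2 hx.1), neutralBranch]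
  ring

theorem measurable_intermittentFormula (α : ℝ) : Measurable (intermittentFormula α) := by
  unfold intermittentFormula
  exact Measurable.ite measurableSet_Iio (by fun_prop) (by fun_prop)

/-- The right branch is the left one conjugated by `x ↦ 1 - x`, so its far endpoint is the smaller
one. Asking for both `m ≤ y` and `m ≤ 1 - x` gives a bound independent of the branch. -/
theorem le_intermittentFormula_sub (hα0 : 0 < α) {b : Bool} {m x y : ℝ} (hx : x ∈ half b)
    (hy : y ∈ half b) (hxy : x ≤ y) (hm : 0 ≤ m) (hmy : m ≤ y) (hmx : m ≤ 1 - x) :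
    (1 + 2 ^ α * m ^ α) * (y - x) ≤ intermittentFormula α y - intermittentFormula α x := by
  cases b
  · rw [intermittentFormula_of_mem_half_false hα0 hx, intermittentFormula_of_mem_half_false hα0 hy]
    exact le_neutralBranch_sub hα0 hx.1 hxy hm hmy
  · rw [intermittentFormula_of_mem_half_true hx, intermittentFormula_of_mem_half_true hy]
    have := le_neutralBranch_sub hα0 (x := 1 - y) (y := 1 - x) (by linarith [hy.2]) (by linarith)
      hm hmx
    linarith

theorem sub_le_intermittentFormula_sub (hα0 : 0 < α) {b : Bool} {x y : ℝ} (hx : x ∈ half b)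
    (hy : y ∈ half b) (hxy : x ≤ y) :
    y - x ≤ intermittentFormula α y - intermittentFormula α x := by
  have := le_intermittentFormula_sub hα0 hx hy hxy le_rfl (half_subset b hy).1
    (by linarith [(half_subset b hx).2])
  rwa [Real.zero_rpow hα0.ne', mul_zero, add_zero, one_mul] at this

theorem intermittentFormula_sub_le (hα0 : 0 < α) (hα1 : α < 1) {b : Bool} {x y : ℝ}
    (hx : x ∈ half b) (hy : y ∈ half b) (hxy : x ≤ y) :
    intermittentFormula α y - intermittentFormula α x ≤ 3 * (y - x) := by
  cases b
  · rw [intermittentFormula_of_mem_half_false hα0 hx, intermittentFormula_of_mem_half_false hα0 hy]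
    exact neutralBranch_sub_le hα0 hα1 hx.1 hxy hy.2.le
  · rw [intermittentFormula_of_mem_half_true hx, intermittentFormula_of_mem_half_true hy]
    have := neutralBranch_sub_le hα0 hα1 (x := 1 - y) (y := 1 - x) (by linarith [hy.2])
      (by linarith) (by linarith [hx.1])
    linarith

theorem strictMonoOn_intermittentFormula (hα0 : 0 < α) (b : Bool) :
    StrictMonoOn (intermittentFormula α) (half b) := fun x hx y hy hxy => by
  linarith [sub_le_intermittentFormula_sub hα0 hx hy hxy.le]

theorem bijOn_intermittentFormula (hα0 : 0 < α) (b : Bool) :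
    BijOn (intermittentFormula α) (half b) (Ico 0 1) := by
  have hc := (continuous_neutralBranch hα0).continuousOn (s := Icc 0 (1 / 2))
  have hmono := strictMonoOn_neutralBranch hα0
  have hz : (0 : ℝ) ∈ Ici (0 : ℝ) := mem_Ici.2 le_rfl
  have hh : (1 / 2 : ℝ) ∈ Ici (0 : ℝ) := mem_Ici.2 (by norm_num)
  have hval : ∀ y ∈ Icc (0 : ℝ) 1, ∃ x ∈ Icc (0 : ℝ) (1 / 2), neutralBranch α x = y := by
    have := intermediate_value_Icc (by norm_num) hc
    rwa [neutralBranch_zero hα0, neutralBranch_half] at this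
  refine ⟨?_, (strictMonoOn_intermittentFormula hα0 b).injOn, ?_⟩
  · intro x hx
    cases b
    · rw [intermittentFormula_of_mem_half_false hα0 hx]
      have h1 := hmono.monotoneOn hz hx.1 hx.1
      have h2 := hmono hx.1 hh hx.2
      rw [neutralBranch_zero hα0] at h1
      rw [neutralBranch_half] at h2
      exact ⟨h1, h2⟩
    · rw [intermittentFormula_of_mem_half_true hx]
      have h0 : 0 < 1 - x := by linarith [hx.2]
      have h1 := hmono hz (mem_Ici.2 h0.le) h0
      have h2 := hmono.monotoneOn (mem_Ici.2 h0.le) hh (by linarith [hx.1])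
      rw [neutralBranch_zero hα0] at h1
      rw [neutralBranch_half] at h2
      exact ⟨by linarith, by linarith⟩
  · intro y hy
    cases b
    · obtain ⟨x, hx, rfl⟩ := hval y ⟨hy.1, hy.2.le⟩
      have hx' : x ∈ half false := by
        refine ⟨hx.1, lt_of_le_of_ne hx.2 ?_⟩
        rintro rfl
        rw [neutralBranch_half] at hy
        exact lt_irrefl _ hy.2
      exact ⟨x, hx', intermittentFormula_of_mem_half_false hα0 hx'⟩
    · obtain ⟨x, hx, hxy⟩ := hval (1 - y) ⟨by linarith [hy.2], by linarith [hy.1]⟩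
      have hx' : 1 - x ∈ half true := by
        refine ⟨by linarith [hx.2], ?_⟩
        have : x ≠ 0 := by
          rintro rfl
          rw [neutralBranch_zero hα0] at hxy
          linarith [hy.2]
        have := lt_of_le_of_ne hx.1 this.symm
        linarith
      refine ⟨1 - x, hx', ?_⟩
      rw [intermittentFormula_of_mem_half_true hx', sub_sub_cancel, hxy]
      ring

theorem intermittentFormula_mem (hα0 : 0 < α) {x : ℝ} (hx : x ∈ Ico (0 : ℝ) 1) :
    intermittentFormula α x ∈ Ico (0 : ℝ) 1 :=
  (bijOn_intermittentFormula hα0 _).mapsTo (mem_half_halfSymbol hx)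

theorem iterate_intermittentFormula_mem (hα0 : 0 < α) {x : ℝ} (hx : x ∈ Ico (0 : ℝ) 1) (n : ℕ) :
    (intermittentFormula α)^[n] x ∈ Ico (0 : ℝ) 1 := by
  induction n with
  | zero => exact hx
  | succ n ih => rw [Function.iterate_succ_apply']; exact intermittentFormula_mem hα0 ih

/-- The inverse branches `[0, 1) → half b` of the intermittent map. -/
def invBranch (α : ℝ) (b : Bool) : ℝ → ℝ := Function.invFunOn (intermittentFormula α) (half b)

theorem invBranch_mem (hα0 : 0 < α) (b : Bool) {x : ℝ} (hx : x ∈ Ico (0 : ℝ) 1) :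
    invBranch α b x ∈ half b :=
  Function.invFunOn_mem ((bijOn_intermittentFormula hα0 b).surjOn hx)

theorem intermittentFormula_invBranch (hα0 : 0 < α) (b : Bool) {x : ℝ} (hx : x ∈ Ico (0 : ℝ) 1) :
    intermittentFormula α (invBranch α b x) = x :=
  Function.invFunOn_eq ((bijOn_intermittentFormula hα0 b).surjOn hx)

theorem invBranch_intermittentFormula (hα0 : 0 < α) {b : Bool} {x : ℝ} (hx : x ∈ half b) :
    invBranch α b (intermittentFormula α x) = x :=
  (bijOn_intermittentFormula hα0 b).injOn.leftInvOn_invFunOn hx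

theorem strictMonoOn_invBranch (hα0 : 0 < α) (b : Bool) :
    StrictMonoOn (invBranch α b) (Ico 0 1) := by
  intro x hx y hy hxy
  rw [← (strictMonoOn_intermittentFormula hα0 b).lt_iff_lt (invBranch_mem hα0 b hx)
    (invBranch_mem hα0 b hy), intermittentFormula_invBranch hα0 b hx,
    intermittentFormula_invBranch hα0 b hy]
  exact hxy

theorem invBranch_mem_Ioo (hα0 : 0 < α) (b : Bool) {x : ℝ} (hx : x ∈ Ioo (0 : ℝ) 1) :
    invBranch α b x ∈ Ioo (0 : ℝ) 1 := by
  have h0 : (0 : ℝ) ∈ Ico (0 : ℝ) 1 := ⟨le_rfl, zero_lt_one⟩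
  have h := strictMonoOn_invBranch hα0 b h0 (Ioo_subset_Ico_self hx) hx.1
  exact ⟨((half_subset b (invBranch_mem hα0 b h0)).1).trans_lt h,
    (half_subset b (invBranch_mem hα0 b (Ioo_subset_Ico_self hx))).2⟩

theorem contractsCrossRatio_invBranch (hα0 : 0 < α) (hα1 : α < 1) (b : Bool) :
    ContractsCrossRatio (invBranch α b) (Ioo 0 1) := by
  intro p hp q hq r hr s hs hpq hqr hrs
  have hp' := Ioo_subset_Ico_self hp
  have hq' := Ioo_subset_Ico_self hq
  have hr' := Ioo_subset_Ico_self hr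
  have hs' := Ioo_subset_Ico_self hs
  have h1 := strictMonoOn_invBranch hα0 b hp' hq' hpq
  have h2 := strictMonoOn_invBranch hα0 b hq' hr' hqr
  have h3 := strictMonoOn_invBranch hα0 b hr' hs' hrs
  have ep := intermittentFormula_invBranch hα0 b hp'
  have eq := intermittentFormula_invBranch hα0 b hq'
  have er := intermittentFormula_invBranch hα0 b hr'
  have es := intermittentFormula_invBranch hα0 b hs'
  have mp := invBranch_mem hα0 b hp'
  have mq := invBranch_mem hα0 b hq'
  have mr := invBranch_mem hα0 b hr'
  have ms := invBranch_mem hα0 b hs'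
  have up := (invBranch_mem_Ioo hα0 b hp).1
  have us := (invBranch_mem_Ioo hα0 b hs).2
  set P := invBranch α b p
  set Q := invBranch α b q
  set R := invBranch α b r
  set S := invBranch α b s
  cases b
  · rw [intermittentFormula_of_mem_half_false hα0 mp] at ep
    rw [intermittentFormula_of_mem_half_false hα0 mq] at eq
    rw [intermittentFormula_of_mem_half_false hα0 mr] at er
    rw [intermittentFormula_of_mem_half_false hα0 ms] at es
    have h := neutralBranch_crossRatio_le hα0 hα1 up h1 h2 h3
    rw [ep, eq, er, es] at h
    linarith
  · rw [intermittentFormula_of_mem_half_true mp] at ep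
    rw [intermittentFormula_of_mem_half_true mq] at eq
    rw [intermittentFormula_of_mem_half_true mr] at er
    rw [intermittentFormula_of_mem_half_true ms] at es
    -- Reflection reverses the order of the four points, and the cross ratio is symmetric under this
    -- reversal.
    have h := neutralBranch_crossRatio_le hα0 hα1 (a := 1 - S) (b := 1 - R) (c := 1 - Q)
      (d := 1 - P) (by linarith) (by linarith) (by linarith) (by linarith)
    rw [show neutralBranch α (1 - S) = 1 - s by linarith,
      show neutralBranch α (1 - R) = 1 - r by linarith,
      show neutralBranch α (1 - Q) = 1 - q by linarith,
      show neutralBranch α (1 - P) = 1 - p by linarith] at h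
    linarith

/-- The composition of `n` inverse branches along `ω`; the branch `ω 0` is applied first. -/
def invBranches (α : ℝ) (ω : ℕ → Bool) : ℕ → ℝ → ℝ
  | 0 => id
  | n + 1 => invBranch α (ω n) ∘ invBranches α ω n

variable (ω : ℕ → Bool)

theorem invBranches_succ_apply (α : ℝ) (n : ℕ) (x : ℝ) :
    invBranches α ω (n + 1) x = invBranch α (ω n) (invBranches α ω n x) := rfl

/-- Peels off the branch applied first instead of the one applied last; this corresponds to the
shift in the functional equation of the fibre series. -/
theorem invBranches_succ_apply' (α : ℝ) (n : ℕ) (x : ℝ) :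
    invBranches α ω (n + 1) x =
      invBranches α (fun i => ω (i + 1)) n (invBranch α (ω 0) x) := by
  induction n with
  | zero => rfl
  | succ n ih => rw [invBranches_succ_apply, ih, invBranches_succ_apply]

theorem invBranches_mem (hα0 : 0 < α) (n : ℕ) {x : ℝ} (hx : x ∈ Ico (0 : ℝ) 1) :
    invBranches α ω n x ∈ Ico (0 : ℝ) 1 := by
  induction n with
  | zero => exact hx
  | succ n ih => exact half_subset _ (invBranch_mem hα0 _ ih)

theorem invBranches_mem_Ioo (hα0 : 0 < α) (n : ℕ) {x : ℝ} (hx : x ∈ Ioo (0 : ℝ) 1) :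
    invBranches α ω n x ∈ Ioo (0 : ℝ) 1 := by
  induction n with
  | zero => exact hx
  | succ n ih => exact invBranch_mem_Ioo hα0 _ ih

theorem intermittentFormula_invBranches_succ (hα0 : 0 < α) (n : ℕ) {x : ℝ}
    (hx : x ∈ Ico (0 : ℝ) 1) :
    intermittentFormula α (invBranches α ω (n + 1) x) = invBranches α ω n x :=
  intermittentFormula_invBranch hα0 _ (invBranches_mem ω hα0 n hx)

theorem halfSymbol_invBranches_succ (hα0 : 0 < α) (n : ℕ) {x : ℝ} (hx : x ∈ Ico (0 : ℝ) 1) :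
    halfSymbol (invBranches α ω (n + 1) x) = ω n :=
  halfSymbol_eq_of_mem (invBranch_mem hα0 _ (invBranches_mem ω hα0 n hx))

theorem iterate_invBranches (hα0 : 0 < α) (n k : ℕ) {x : ℝ} (hx : x ∈ Ico (0 : ℝ) 1) :
    (intermittentFormula α)^[k] (invBranches α ω (n + k) x) = invBranches α ω n x := by
  induction k with
  | zero => rfl
  | succ k ih =>
    rw [Function.iterate_succ_apply, ← add_assoc, intermittentFormula_invBranches_succ ω hα0 _ hx,
      ih]

theorem strictMonoOn_invBranches (hα0 : 0 < α) (n : ℕ) :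
    StrictMonoOn (invBranches α ω n) (Ico 0 1) := by
  induction n with
  | zero => exact strictMonoOn_id
  | succ n ih =>
    exact (strictMonoOn_invBranch hα0 _).comp ih fun x hx => invBranches_mem ω hα0 n hx

theorem contractsCrossRatio_invBranches (hα0 : 0 < α) (hα1 : α < 1) (n : ℕ) :
    ContractsCrossRatio (invBranches α ω n) (Ioo 0 1) := by
  induction n with
  | zero => 
    intro a _ b _ c _ d _ _ _ _
    exact le_of_eq (by simp only [invBranches, id]; ring)
  | succ n ih =>
    exact (contractsCrossRatio_invBranch hα0 hα1 _).comp ih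
      (fun x hx => invBranches_mem_Ioo ω hα0 n hx)
      ((strictMonoOn_invBranches ω hα0 n).mono Ioo_subset_Ico_self)
      ((strictMonoOn_invBranch hα0 _).mono Ioo_subset_Ico_self)

/-- One more inverse branch contracts by the derivative of the map at a lower bound `m`
for the distance to the neutral point. -/
theorem invBranches_succ_sub_le (hα0 : 0 < α) (n : ℕ) {m x y : ℝ} (hx : x ∈ Ico (0 : ℝ) 1)
    (hy : y ∈ Ico (0 : ℝ) 1) (hxy : x ≤ y) (hm : 0 ≤ m) (hmy : m ≤ invBranches α ω (n + 1) y)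
    (hmx : m ≤ 1 - invBranches α ω (n + 1) x) :
    (1 + 2 ^ α * m ^ α) * (invBranches α ω (n + 1) y - invBranches α ω (n + 1) x) ≤
      invBranches α ω n y - invBranches α ω n x := by
  have h := le_intermittentFormula_sub hα0 (invBranch_mem hα0 (ω n) (invBranches_mem ω hα0 n hx))
    (invBranch_mem hα0 (ω n) (invBranches_mem ω hα0 n hy))
    ((strictMonoOn_invBranches ω hα0 (n + 1)).monotoneOn hx hy hxy) hm hmy hmx
  rwa [intermittentFormula_invBranch hα0 _ (invBranches_mem ω hα0 n hx),
    intermittentFormula_invBranch hα0 _ (invBranches_mem ω hα0 n hy)] at h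

theorem invBranches_sub_le (hα0 : 0 < α) (n : ℕ) {x y : ℝ} (hx : x ∈ Ico (0 : ℝ) 1)
    (hy : y ∈ Ico (0 : ℝ) 1) (hxy : x ≤ y) :
    invBranches α ω n y - invBranches α ω n x ≤ y - x := by
  induction n with
  | zero => exact le_rfl
  | succ n ih =>
    have h := invBranches_succ_sub_le ω hα0 n hx hy hxy le_rfl
      (invBranches_mem ω hα0 (n + 1) hy).1
      (by linarith [(invBranches_mem ω hα0 (n + 1) hx).2])
    rw [Real.zero_rpow hα0.ne', mul_zero, add_zero, one_mul] at h
    exact h.trans ih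

theorem continuousOn_invBranches (hα0 : 0 < α) (n : ℕ) :
    ContinuousOn (invBranches α ω n) (Ico 0 1) := by
  refine (LipschitzOnWith.of_dist_le_mul (K := 1) fun x hx y hy => ?_).continuousOn
  rw [NNReal.coe_one, one_mul]
  wlog hxy : x ≤ y generalizing x y
  · rw [dist_comm, dist_comm x]; exact this y hy x hx (not_le.1 hxy).le
  rw [dist_comm, dist_comm x, Real.dist_eq, Real.dist_eq, abs_of_nonneg (sub_nonneg.2 hxy),
    abs_of_nonneg (sub_nonneg.2 ((strictMonoOn_invBranches ω hα0 n).monotoneOn hx hy hxy))]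
  exact invBranches_sub_le ω hα0 n hx hy hxy

/-- The cylinders of order `n` shrink uniformly. -/
theorem exists_forall_invBranches_sub_le (hα0 : 0 < α) {δ : ℝ} (hδ : 0 < δ) :
    ∃ N, ∀ n ≥ N, ∀ ω : ℕ → Bool, ∀ x ∈ Ico (0 : ℝ) 1, ∀ y ∈ Ico (0 : ℝ) 1,
      |invBranches α ω n y - invBranches α ω n x| ≤ δ := by
  have hr : 1 < 1 + (2 : ℝ) ^ α * δ ^ α := by
    have := Real.rpow_pos_of_pos hδ α
    have : 0 < (2 : ℝ) ^ α * δ ^ α := by positivity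
    linarith
  obtain ⟨N, hN⟩ := pow_unbounded_of_one_lt (1 / δ) hr
  refine ⟨N, fun n hn ω x hx y hy => ?_⟩
  wlog hxy : x ≤ y generalizing x y
  · rw [abs_sub_comm]; exact this y hy x hx (not_le.1 hxy).le
  have hmono : ∀ k, invBranches α ω k x ≤ invBranches α ω k y := fun k =>
    (strictMonoOn_invBranches ω hα0 k).monotoneOn hx hy hxy
  rw [abs_of_nonneg (sub_nonneg.2 (hmono n))]
  -- If the order-`n` image is longer than `δ`, so are all images of lower order. An interval of
  -- length at least `δ` has right end at least `δ` and left end at most `1 - δ`, so each step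
  -- towards order 0 stretches it by `1 + 2^α δ^α`. After `N` steps it would be longer than 1.
  by_contra! hlt
  have key : ∀ k ≤ n, (1 + (2 : ℝ) ^ α * δ ^ α) ^ k *
      (invBranches α ω n y - invBranches α ω n x) ≤
      invBranches α ω (n - k) y - invBranches α ω (n - k) x := by
    intro k
    induction k with
    | zero => intro _; simp
    | succ k ih =>
      intro hk
      have h1 := ih (by omega)
      obtain ⟨j, hj⟩ : ∃ j, n - k = j + 1 := ⟨n - k - 1, by omega⟩
      have hj' : n - (k + 1) = j := by omega
      rw [hj'] 
      rw [hj] at h1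
      have hge : δ ≤ invBranches α ω (j + 1) y - invBranches α ω (j + 1) x := by
        refine hlt.le.trans (le_trans ?_ h1)
        exact le_mul_of_one_le_left (sub_nonneg.2 (hmono n)) (one_le_pow₀ hr.le)
      have hx1 := invBranches_mem ω hα0 (j + 1) hx
      have hy1 := invBranches_mem ω hα0 (j + 1) hy
      have h2 := invBranches_succ_sub_le ω hα0 j hx hy hxy hδ.le (by linarith [hx1.1])
        (by linarith [hy1.2])
      refine le_trans ?_ h2
      rw [pow_succ', mul_assoc]
      exact mul_le_mul_of_nonneg_left h1 (by linarith)
  have h := key N hn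
  have hle : invBranches α ω (n - N) y - invBranches α ω (n - N) x ≤ 1 := by
    linarith [(invBranches_mem ω hα0 (n - N) hx).1, (invBranches_mem ω hα0 (n - N) hy).2]
  have h3 : 1 < (1 + (2 : ℝ) ^ α * δ ^ α) ^ N * δ := by
    rwa [div_lt_iff₀ hδ] at hN
  have h4 := mul_lt_mul_of_pos_left hlt (pow_pos (zero_lt_one.trans hr) N)
  linarith

end Branches

/-! ### Cylinders and bounded distortion -/

section Cylinders

variable {α : ℝ}

/-- The symbols of the first `n` points of the orbit of `x`, the latest one first. -/
def pastWord (α : ℝ) (n : ℕ) (x : ℝ) : Fin n → Bool :=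
  fun i => halfSymbol ((intermittentFormula α)^[n - 1 - i] x)

/-- Extension of a finite word by `false`. -/
def extendWord {n : ℕ} (a : Fin n → Bool) : ℕ → Bool :=
  fun i => if h : i < n then a ⟨i, h⟩ else false

theorem extendWord_of_lt {n : ℕ} (a : Fin n → Bool) {i : ℕ} (h : i < n) :
    extendWord a i = a ⟨i, h⟩ := dif_pos h

/-- The cylinder of all points of `[0, 1)` with a given word. -/
def pastCylinder (α : ℝ) {n : ℕ} (a : Fin n → Bool) : Set ℝ := Ico 0 1 ∩ pastWord α n ⁻¹' {a}

theorem measurable_pastWord (α : ℝ) (n : ℕ) : Measurable (pastWord α n) :=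
  measurable_pi_lambda _ fun _ =>
    measurable_halfSymbol.comp ((measurable_intermittentFormula α).iterate _)

/-- With the latest symbol first, symbol `k` selects the branch leading from `f^(n-k) x` back to
`f^(n-k-1) x`, so `invBranches` retraces the orbit. -/
theorem invBranches_pastWord (hα0 : 0 < α) (n : ℕ) {x : ℝ} (hx : x ∈ Ico (0 : ℝ) 1) :
    invBranches α (extendWord (pastWord α n x)) n ((intermittentFormula α)^[n] x) = x := by
  have key : ∀ k ≤ n, invBranches α (extendWord (pastWord α n x)) k
      ((intermittentFormula α)^[n] x) = (intermittentFormula α)^[n - k] x := by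
    intro k
    induction k with
    | zero => intro _; rfl
    | succ k ih =>
      intro hk
      rw [invBranches_succ_apply, ih (by omega), extendWord_of_lt _ (by omega : k < n), pastWord,
        show n - k = (n - 1 - k) + 1 by omega, Function.iterate_succ_apply',
        show n - (k + 1) = n - 1 - k by omega]
      exact invBranch_intermittentFormula hα0
        (mem_half_halfSymbol (iterate_intermittentFormula_mem hα0 hx _))
  simpa using key n le_rfl

theorem iterate_invBranches_self (hα0 : 0 < α) (ω : ℕ → Bool) (n : ℕ) {x : ℝ}
    (hx : x ∈ Ico (0 : ℝ) 1) : (intermittentFormula α)^[n] (invBranches α ω n x) = x := by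
  simpa [invBranches] using iterate_invBranches ω hα0 0 n hx

theorem invBranches_mem_cylinder (hα0 : 0 < α) {n : ℕ} (a : Fin n → Bool) {x : ℝ}
    (hx : x ∈ Ico (0 : ℝ) 1) : invBranches α (extendWord a) n x ∈ pastCylinder α a := by
  refine ⟨invBranches_mem _ hα0 n hx, ?_⟩
  simp only [mem_preimage, mem_singleton_iff]
  ext i
  have hi := i.2
  have h := iterate_invBranches (extendWord a) hα0 (i + 1) (n - 1 - i) hx
  rw [show (i : ℕ) + 1 + (n - 1 - i) = n by omega] at h
  rw [pastWord, h, halfSymbol_invBranches_succ _ hα0 _ hx, extendWord_of_lt a hi]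

/-- On a cylinder of order `n` the map `f^n` is a bijection onto `[0, 1)`, inverted by the
corresponding composition of branches. Distortion estimates thereby become estimates of the lengths
of images. -/
theorem cylinder_inter_preimage (hα0 : 0 < α) {n : ℕ} (a : Fin n → Bool) {A : Set ℝ}
    (hA : A ⊆ Ico 0 1) : pastCylinder α a ∩ (intermittentFormula α)^[n] ⁻¹' A =
      invBranches α (extendWord a) n '' A := by
  ext x
  constructor
  · rintro ⟨⟨hx, hxa⟩, hxA⟩
    refine ⟨_, hxA, ?_⟩
    rw [← (hxa : pastWord α n x = a)]
    exact invBranches_pastWord hα0 n hx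
  · rintro ⟨z, hz, rfl⟩
    refine ⟨invBranches_mem_cylinder hα0 a (hA hz), ?_⟩
    rw [mem_preimage, iterate_invBranches_self hα0 _ n (hA hz)]
    exact hz

/-- Upper Koebe bound: apply the cross ratio inequality to `ε/2 < x < y < 1 - ε/2`. On the right
both gaps of the image are at most its total length; on the left both outer gaps `x - ε/2` and `1 -
ε/2 - y` are at least `ε/2`. -/
theorem invBranches_sub_mul_le (hα0 : 0 < α) (hα1 : α < 1) (ω : ℕ → Bool) (n : ℕ) {ε x y : ℝ}
    (hε : 0 < ε) (hx : ε ≤ x) (hy : y ≤ 1 - ε) (hxy : x ≤ y) :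
    (invBranches α ω n y - invBranches α ω n x) * (ε / 2 * (ε / 2)) ≤
      (invBranches α ω n (1 - ε / 2) - invBranches α ω n (ε / 2)) * (y - x) := by
  rcases hxy.eq_or_lt with rfl | hxy
  · simp
  set g := invBranches α ω n
  have hm : StrictMonoOn g (Ico 0 1) := strictMonoOn_invBranches ω hα0 n
  have h := contractsCrossRatio_invBranches ω hα0 hα1 n (ε / 2) ⟨by linarith, by linarith⟩
    x ⟨by linarith, by linarith⟩ y ⟨by linarith, by linarith⟩ (1 - ε / 2)
    ⟨by linarith, by linarith⟩ (by linarith) hxy (by linarith)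
  change (g _ - g _) * (g _ - g _) * _ ≤ (g _ - g _) * (g _ - g _) * _ at h
  have m1 : g (ε / 2) < g x := hm ⟨by linarith, by linarith⟩ ⟨by linarith, by linarith⟩
    (by linarith)
  have m2 : g x < g y := hm ⟨by linarith, by linarith⟩ ⟨by linarith, by linarith⟩ hxy
  have m3 : g y < g (1 - ε / 2) := hm ⟨by linarith, by linarith⟩ ⟨by linarith, by linarith⟩
    (by linarith)
  have hL : 0 < g (1 - ε / 2) - g (ε / 2) := by linarith
  refine le_of_mul_le_mul_left ?_ hL
  calc (g (1 - ε / 2) - g (ε / 2)) * ((g y - g x) * (ε / 2 * (ε / 2)))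
      ≤ (g (1 - ε / 2) - g (ε / 2)) * (g y - g x) * ((x - ε / 2) * (1 - ε / 2 - y)) := by
        rw [mul_assoc]
        refine mul_le_mul_of_nonneg_left (mul_le_mul_of_nonneg_left ?_ (by linarith)) hL.le
        exact mul_le_mul (by linarith) (by linarith) (by linarith) (by linarith)
    _ ≤ _ := h
    _ ≤ (g (1 - ε / 2) - g (ε / 2)) * (g (1 - ε / 2) - g (ε / 2)) * (1 * (y - x)) := by
        refine mul_le_mul (mul_le_mul (by linarith) (by linarith) (by linarith) hL.le)
          (mul_le_mul_of_nonneg_right (by linarith) (by linarith))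
          (mul_nonneg (by linarith) (by linarith)) (mul_nonneg hL.le hL.le)
    _ = _ := by ring

/-- Lower Koebe bound. The image of `[ε, 1 - ε]` splits into the pieces left of, over and right of
`[x, y]`, which accounts for the 3. Each outer piece is compared with the middle one by a quadruple
that contains `x`, `y` and a collar of width `ε/2` beyond `ε` or `1 - ε`. -/
theorem sub_mul_le_invBranches_sub (hα0 : 0 < α) (hα1 : α < 1) (ω : ℕ → Bool) (n : ℕ) {ε x y : ℝ}
    (hε : 0 < ε) (hx : ε ≤ x) (hy : y ≤ 1 - ε) (hxy : x ≤ y) :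
    (invBranches α ω n (1 - ε) - invBranches α ω n ε) * (y - x) * (ε / 2) ≤
      3 * (invBranches α ω n y - invBranches α ω n x) := by
  rcases hxy.eq_or_lt with rfl | hxy
  · simp
  have hcr := contractsCrossRatio_invBranches ω hα0 hα1 n
  have hm : StrictMonoOn (invBranches α ω n) (Ico 0 1) := strictMonoOn_invBranches ω hα0 n
  set g := invBranches α ω n
  have m2 : g x < g y := hm ⟨by linarith, by linarith⟩ ⟨by linarith, by linarith⟩ hxy
  have right : (g (1 - ε) - g y) * (y - x) * (ε / 2) ≤ g y - g x := by
    rcases hy.eq_or_lt with rfl | hy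
    · simp; linarith
    have h := hcr x ⟨by linarith, by linarith⟩ y ⟨by linarith, by linarith⟩ (1 - ε)
      ⟨by linarith, by linarith⟩ (1 - ε / 2) ⟨by linarith, by linarith⟩ hxy hy (by linarith)
    have m3 : g y < g (1 - ε) := hm ⟨by linarith, by linarith⟩ ⟨by linarith, by linarith⟩ hy
    have m4 : g (1 - ε) < g (1 - ε / 2) := hm ⟨by linarith, by linarith⟩
      ⟨by linarith, by linarith⟩ (by linarith)
    refine le_of_mul_le_mul_left ?_ (by linarith : 0 < g (1 - ε / 2) - g x)
    calc _ = (g (1 - ε / 2) - g x) * (g (1 - ε) - g y) * ((y - x) * (1 - ε / 2 - (1 - ε))) := by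
          ring
      _ ≤ _ := h
      _ ≤ (g y - g x) * (g (1 - ε / 2) - g x) * (1 * 1) := by
        refine mul_le_mul (mul_le_mul_of_nonneg_left (by linarith) (by linarith))
          (mul_le_mul (by linarith) (by linarith) (by linarith) zero_le_one)
          (mul_nonneg (by linarith) (by linarith)) (mul_nonneg (by linarith) (by linarith))
      _ = _ := by ring
  have left : (g x - g ε) * (y - x) * (ε / 2) ≤ g y - g x := by
    rcases hx.eq_or_lt with rfl | hx
    · simp; linarith
    have h := hcr (ε / 2) ⟨by linarith, by linarith⟩ ε ⟨by linarith, by linarith⟩ x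
      ⟨by linarith, by linarith⟩ y ⟨by linarith, by linarith⟩ (by linarith) hx hxy
    have m3 : g ε < g x := hm ⟨by linarith, by linarith⟩ ⟨by linarith, by linarith⟩ hx
    have m4 : g (ε / 2) < g ε := hm ⟨by linarith, by linarith⟩
      ⟨by linarith, by linarith⟩ (by linarith)
    refine le_of_mul_le_mul_left ?_ (by linarith : 0 < g y - g (ε / 2))
    calc _ = (g y - g (ε / 2)) * (g x - g ε) * ((ε - ε / 2) * (y - x)) := by
          ring
      _ ≤ _ := h
      _ ≤ (g y - g (ε / 2)) * (g y - g x) * (1 * 1) := by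
        refine mul_le_mul (mul_le_mul_of_nonneg_right (by linarith) (by linarith))
          (mul_le_mul (by linarith) (by linarith) (by linarith) zero_le_one)
          (mul_nonneg (by linarith) (by linarith)) (mul_nonneg (by linarith) (by linarith))
      _ = _ := by ring
  have mid : (g y - g x) * (y - x) * (ε / 2) ≤ g y - g x := by
    rw [mul_assoc]
    refine mul_le_of_le_one_right (by linarith) ?_
    exact mul_le_one₀ (by linarith) (by linarith) (by linarith)
  linarith

theorem volume_image_le_of_sub_le {g : ℝ → ℝ} {A : Set ℝ} {C : ℝ}
    (h : ∀ x ∈ A, ∀ y ∈ A, |g x - g y| ≤ C * |x - y|) :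
    volume (g '' A) ≤ ENNReal.ofReal C * volume A := by
  have hl : LipschitzOnWith C.toNNReal g A := LipschitzOnWith.of_dist_le_mul fun x hx y hy => by
    rw [Real.dist_eq, Real.dist_eq]
    exact (h x hx y hy).trans (mul_le_mul_of_nonneg_right (Real.le_coe_toNNReal C) (abs_nonneg _))
  have := hl.hausdorffMeasure_image_le zero_le_one
  rwa [hausdorffMeasure_real, ENNReal.rpow_one] at this

/-- The branch onto the cylinder is Lipschitz on `[ε, 1 - ε]` with constant `4 / ε ^ 2` times the
length of the image of `[ε/2, 1 - ε/2]`, which lies in the cylinder. The factor `4 / ε ^ 2` does not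
depend on `n` or on the word. -/
theorem volume_cylinder_inter_le (hα0 : 0 < α) (hα1 : α < 1) {ε : ℝ} (hε : 0 < ε) {n : ℕ}
    (a : Fin n → Bool) {A : Set ℝ} (hA : A ⊆ Icc ε (1 - ε)) :
    volume (pastCylinder α a ∩ (intermittentFormula α)^[n] ⁻¹' A) ≤
      ENNReal.ofReal (4 / ε ^ 2) * (volume (pastCylinder α a) * volume A) := by
  rcases A.eq_empty_or_nonempty with rfl | ⟨z, hz⟩
  · simp
  have hε2 : ε ≤ 1 - ε := (hA hz).1.trans (hA hz).2
  have hA' : A ⊆ Ico 0 1 := fun x hx => ⟨by linarith [(hA hx).1], by linarith [(hA hx).2]⟩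
  have hm : StrictMonoOn (invBranches α (extendWord a) n) (Ico 0 1) :=
    strictMonoOn_invBranches _ hα0 n
  have hc := continuousOn_invBranches (extendWord a) hα0 n
  have hle := fun x y => invBranches_sub_mul_le hα0 hα1 (extendWord a) n (x := x) (y := y) hε
  have hcyl := cylinder_inter_preimage hα0 a (subset_refl (Ico (0 : ℝ) 1))
  rw [cylinder_inter_preimage hα0 a hA']
  set g := invBranches α (extendWord a) n
  have hlen : ENNReal.ofReal (g (1 - ε / 2) - g (ε / 2)) ≤ volume (pastCylinder α a) := by
    rw [← Real.volume_Icc]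
    refine measure_mono (subset_trans ?_ (subset_trans hcyl.symm.subset inter_subset_left))
    have hs : Icc (ε / 2) (1 - ε / 2) ⊆ Ico 0 1 := fun x hx =>
      ⟨by linarith [hx.1], by linarith [hx.2]⟩
    exact (intermediate_value_Icc (by linarith) (hc.mono hs)).trans (image_mono hs)
  have hL : 0 ≤ g (1 - ε / 2) - g (ε / 2) :=
    sub_nonneg.2 (hm.monotoneOn ⟨by linarith, by linarith⟩ ⟨by linarith, by linarith⟩
      (by linarith))
  have hlip : volume (g '' A) ≤
      ENNReal.ofReal (4 / ε ^ 2 * (g (1 - ε / 2) - g (ε / 2))) * volume A := by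
    apply volume_image_le_of_sub_le
    intro x hx y hy
    wlog hxy : y ≤ x generalizing x y
    · rw [abs_sub_comm, abs_sub_comm x]; exact this y hy x hx (not_le.1 hxy).le
    have := hle y x (hA hy).1 (hA hx).2 hxy
    rw [abs_of_nonneg (sub_nonneg.2 hxy),
      abs_of_nonneg (sub_nonneg.2 (hm.monotoneOn (hA' hy) (hA' hx) hxy))]
    rw [div_mul_eq_mul_div, div_mul_eq_mul_div, le_div_iff₀ (by positivity)]
    nlinarith
  refine hlip.trans ?_
  rw [ENNReal.ofReal_mul (by positivity), mul_assoc]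
  gcongr

/-- Counterpart of the upper bound, from the Lipschitz constant of `f^n` on the image of `[ε, 1 -
ε]`. Only the part of the cylinder that lands in `[ε, 1 - ε]` enters the comparison. -/
theorem volume_mul_le_volume_cylinder_inter (hα0 : 0 < α) (hα1 : α < 1) {ε : ℝ} (hε : 0 < ε)
    {n : ℕ} (a : Fin n → Bool) {A : Set ℝ} (hA : A ⊆ Icc ε (1 - ε)) :
    volume (pastCylinder α a ∩ (intermittentFormula α)^[n] ⁻¹' (Icc ε (1 - ε))) * volume A ≤
      ENNReal.ofReal (6 / ε) * volume (pastCylinder α a ∩ (intermittentFormula α)^[n] ⁻¹' A) := by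
  rcases A.eq_empty_or_nonempty with rfl | ⟨z, hz⟩
  · simp
  have hε2 : ε ≤ 1 - ε := (hA hz).1.trans (hA hz).2
  have hK : Icc ε (1 - ε) ⊆ Ico 0 1 := fun x hx => ⟨by linarith [hx.1], by linarith [hx.2]⟩
  rw [cylinder_inter_preimage hα0 a (hA.trans hK), cylinder_inter_preimage hα0 a hK]
  have hm : StrictMonoOn (invBranches α (extendWord a) n) (Ico 0 1) :=
    strictMonoOn_invBranches _ hα0 n
  have hle := fun x y => sub_mul_le_invBranches_sub hα0 hα1 (extendWord a) n (x := x) (y := y) hε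
  have hinv : ∀ x ∈ Ico (0 : ℝ) 1, (intermittentFormula α)^[n]
    (invBranches α (extendWord a) n x) = x := fun x hx => iterate_invBranches_self hα0 _ n hx
  set g := invBranches α (extendWord a) n
  set L := g (1 - ε) - g ε with hLdef
  have hlt : ε < 1 - ε ∨ ε = 1 - ε := hε2.lt_or_eq
  rcases hlt with hlt | heq
  swap
  · have : A ⊆ {ε} := fun x hx => le_antisymm (by linarith [(hA hx).2]) (hA hx).1
    rw [measure_mono_null this Real.volume_singleton, mul_zero]
    exact zero_le
  have hL : 0 < L := sub_pos.2 (hm (hK ⟨le_rfl, hε2⟩) (hK ⟨hε2, le_rfl⟩) hlt)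
  have hKle : volume (g '' Icc ε (1 - ε)) ≤ ENNReal.ofReal L := by
    rw [← Real.volume_Icc]
    refine measure_mono ?_
    rintro _ ⟨x, hx, rfl⟩
    exact ⟨hm.monotoneOn (hK ⟨le_rfl, hε2⟩) (hK hx) hx.1,
      hm.monotoneOn (hK hx) (hK ⟨hε2, le_rfl⟩) hx.2⟩
  have hback : volume A ≤ ENNReal.ofReal (6 / ε / L) * volume (g '' A) := by
    have himg : (intermittentFormula α)^[n] '' (g '' A) = A := by
      rw [image_image]
      conv_rhs => rw [← image_id A]
      exact image_congr fun x hx => hinv x (hK (hA hx))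
    conv_lhs => rw [← himg]
    apply volume_image_le_of_sub_le
    rintro _ ⟨x, hx, rfl⟩ _ ⟨y, hy, rfl⟩
    rw [hinv x (hK (hA hx)), hinv y (hK (hA hy))]
    wlog hxy : y ≤ x generalizing x y
    · rw [abs_sub_comm, abs_sub_comm (g x)]; exact this y hy x hx (not_le.1 hxy).le
    have := hle y x (hA hy).1 (hA hx).2 hxy
    rw [abs_of_nonneg (sub_nonneg.2 hxy),
      abs_of_nonneg (sub_nonneg.2 (hm.monotoneOn (hK (hA hy)) (hK (hA hx)) hxy))]
    rw [div_div, div_mul_eq_mul_div, le_div_iff₀ (by positivity)]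
    nlinarith
  calc _ ≤ ENNReal.ofReal L * (ENNReal.ofReal (6 / ε / L) * volume (g '' A)) :=
        mul_le_mul' hKle hback
    _ = _ := by
        rw [← mul_assoc, ← ENNReal.ofReal_mul hL.le, mul_div_cancel₀ _ hL.ne']

end Cylinders

/-! ### Absolutely continuous measures are almost constant on small cylinders -/

theorem lintegral_comp_mul_comp {X ι : Type*} [MeasurableSpace X] [Fintype ι] [MeasurableSpace ι]
    [DiscreteMeasurableSpace ι] (m : Measure X) {W : X → ι} (hW : Measurable W) (c : ι → ℝ≥0∞) :
    ∫⁻ x, c (W x) ∂m = ∑ a, c a * m (W ⁻¹' {a}) := by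
  rw [← lintegral_map (f := c) Measurable.of_discrete hW, lintegral_fintype]
  exact Finset.sum_congr rfl fun a _ => by rw [Measure.map_apply hW (measurableSet_singleton a)]

theorem withDensity_comp_apply {X ι : Type*} [MeasurableSpace X] [Fintype ι] [MeasurableSpace ι]
    [DiscreteMeasurableSpace ι] (m : Measure X) {W : X → ι} (hW : Measurable W) (c : ι → ℝ≥0∞)
    {S : Set X} (hS : MeasurableSet S) :
    m.withDensity (fun x => c (W x)) S = ∑ a, c a * m (W ⁻¹' {a} ∩ S) := by
  rw [withDensity_apply _ hS, lintegral_comp_mul_comp _ hW]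
  exact Finset.sum_congr rfl fun a _ => by
    rw [Measure.restrict_apply (hW (measurableSet_singleton a))]

section Density

variable {α : ℝ}

theorem restrict_preimage_pastWord_inter {n : ℕ} (a : Fin n → Bool) {S : Set ℝ}
    (hS : MeasurableSet S) :
    volume.restrict (Ico 0 1) (pastWord α n ⁻¹' {a} ∩ S) = volume (pastCylinder α a ∩ S) := by
  rw [Measure.restrict_apply ((measurable_pastWord α n (measurableSet_singleton a)).inter hS),
    pastCylinder]
  congr 1
  ext x
  simp only [mem_inter_iff]
  tauto

/-- Approximate the density in `L¹` by a compactly supported continuous function. It is uniformly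
continuous and cylinders shrink uniformly, so on each it is close to one of its values. The single
measure `err` controls the difference in both directions. -/
theorem exists_density_const_on_cylinders (hα0 : 0 < α) {m : Measure ℝ} [IsFiniteMeasure m]
    (hm : m ≪ volume.restrict (Ico 0 1)) {δ : ℝ} (hδ : 0 < δ) :
    ∃ N, ∀ n ≥ N, ∃ (c : (Fin n → Bool) → ℝ≥0∞) (err : Measure ℝ), err univ ≤ ENNReal.ofReal δ ∧
      m ≤ (volume.restrict (Ico 0 1)).withDensity (fun x => c (pastWord α n x)) + err ∧
      (volume.restrict (Ico 0 1)).withDensity (fun x => c (pastWord α n x)) ≤ m + err := by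
  set l : Measure ℝ := volume.restrict (Ico 0 1) with hl
  have hl1 : l univ = 1 := by simp [hl]
  have : IsProbabilityMeasure l := ⟨hl1⟩
  set h := m.rnDeriv l with hh
  have hmeas : Measurable h := Measure.measurable_rnDeriv _ _
  have hint : Integrable (fun x => (h x).toReal) l := Measure.integrable_toReal_rnDeriv
  obtain ⟨g, hgs, hgint, hgc, hgi⟩ := hint.exists_hasCompactSupport_integral_sub_le
    (ε := δ / 2) (by linarith)
  have huc : UniformContinuous g := hgs.uniformContinuous_of_continuous hgc
  obtain ⟨ρ, hρ, hρg⟩ := Metric.uniformContinuous_iff.1 huc (δ / 2) (by linarith)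
  obtain ⟨N, hN⟩ := exists_forall_invBranches_sub_le hα0 (half_pos hρ)
  refine ⟨N, fun n hn => ?_⟩
  -- The sample point in each cylinder is the preimage of `0` under `f^n`.
  let c : (Fin n → Bool) → ℝ≥0∞ := fun a => ENNReal.ofReal (g (invBranches α (extendWord a) n 0))
  let e : ℝ → ℝ≥0∞ := fun x => ENNReal.ofReal (‖(h x).toReal - g x‖ + δ / 2)
  have hc : Measurable fun x => c (pastWord α n x) :=
    (Measurable.of_discrete (f := c)).comp (measurable_pastWord α n)
  have he : Measurable e := by
    have := hgc.measurable
    fun_prop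
  have hclose : ∀ x ∈ Ico (0 : ℝ) 1,
      |g x - g (invBranches α (extendWord (pastWord α n x)) n 0)| ≤ δ / 2 := by
    intro x hx
    have h1 := hN n hn (extendWord (pastWord α n x)) 0 ⟨le_rfl, zero_lt_one⟩ _
      (iterate_intermittentFormula_mem hα0 hx n)
    rw [invBranches_pastWord hα0 n hx] at h1
    exact (hρg (lt_of_le_of_lt h1 (by linarith))).le
  have hmd : m = l.withDensity h := (Measure.withDensity_rnDeriv_eq m l hm).symm
  have hfin : ∀ᵐ x ∂l, h x < ∞ := Measure.rnDeriv_lt_top m l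
  have hmem : ∀ᵐ x ∂l, x ∈ Ico (0 : ℝ) 1 := ae_restrict_mem measurableSet_Ico
  refine ⟨c, l.withDensity e, ?_, ?_, ?_⟩
  · have hi : Integrable (fun x => ‖(h x).toReal - g x‖ + δ / 2) l :=
      (hint.sub hgi).norm.add (integrable_const _)
    rw [withDensity_apply _ MeasurableSet.univ, Measure.restrict_univ,
      ← ofReal_integral_eq_lintegral_ofReal hi (ae_of_all _ fun x => by positivity)]
    apply ENNReal.ofReal_le_ofReal
    have hi' : Integrable (fun x => ‖(h x).toReal - g x‖) l := (hint.sub hgi).norm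
    rw [integral_add hi' (integrable_const _)]
    simp only [integral_const, measureReal_def, hl1, ENNReal.toReal_one, one_smul]
    linarith
  · conv_lhs => rw [hmd]
    rw [← withDensity_add_left hc]
    refine withDensity_mono ?_
    filter_upwards [hfin, hmem] with x hx hx01
    rw [← ENNReal.ofReal_toReal hx.ne]
    refine (ENNReal.ofReal_le_ofReal ?_).trans ENNReal.ofReal_add_le
    have h1 := (abs_le.1 (hclose x hx01)).2
    have h2 := le_abs_self ((h x).toReal - g x)
    rw [Real.norm_eq_abs]
    linarith
  · conv_rhs => rw [hmd]
    rw [← withDensity_add_left hmeas]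
    refine withDensity_mono ?_
    filter_upwards [hfin, hmem] with x hx hx01
    simp only [Pi.add_apply]
    nth_rewrite 1 [← ENNReal.ofReal_toReal hx.ne]
    refine (ENNReal.ofReal_le_ofReal ?_).trans ENNReal.ofReal_add_le
    have h1 := (abs_le.1 (hclose x hx01)).1
    have h2 := neg_abs_le ((h x).toReal - g x)
    rw [Real.norm_eq_abs]
    linarith

theorem ENNReal_le_of_forall_ofReal_le {a b K : ℝ≥0∞} (hK : K ≠ ∞)
    (h : ∀ δ : ℝ, 0 < δ → a ≤ b + K * ENNReal.ofReal δ) : a ≤ b := by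
  have ht : Tendsto (fun δ : ℝ => b + K * ENNReal.ofReal δ) (𝓝[>] 0) (𝓝 (b + K * 0)) := by
    refine Tendsto.mono_left ?_ nhdsWithin_le_nhds
    refine Tendsto.const_add _ (ENNReal.Tendsto.const_mul ?_ (Or.inr hK))
    simpa using (ENNReal.continuous_ofReal.tendsto 0)
  rw [mul_zero, add_zero] at ht
  exact ge_of_tendsto ht (by filter_upwards [self_mem_nhdsWithin] with δ hδ using h δ hδ)

/-- An absolutely continuous invariant measure is bounded below by a multiple of Lebesgue
measure away from the neutral fixed point. -/
theorem measure_mul_volume_le (hα0 : 0 < α) (hα1 : α < 1) {m : Measure ℝ} [IsFiniteMeasure m]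
    (hm : m ≪ volume.restrict (Ico 0 1)) (hinv : MeasurePreserving (intermittentFormula α) m m)
    {ε : ℝ} (hε : 0 < ε) {A : Set ℝ} (hA : A ⊆ Icc ε (1 - ε)) (hAm : MeasurableSet A) :
    m (Icc ε (1 - ε)) * volume A ≤ ENNReal.ofReal (6 / ε) * m A := by
  set C := ENNReal.ofReal (6 / ε)
  have hA1 : volume A ≤ 1 := by
    refine (measure_mono hA).trans ?_
    rw [Real.volume_Icc]
    exact ENNReal.ofReal_le_one.2 (by linarith)
  refine ENNReal_le_of_forall_ofReal_le (K := C + 1) (by finiteness) fun δ hδ => ?_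
  obtain ⟨N, hN⟩ := exists_density_const_on_cylinders hα0 hm hδ
  obtain ⟨c, err, herr, h1, h2⟩ := hN N le_rfl
  set l : Measure ℝ := volume.restrict (Ico 0 1)
  set m' := l.withDensity (fun x => c (pastWord α N x))
  set T := (intermittentFormula α)^[N]
  have hT : Measurable T := (measurable_intermittentFormula α).iterate _
  have hinvN : ∀ S, MeasurableSet S → m (T ⁻¹' S) = m S := fun S hS =>
    (hinv.iterate N).measure_preimage hS.nullMeasurableSet
  have herr' : ∀ S, err S ≤ ENNReal.ofReal δ := fun S => (measure_mono (subset_univ S)).trans herr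
  have hm' : ∀ S, MeasurableSet S → m' S = ∑ a, c a * volume (pastCylinder α a ∩ S) := fun S hS => by
    rw [withDensity_comp_apply l (measurable_pastWord α N) c hS]
    exact Finset.sum_congr rfl fun a _ => by rw [restrict_preimage_pastWord_inter a hS]
  -- For a density constant on cylinders the claim is the distortion estimate summed over words with
  -- weights `c a`. Invariance is applied to `m`, before and after the passage to `m'`.
  have key : m' (T ⁻¹' Icc ε (1 - ε)) * volume A ≤ C * m' (T ⁻¹' A) := by
    rw [hm' _ (hT measurableSet_Icc), hm' _ (hT hAm), Finset.sum_mul, Finset.mul_sum]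
    refine Finset.sum_le_sum fun a _ => ?_
    calc _ = c a * (volume (pastCylinder α a ∩ T ⁻¹' Icc ε (1 - ε)) * volume A) := by ring
      _ ≤ c a * (C * volume (pastCylinder α a ∩ T ⁻¹' A)) := by
        exact mul_le_mul' le_rfl (volume_mul_le_volume_cylinder_inter hα0 hα1 hε a hA)
      _ = _ := by ring
  calc m (Icc ε (1 - ε)) * volume A
      = m (T ⁻¹' Icc ε (1 - ε)) * volume A := by rw [hinvN _ measurableSet_Icc]
    _ ≤ (m' (T ⁻¹' Icc ε (1 - ε)) + ENNReal.ofReal δ) * volume A := by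
        gcongr
        exact (h1 _).trans (by rw [Measure.add_apply]; gcongr; exact herr' _)
    _ = m' (T ⁻¹' Icc ε (1 - ε)) * volume A + ENNReal.ofReal δ * volume A := add_mul _ _ _
    _ ≤ C * (m A + ENNReal.ofReal δ) + ENNReal.ofReal δ * 1 := by
        refine add_le_add (key.trans (mul_le_mul' le_rfl ?_)) (mul_le_mul' le_rfl hA1)
        refine (h2 _).trans ?_
        rw [Measure.add_apply, hinvN _ hAm]
        gcongr
        exact herr' _
    _ = _ := by ring

/-- Away from the neutral fixed point the joint law of the past and the present is bounded above
by a multiple of the product of the law of the past and Lebesgue measure. -/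
theorem measure_pastWord_iterate_le (hα0 : 0 < α) (hα1 : α < 1) {m : Measure ℝ}
    [IsFiniteMeasure m] (hm : m ≪ volume.restrict (Ico 0 1)) {ε : ℝ} (hε : 0 < ε) {δ : ℝ}
    (hδ : 0 < δ) : ∃ N, ∀ n ≥ N, ∀ E : (Fin n → Bool) → Set ℝ, (∀ a, MeasurableSet (E a)) →
      (∀ a, E a ⊆ Icc ε (1 - ε)) →
      m {x | (intermittentFormula α)^[n] x ∈ E (pastWord α n x)} ≤
        ENNReal.ofReal (4 / ε ^ 2) * ∫⁻ x, volume (E (pastWord α n x)) ∂m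
          + (ENNReal.ofReal (4 / ε ^ 2) + 1) * ENNReal.ofReal δ := by
  obtain ⟨N, hN⟩ := exists_density_const_on_cylinders hα0 hm hδ
  refine ⟨N, fun n hn E hE hEK => ?_⟩
  obtain ⟨c, err, herr, h1, h2⟩ := hN n hn
  set C := ENNReal.ofReal (4 / ε ^ 2)
  set l : Measure ℝ := volume.restrict (Ico 0 1)
  set T := (intermittentFormula α)^[n]
  have hT : Measurable T := (measurable_intermittentFormula α).iterate _
  have hW := measurable_pastWord α n
  have hS : MeasurableSet {x | T x ∈ E (pastWord α n x)} := by
    have : {x | T x ∈ E (pastWord α n x)} = ⋃ a, (pastWord α n ⁻¹' {a} ∩ T ⁻¹' E a) := by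
      ext x; simp
    rw [this]
    exact MeasurableSet.iUnion fun a => (hW (measurableSet_singleton a)).inter (hT (hE a))
  have hE1 : ∀ a, volume (E a) ≤ 1 := fun a => by
    refine (measure_mono (hEK a)).trans ?_
    rw [Real.volume_Icc]
    exact ENNReal.ofReal_le_one.2 (by linarith)
  set m' := l.withDensity (fun x => c (pastWord α n x)) with hm'
  have hcm : Measurable fun x => c (pastWord α n x) := (Measurable.of_discrete (f := c)).comp hW
  have hvm : Measurable fun x => volume (E (pastWord α n x)) :=
    (Measurable.of_discrete (f := fun a => volume (E a))).comp hW
  have key : m' {x | T x ∈ E (pastWord α n x)} ≤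
      C * ∫⁻ x, volume (E (pastWord α n x)) ∂m' := by
    rw [hm', lintegral_withDensity_eq_lintegral_mul _ hcm hvm,
      withDensity_comp_apply l hW c hS]
    have := lintegral_comp_mul_comp l hW (fun a => c a * volume (E a))
    simp only [Pi.mul_apply]
    rw [this, Finset.mul_sum]
    refine Finset.sum_le_sum fun a _ => ?_
    have e1 : pastWord α n ⁻¹' {a} ∩ {x | T x ∈ E (pastWord α n x)} =
        pastWord α n ⁻¹' {a} ∩ T ⁻¹' E a := by
      ext x
      simp only [mem_inter_iff, mem_preimage, mem_singleton_iff, mem_ofPred_eq]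
      exact and_congr_right fun h => by rw [h]
    have e2 : l (pastWord α n ⁻¹' {a}) = volume (pastCylinder α a) := by
      have := restrict_preimage_pastWord_inter (α := α) a MeasurableSet.univ
      rwa [inter_univ, inter_univ] at this
    rw [e1, e2, restrict_preimage_pastWord_inter a (hT (hE a))]
    calc _ ≤ c a * (C * (volume (pastCylinder α a) * volume (E a))) := by
          gcongr
          exact volume_cylinder_inter_le hα0 hα1 hε a (hEK a)
      _ = _ := by ring
  calc _ ≤ m' {x | T x ∈ E (pastWord α n x)} + ENNReal.ofReal δ := by
        refine (h1 _).trans ?_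
        rw [Measure.add_apply]
        gcongr
        exact (measure_mono (subset_univ _)).trans herr
    _ ≤ C * ∫⁻ x, volume (E (pastWord α n x)) ∂m' + ENNReal.ofReal δ := by gcongr
    -- Returning from `m'` to `m` costs at most `δ`, because each `E a` has volume at most 1.
    _ ≤ C * ∫⁻ x, volume (E (pastWord α n x)) ∂(m + err) + ENNReal.ofReal δ := by
        gcongr
    _ ≤ C * (∫⁻ x, volume (E (pastWord α n x)) ∂m + ENNReal.ofReal δ) + ENNReal.ofReal δ := by
        rw [lintegral_add_measure]
        gcongr
        refine (lintegral_mono fun x => hE1 _).trans ?_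
        rw [lintegral_one]
        exact herr
    _ = _ := by ring

/-- An absolutely continuous invariant measure of the intermittent map is equivalent to Lebesgue
measure. -/
theorem restrict_volume_absolutelyContinuous (hα0 : 0 < α) (hα1 : α < 1) {m : Measure ℝ}
    [IsFiniteMeasure m] (hm : m ≪ volume.restrict (Ico 0 1))
    (hinv : MeasurePreserving (intermittentFormula α) m m) (hm0 : m ≠ 0) :
    volume.restrict (Ico 0 1) ≪ m := by
  have hmono : Monotone fun k : ℕ => Icc (1 / ((k : ℝ) + 1)) (1 - 1 / ((k : ℝ) + 1)) := by
    intro j k hjk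
    have : 1 / ((k : ℝ) + 1) ≤ 1 / ((j : ℝ) + 1) := by gcongr
    exact Icc_subset_Icc this (by linarith)
  have hunion : ⋃ k : ℕ, Icc (1 / ((k : ℝ) + 1)) (1 - 1 / ((k : ℝ) + 1)) = Ioo 0 1 := by
    ext x
    simp only [mem_iUnion, mem_Icc, mem_Ioo]
    constructor
    · rintro ⟨k, h1, h2⟩
      have : 0 < 1 / ((k : ℝ) + 1) := by positivity
      constructor <;> linarith
    · rintro ⟨h1, h2⟩
      obtain ⟨k, hk⟩ := exists_nat_one_div_lt (lt_min h1 (sub_pos.2 h2))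
      exact ⟨k, (hk.le.trans (min_le_left _ _)), by linarith [hk.le.trans (min_le_right _ _)]⟩
  have hIoo : m (Ioo 0 1) ≠ 0 := by
    intro h0
    apply hm0
    rw [← Measure.measure_univ_eq_zero]
    have h1 : m (Ioo 0 1)ᶜ = 0 := by
      apply hm
      rw [← restrict_Ioo_eq_restrict_Ico, Measure.restrict_apply measurableSet_Ioo.compl,
        compl_inter_self, measure_empty]
    rw [← union_compl_self (Ioo (0 : ℝ) 1)]
    exact measure_union_null h0 h1
  -- One compact interval of positive measure suffices: all larger ones then have positive measure
  -- too, and the lower bound turns `m A = 0` into `volume A = 0` on each of them.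
  have hex : ∃ k : ℕ, m (Icc (1 / ((k : ℝ) + 1)) (1 - 1 / ((k : ℝ) + 1))) ≠ 0 := by
    by_contra! h
    exact hIoo (by rw [← hunion]; exact measure_iUnion_null h)
  obtain ⟨k, hk⟩ := hex
  refine Measure.AbsolutelyContinuous.mk fun A hA hA0 => ?_
  rw [← restrict_Ioo_eq_restrict_Ico, Measure.restrict_apply hA, ← hunion, inter_iUnion]
  have hnull : ∀ j ≥ k, volume (A ∩ Icc (1 / ((j : ℝ) + 1)) (1 - 1 / ((j : ℝ) + 1))) = 0 := by
    intro j hj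
    have h := measure_mul_volume_le hα0 hα1 hm hinv (ε := 1 / ((j : ℝ) + 1)) (by positivity)
      (A := A ∩ Icc (1 / ((j : ℝ) + 1)) (1 - 1 / ((j : ℝ) + 1))) inter_subset_right
      (hA.inter measurableSet_Icc)
    rw [measure_mono_null inter_subset_left hA0, mul_zero, nonpos_iff_eq_zero, mul_eq_zero] at h
    refine h.resolve_left fun h' => hk (measure_mono_null (hmono hj) h')
  refine measure_iUnion_null fun j => ?_
  exact measure_mono_null (inter_subset_inter_right _ (hmono (le_max_left j k)))
    (hnull (max j k) (le_max_right j k))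

end Density

/-! ### The intermittent map on the circle -/

/-- The representative in `[0, 1)` of a point of the circle. -/
def circleRep (x : Circle1) : ℝ := AddCircle.equivIco 1 0 x

theorem circleRep_mem (x : Circle1) : circleRep x ∈ Ico (0 : ℝ) 1 := by
  have h := (AddCircle.equivIco 1 0 x).2
  exact ⟨h.1, h.2.trans_eq (zero_add 1)⟩

@[simp] theorem coe_circleRep (x : Circle1) : ((circleRep x : ℝ) : Circle1) = x :=
  (AddCircle.equivIco 1 0).symm_apply_apply x

theorem circleRep_coe {t : ℝ} (ht : t ∈ Ico (0 : ℝ) 1) : circleRep (t : Circle1) = t := by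
  rw [circleRep, AddCircle.equivIco_coe_eq (by simpa using ht)]

theorem circleRep_injective : Function.Injective circleRep :=
  Function.LeftInverse.injective coe_circleRep

theorem measurable_circleRep : Measurable circleRep :=
  measurable_subtype_coe.comp (AddCircle.measurableEquivIco 1 0).measurable

theorem intermittentMap_eq (α : ℝ) (x : Circle1) :
    intermittentMap α x = (intermittentFormula α (circleRep x) : Circle1) := rfl

theorem circleRep_intermittentMap {α : ℝ} (hα0 : 0 < α) (x : Circle1) :
    circleRep (intermittentMap α x) = intermittentFormula α (circleRep x) :=
  circleRep_coe (intermittentFormula_mem hα0 (circleRep_mem x))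

theorem circleRep_iterate_intermittentMap {α : ℝ} (hα0 : 0 < α) (n : ℕ) (x : Circle1) :
    circleRep ((intermittentMap α)^[n] x) = (intermittentFormula α)^[n] (circleRep x) :=
  Function.Semiconj.iterate_right (circleRep_intermittentMap hα0) n x

theorem measurable_intermittentMap (α : ℝ) : Measurable (intermittentMap α) :=
  AddCircle.measurable_mk'.comp ((measurable_intermittentFormula α).comp measurable_circleRep)

theorem map_coe_restrict_volume :
    (volume.restrict (Ico (0 : ℝ) 1)).map ((↑) : ℝ → Circle1) = volume := by
  have := (AddCircle.measurePreserving_mk 1 0).map_eq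
  rwa [zero_add, ← restrict_Ico_eq_restrict_Ioc] at this

theorem map_circleRep_volume :
    (volume : Measure Circle1).map circleRep = volume.restrict (Ico (0 : ℝ) 1) := by
  rw [← map_coe_restrict_volume, Measure.map_map measurable_circleRep AddCircle.measurable_mk']
  conv_rhs => rw [← Measure.map_id (μ := volume.restrict (Ico (0 : ℝ) 1))]
  refine Measure.map_congr ?_
  filter_upwards [ae_restrict_mem measurableSet_Ico] with t ht using circleRep_coe ht

theorem map_circleRep_absolutelyContinuous {m : Measure Circle1} (hm : m ≪ volume) :
    m.map circleRep ≪ volume.restrict (Ico (0 : ℝ) 1) := by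
  rw [← map_circleRep_volume]
  exact hm.map measurable_circleRep

theorem measurePreserving_map_circleRep {α : ℝ} (hα0 : 0 < α) {m : Measure Circle1}
    (hm : MeasurePreserving (intermittentMap α) m m) :
    MeasurePreserving (intermittentFormula α) (m.map circleRep) (m.map circleRep) := by
  refine ⟨measurable_intermittentFormula α, ?_⟩
  rw [Measure.map_map (measurable_intermittentFormula α) measurable_circleRep]
  have : intermittentFormula α ∘ circleRep = circleRep ∘ intermittentMap α :=
    funext fun x => (circleRep_intermittentMap hα0 x).symm
  rw [this, ← Measure.map_map measurable_circleRep hm.measurable, hm.map_eq]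

theorem volume_absolutelyContinuous {α : ℝ} (hα0 : 0 < α) (hα1 : α < 1) {m : Measure Circle1}
    [IsFiniteMeasure m] (hm : m ≪ volume) (hinv : MeasurePreserving (intermittentMap α) m m)
    (hm0 : m ≠ 0) : volume ≪ m := by
  have h := restrict_volume_absolutelyContinuous hα0 hα1 (map_circleRep_absolutelyContinuous hm)
    (measurePreserving_map_circleRep hα0 hinv)
    (by rwa [Ne, Measure.map_eq_zero_iff measurable_circleRep.aemeasurable])
  have h2 := h.map (f := ((↑) : ℝ → Circle1)) AddCircle.measurable_mk'
  rw [map_coe_restrict_volume, Measure.map_map AddCircle.measurable_mk' measurable_circleRep] at h2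
  have e : ((↑) : ℝ → Circle1) ∘ circleRep = id := funext coe_circleRep
  rwa [e, Measure.map_id] at h2

/-- The restriction of `μ` to an invariant set of positive measure is again invariant and absolutely
continuous, hence equivalent to Lebesgue measure; so the complement is null. -/
theorem IsCircleSRB.ergodic {α : ℝ} (hα0 : 0 < α) (hα1 : α < 1) {μ : Measure Circle1}
    (hμ : IsCircleSRB (intermittentMap α) μ) : Ergodic (intermittentMap α) μ := by
  have := hμ.isProb
  refine ⟨hμ.invariant, ⟨fun {s} hs hinv => ?_⟩⟩
  by_cases h0 : μ s = 0
  · rw [eventuallyConst_set']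
    exact Or.inl (ae_eq_empty.2 h0)
  · have hpres := hμ.invariant.restrict_preimage hs
    rw [hinv] at hpres
    have hv := volume_absolutelyContinuous hα0 hα1
      (Measure.absolutelyContinuous_of_le Measure.restrict_le_self |>.trans hμ.absCont) hpres
      (by rwa [Ne, Measure.restrict_eq_zero])
    have hc : μ.restrict s sᶜ = 0 := by
      rw [Measure.restrict_apply hs.compl, compl_inter_self, measure_empty]
    rw [eventuallyConst_set']
    exact Or.inr (eventuallyEq_univ.2 (mem_ae_iff.2 (hμ.absCont (hv hc))))

theorem IsCircleSRB.unique {α : ℝ} (hα0 : 0 < α) (hα1 : α < 1) {μ ν : Measure Circle1}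
    (hμ : IsCircleSRB (intermittentMap α) μ) (hν : IsCircleSRB (intermittentMap α) ν) : ν = μ := by
  have := hμ.isProb
  have := hν.isProb
  refine (hμ.ergodic hα0 hα1).eq_of_absolutelyContinuous hν.invariant ?_
  exact hν.absCont.trans (volume_absolutelyContinuous hα0 hα1 hμ.absCont hμ.invariant
    (IsProbabilityMeasure.ne_zero μ))

/-! ### Visits of a measure preserving map -/

section Maximal

variable {X : Type*} [MeasurableSpace X]

/-- The maximal ergodic theorem. -/
theorem setIntegral_nonneg_of_birkhoffSum_pos {T : X → X} {m : Measure X}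
    (hT : MeasurePreserving T m m) {φ : X → ℝ} (hφ : Integrable φ m) (hφm : Measurable φ) (N : ℕ) :
    0 ≤ ∫ x in {x | ∃ k ∈ Finset.range (N + 1), 0 < birkhoffSum T φ k x}, φ x ∂m := by
  -- Garsia's argument. The maximum includes the empty sum `k = 0`, so `M ≥ 0`; where `M > 0` it is
  -- attained at some `k ≥ 1`, and removing the first term of that sum gives `M ≤ φ + M ∘ T`.
  set M : X → ℝ := fun x =>
    (Finset.range (N + 1)).sup' Finset.nonempty_range_add_one fun k => birkhoffSum T φ k x with hM
  have hbi : ∀ k, Integrable (birkhoffSum T φ k) m := fun k =>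
    integrable_finsetSum _ fun i _ => (hT.iterate i).integrable_comp_of_integrable hφ
  have hbm : ∀ k, Measurable (birkhoffSum T φ k) := fun k =>
    Finset.measurable_sum _ fun i _ => hφm.comp (hT.measurable.iterate i)
  have hMi : Integrable M m := by
    have : M = (Finset.range (N + 1)).sup' Finset.nonempty_range_add_one
        fun k => birkhoffSum T φ k := by ext x; simp [hM, Finset.sup'_apply]
    rw [this]
    refine Finset.sup'_induction _ _ (p := fun f => Integrable f m) (fun f hf g hg => hf.sup hg)
      fun k _ => hbi k
  have hset : {x | ∃ k ∈ Finset.range (N + 1), 0 < birkhoffSum T φ k x} = {x | 0 < M x} := by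
    ext x
    simp [hM, Finset.lt_sup'_iff]
  have hM0 : ∀ x, 0 ≤ M x := fun x => by
    have := Finset.le_sup' (fun k => birkhoffSum T φ k x) (Finset.mem_range.2 (Nat.succ_pos N))
    simpa using this
  have hS : MeasurableSet {x | 0 < M x} := by
    rw [← hset]
    have : {x | ∃ k ∈ Finset.range (N + 1), 0 < birkhoffSum T φ k x} =
        ⋃ k ∈ Finset.range (N + 1), {x | 0 < birkhoffSum T φ k x} := by ext x; simp
    rw [this]
    exact Finset.measurableSet_biUnion _ fun k _ => measurableSet_lt measurable_const (hbm k)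
  have hMT : Integrable (fun x => M (T x)) m := hT.integrable_comp_of_integrable hMi
  have hle : ∀ x ∈ {x | 0 < M x}, M x - M (T x) ≤ φ x := by
    intro x hx
    obtain ⟨k, hk, hkM⟩ := Finset.exists_mem_eq_sup' (Finset.nonempty_range_add_one (n := N))
      (fun k => birkhoffSum T φ k x)
    change M x = _ at hkM
    have hx' : 0 < M x := hx
    rw [hkM] at hx' ⊢
    rcases k with _ | k
    · simp at hx'
    · rw [birkhoffSum_succ']
      have := Finset.le_sup' (fun k => birkhoffSum T φ k (T x))
        (Finset.mem_range.2 (by have := Finset.mem_range.1 hk; omega : k < N + 1))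
      change birkhoffSum T φ k (T x) ≤ M (T x) at this
      linarith
  rw [hset]
  calc (0 : ℝ) = ∫ x, M x ∂m - ∫ x, M (T x) ∂m := by
        have h := integral_map (μ := m) hT.measurable.aemeasurable (f := M)
          (by rw [hT.map_eq]; exact hMi.aestronglyMeasurable)
        rw [hT.map_eq] at h
        rw [h, sub_self]
    _ ≤ ∫ x in {x | 0 < M x}, M x ∂m - ∫ x in {x | 0 < M x}, M (T x) ∂m := by
        refine sub_le_sub (le_of_eq ?_) (setIntegral_le_integral hMT (ae_of_all _ fun x => hM0 _))
        refine (setIntegral_eq_integral_of_forall_compl_eq_zero fun x hx => ?_).symm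
        exact le_antisymm (not_lt.1 hx) (hM0 x)
    _ = ∫ x in {x | 0 < M x}, (M x - M (T x)) ∂m :=
        (integral_sub hMi.integrableOn hMT.integrableOn).symm
    _ ≤ _ := setIntegral_mono_on (hMi.sub hMT).integrableOn hφ.integrableOn hS hle

/-- Almost every point of a set of finite measure returns to it with positive lower frequency. -/
theorem ae_exists_le_birkhoffSum_indicator {T : X → X} {m : Measure X} [IsFiniteMeasure m]
    (hT : MeasurePreserving T m m) {B : Set X} (hB : MeasurableSet B) :
    ∀ᵐ x ∂m, x ∈ B → ∃ ρ > (0 : ℝ), ∃ N, ∀ n ≥ N,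
      ρ * n ≤ birkhoffSum T (B.indicator fun _ => (1 : ℝ)) n x := by
  set S := birkhoffSum T (B.indicator fun _ => (1 : ℝ)) with hSdef
  have hSm : ∀ k, Measurable (S k) := fun k =>
    Finset.measurable_sum _ fun i _ =>
      (measurable_const.indicator hB).comp (hT.measurable.iterate i)
  -- The points whose lower frequency of visits to `B` is zero.
  set E : Set X := {x | ∀ k : ℕ, ∀ N : ℕ, ∃ n ≥ N, S n x < 1 / ((k : ℝ) + 1) * n} with hE
  have hEm : MeasurableSet E := by
    have : E = ⋂ k : ℕ, ⋂ N : ℕ, ⋃ n ≥ N, {x | S n x < 1 / ((k : ℝ) + 1) * n} := by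
      ext x; simp [hE]
    rw [this]
    exact MeasurableSet.iInter fun k => MeasurableSet.iInter fun N =>
      MeasurableSet.biUnion (to_countable _) fun n _ => measurableSet_lt (hSm n) measurable_const
  have hTE : ∀ x ∈ E, T x ∈ E := by
    intro x hx k N
    -- Passing from `n = j + 1` to `j` loses a factor of at most 2 as `j ≥ 1`; the threshold `1 /
    -- (2k + 2)` compensates for it.
    obtain ⟨n, hn, hlt⟩ := hx (2 * k + 1) (N + 2)
    obtain ⟨j, rfl⟩ : ∃ j, n = j + 1 := ⟨n - 1, by omega⟩
    refine ⟨j, by omega, ?_⟩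
    have h1 : S j (T x) ≤ S (j + 1) x := by
      rw [hSdef, birkhoffSum_succ']
      have : 0 ≤ B.indicator (fun _ => (1 : ℝ)) x := indicator_nonneg (fun _ _ => zero_le_one) x
      linarith
    refine (h1.trans_lt hlt).trans_le ?_
    have hj : (1 : ℝ) ≤ j := by exact_mod_cast (by omega : 1 ≤ j)
    push_cast
    rw [div_mul_eq_mul_div, div_mul_eq_mul_div, div_le_div_iff₀ (by positivity) (by positivity)]
    have hk : (0 : ℝ) ≤ k := k.cast_nonneg
    nlinarith
  have hTE' : ∀ x ∈ E, ∀ i, T^[i] x ∈ E := fun x hx i => by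
    induction i with
    | zero => exact hx
    | succ i ih => rw [Function.iterate_succ_apply']; exact hTE _ ih
  -- The maximal theorem is applied to `ε - 1_B` cut off to the forward invariant set `E`: every
  -- point of `E` has a positive Birkhoff sum, so this function has nonnegative integral over `E`.
  have hle : ∀ k : ℕ, m.real (E ∩ B) ≤ 1 / ((k : ℝ) + 1) * m.real E := by
    intro k
    set ε : ℝ := 1 / ((k : ℝ) + 1)
    set ψ : X → ℝ := fun x => ε - B.indicator (fun _ => (1 : ℝ)) x with hψ
    have hψi : Integrable ψ m :=
      (integrable_const _).sub ((integrable_const _).indicator hB)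
    have hψm : Measurable ψ := measurable_const.sub (measurable_const.indicator hB)
    set φ : X → ℝ := E.indicator ψ
    have hφi : Integrable φ m := hψi.indicator hEm
    have hφm : Measurable φ := hψm.indicator hEm
    have hsum : ∀ x ∈ E, ∀ n : ℕ, birkhoffSum T φ n x = ε * n - S n x := by
      intro x hx n
      rw [hSdef]
      simp only [birkhoffSum]
      rw [Finset.sum_congr rfl fun i _ => indicator_of_mem (hTE' x hx i) ψ, hψ,
        Finset.sum_sub_distrib, Finset.sum_const, Finset.card_range, nsmul_eq_mul, mul_comm]
    set A : ℕ → Set X := fun N => {x | ∃ k ∈ Finset.range (N + 1), 0 < birkhoffSum T φ k x}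
    have hAm : ∀ N, MeasurableSet (A N) := fun N => by
      have : A N = ⋃ k ∈ Finset.range (N + 1), {x | 0 < birkhoffSum T φ k x} := by
        ext x; simp [A]
      rw [this]
      exact Finset.measurableSet_biUnion _ fun k _ => measurableSet_lt measurable_const
        (Finset.measurable_sum _ fun i _ => hφm.comp (hT.measurable.iterate i))
    have hAmono : Monotone A := fun i j hij x ⟨k, hk, hx⟩ =>
      ⟨k, Finset.mem_range.2 (by have := Finset.mem_range.1 hk; omega), hx⟩
    have hEA : E ⊆ ⋃ N, A N := by
      intro x hx
      obtain ⟨n, -, hn⟩ := hx k 0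
      refine mem_iUnion.2 ⟨n, n, Finset.self_mem_range_succ n, ?_⟩
      rw [hsum x hx]
      exact sub_pos.2 hn
    have hlim := tendsto_setIntegral_of_monotone hAm hAmono hφi.integrableOn
    have h0 : 0 ≤ ∫ x in ⋃ N, A N, φ x ∂m :=
      ge_of_tendsto' hlim fun N => setIntegral_nonneg_of_birkhoffSum_pos hT hφi hφm N
    have hBi : Integrable (B.indicator fun _ => (1 : ℝ)) (m.restrict E) :=
      (integrable_const _).indicator hB
    rw [setIntegral_indicator hEm, inter_eq_self_of_subset_right hEA,
      integral_sub (integrable_const _) hBi, setIntegral_indicator hB] at h0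
    simp only [integral_const, smul_eq_mul, mul_one, measureReal_restrict_apply_univ] at h0
    linarith
  have hzero : m (E ∩ B) = 0 := by
    have h1 : Tendsto (fun k : ℕ => 1 / ((k : ℝ) + 1) * m.real E) atTop (𝓝 (0 * m.real E)) :=
      tendsto_one_div_add_atTop_nhds_zero_nat.mul_const _
    rw [zero_mul] at h1
    have h2 : m.real (E ∩ B) ≤ 0 := ge_of_tendsto' h1 hle
    exact (measureReal_eq_zero_iff).1 (le_antisymm h2 measureReal_nonneg)
  filter_upwards [measure_eq_zero_iff_ae_notMem.1 hzero] with x hx hxB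
  have hxE : x ∉ E := fun h => hx ⟨h, hxB⟩
  simp only [hE, mem_ofPred_eq, not_forall, not_exists, not_and, not_lt] at hxE
  obtain ⟨k, N, h⟩ := hxE
  exact ⟨1 / ((k : ℝ) + 1), by positivity, N, h⟩

end Maximal

/-- An inequality between finite measures can be checked on a generating algebra. -/
theorem measure_le_of_forall_isSetAlgebra {X : Type*} [m0 : MeasurableSpace X] {m m' : Measure X}
    [IsFiniteMeasure m] [IsFiniteMeasure m'] {𝒜 : Set (Set X)} (h𝒜 : IsSetAlgebra 𝒜)
    (hgen : m0 = MeasurableSpace.generateFrom 𝒜) (hle : ∀ s ∈ 𝒜, m s ≤ m' s) : m ≤ m' := by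
  have hd := Measure.MeasureDense.of_generateFrom_isSetAlgebra_finite (μ := m + m') h𝒜 hgen
  refine Measure.le_iff.2 fun s hs => ?_
  refine ENNReal_le_of_forall_ofReal_le (K := 2) (by finiteness) fun δ hδ => ?_
  obtain ⟨t, ht, hst⟩ := hd.approx s hs (measure_ne_top _ _) δ hδ
  rw [Measure.add_apply] at hst
  have h1 : m s ≤ m t + ENNReal.ofReal δ := by
    refine (measure_mono (?_ : s ⊆ t ∪ symmDiff s t)).trans
      ((measure_union_le _ _).trans (add_le_add le_rfl (le_trans le_self_add hst.le)))
    intro x hx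
    by_cases hxt : x ∈ t
    · exact Or.inl hxt
    · exact Or.inr (Or.inl ⟨hx, hxt⟩)
  have h2 : m' t ≤ m' s + ENNReal.ofReal δ := by
    refine (measure_mono (?_ : t ⊆ s ∪ symmDiff s t)).trans
      ((measure_union_le _ _).trans (add_le_add le_rfl (le_trans le_add_self hst.le)))
    intro x hx
    by_cases hxt : x ∈ s
    · exact Or.inl hxt
    · exact Or.inr (Or.inr ⟨hx, hxt⟩)
  calc m s ≤ m t + ENNReal.ofReal δ := h1
    _ ≤ m' s + ENNReal.ofReal δ + ENNReal.ofReal δ := by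
      gcongr
      exact (hle t ht).trans h2
    _ = _ := by ring


/-! ### The lift of the intermittent map and its expansion on the circle -/

theorem circleRep_coe_eq_fract (t : ℝ) : circleRep (t : Circle1) = Int.fract t := by
  rw [← AddCircle.coe_fract, circleRep_coe ⟨Int.fract_nonneg t, Int.fract_lt_one t⟩]

theorem monotone_floor_add_comp_fract {k : ℝ → ℝ} (hk : MonotoneOn k (Ico 0 1))
    (hk01 : MapsTo k (Ico 0 1) (Icc 0 1)) : Monotone fun t : ℝ => (⌊t⌋ : ℝ) + k (Int.fract t) := by
  intro s t hst
  have hs : Int.fract s ∈ Ico (0 : ℝ) 1 := ⟨Int.fract_nonneg s, Int.fract_lt_one s⟩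
  have ht : Int.fract t ∈ Ico (0 : ℝ) 1 := ⟨Int.fract_nonneg t, Int.fract_lt_one t⟩
  rcases (Int.floor_mono hst).eq_or_lt with h | h
  · simp only [h]
    have : Int.fract s ≤ Int.fract t := by rw [Int.fract, Int.fract, h]; linarith
    linarith [hk hs ht this]
  · have h' : (⌊s⌋ : ℝ) + 1 ≤ ⌊t⌋ := by exact_mod_cast h
    simp only
    linarith [(hk01 hs).2, (hk01 ht).1]

section Lift

variable {α : ℝ}

/-- The difference between the lift of the intermittent map to the real line and the identity,
on the fundamental domain. -/
def liftDisplacement (α s : ℝ) : ℝ :=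
  intermittentFormula α s + (if s < 1 / 2 then 0 else 1) - s

theorem liftDisplacement_of_mem_half_false (hα0 : 0 < α) {s : ℝ} (hs : s ∈ half false) :
    liftDisplacement α s = neutralBranch α s - s := by
  rw [liftDisplacement, intermittentFormula_of_mem_half_false hα0 hs, if_pos hs.2, add_zero]

theorem liftDisplacement_of_mem_half_true {s : ℝ} (hs : s ∈ half true) :
    liftDisplacement α s = 1 - (neutralBranch α (1 - s) - (1 - s)) := by
  rw [liftDisplacement, intermittentFormula_of_mem_half_true hs, if_neg (not_lt.2 hs.1)]
  ring

theorem neutralBranch_sub_self_bounds (hα0 : 0 < α) (hα1 : α < 1) {u : ℝ} (h0 : 0 ≤ u)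
    (h1 : u ≤ 1 / 2) : 0 ≤ neutralBranch α u - u ∧ neutralBranch α u - u ≤ 1 / 2 ∧
      neutralBranch α u ≤ 3 * u ∧ 3 * u - 1 / 2 ≤ neutralBranch α u := by
  have a1 := le_neutralBranch_sub hα0 le_rfl h0 le_rfl h0
  have a2 := le_neutralBranch_sub hα0 h0 h1 le_rfl (by norm_num)
  have a3 := neutralBranch_sub_le hα0 hα1 le_rfl h0 h1
  have a4 := neutralBranch_sub_le hα0 hα1 h0 h1 le_rfl
  rw [Real.zero_rpow hα0.ne', mul_zero, add_zero, one_mul, neutralBranch_zero hα0] at a1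
  rw [Real.zero_rpow hα0.ne', mul_zero, add_zero, one_mul, neutralBranch_half] at a2
  rw [neutralBranch_zero hα0] at a3
  rw [neutralBranch_half] at a4
  refine ⟨?_, ?_, ?_, ?_⟩ <;> linarith

theorem monotone_half_cases {k : ℝ → ℝ} {c : ℝ} (h : ∀ b, MonotoneOn k (half b))
    (h0 : ∀ x ∈ half false, k x ≤ c) (h1 : ∀ x ∈ half true, c ≤ k x) :
    MonotoneOn k (Ico 0 1) := by
  intro x hx y hy hxy
  by_cases hy2 : y < 1 / 2
  · exact h false ⟨hx.1, hxy.trans_lt hy2⟩ ⟨hy.1, hy2⟩ hxy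
  · by_cases hx2 : x < 1 / 2
    · exact (h0 x ⟨hx.1, hx2⟩).trans (h1 y ⟨not_lt.1 hy2, hy.2⟩)
    · exact h true ⟨not_lt.1 hx2, hx.2⟩ ⟨not_lt.1 hy2, hy.2⟩ hxy

theorem liftDisplacement_sub_bounds (hα0 : 0 < α) (hα1 : α < 1) {b : Bool} {x y : ℝ}
    (hx : x ∈ half b) (hy : y ∈ half b) (hxy : x ≤ y) :
    liftDisplacement α x ≤ liftDisplacement α y ∧
      liftDisplacement α y - liftDisplacement α x ≤ 2 * (y - x) := by
  have h1 := sub_le_intermittentFormula_sub hα0 hx hy hxy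
  have h2 := intermittentFormula_sub_le hα0 hα1 hx hy hxy
  have h3 : (if x < 1 / 2 then (0 : ℝ) else 1) = if y < 1 / 2 then (0 : ℝ) else 1 := by
    cases b
    · rw [if_pos hx.2, if_pos hy.2]
    · rw [if_neg (not_lt.2 hx.1), if_neg (not_lt.2 hy.1)]
  unfold liftDisplacement
  rw [h3]
  constructor <;> linarith

/-- Monotonicity of the displacement says that the lift has slope at least 1, also across the ends
of the two branches. The companion statement with `2 * Int.fract t` gives slope at most 3. -/
theorem monotone_floor_add_liftDisplacement (hα0 : 0 < α) (hα1 : α < 1) :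
    Monotone fun t : ℝ => (⌊t⌋ : ℝ) + liftDisplacement α (Int.fract t) := by
  have hF : ∀ x ∈ half false, 0 ≤ liftDisplacement α x ∧ liftDisplacement α x ≤ 1 / 2 := by
    intro x hx
    have h := neutralBranch_sub_self_bounds hα0 hα1 hx.1 hx.2.le
    rw [liftDisplacement_of_mem_half_false hα0 hx]
    exact ⟨h.1, h.2.1⟩
  have hT : ∀ x ∈ half true, 1 / 2 ≤ liftDisplacement α x ∧ liftDisplacement α x ≤ 1 := by
    intro x hx
    have h := neutralBranch_sub_self_bounds hα0 hα1 (u := 1 - x) (by linarith [hx.2])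
      (by linarith [hx.1])
    rw [liftDisplacement_of_mem_half_true hx]
    constructor <;> linarith [h.1, h.2.1]
  refine monotone_floor_add_comp_fract (monotone_half_cases (fun b x hx y hy hxy =>
    (liftDisplacement_sub_bounds hα0 hα1 hx hy hxy).1) (fun x hx => (hF x hx).2)
    fun x hx => (hT x hx).1) fun x hx => ?_
  have hb := mem_half_halfSymbol hx
  cases h : halfSymbol x <;> rw [h] at hb
  · exact ⟨(hF x hb).1, by linarith [(hF x hb).2]⟩
  · exact ⟨by linarith [(hT x hb).1], (hT x hb).2⟩

theorem monotone_floor_add_two_mul_sub_liftDisplacement (hα0 : 0 < α) (hα1 : α < 1) :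
    Monotone fun t : ℝ => (⌊t⌋ : ℝ) + (2 * Int.fract t - liftDisplacement α (Int.fract t)) := by
  have hF : ∀ x ∈ half false, 0 ≤ 2 * x - liftDisplacement α x ∧
      2 * x - liftDisplacement α x ≤ 1 / 2 := by
    intro x hx
    have h := neutralBranch_sub_self_bounds hα0 hα1 hx.1 hx.2.le
    rw [liftDisplacement_of_mem_half_false hα0 hx]
    constructor <;> linarith [h.2.2.1, h.2.2.2]
  have hT : ∀ x ∈ half true, 1 / 2 ≤ 2 * x - liftDisplacement α x ∧
      2 * x - liftDisplacement α x ≤ 1 := by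
    intro x hx
    have h := neutralBranch_sub_self_bounds hα0 hα1 (u := 1 - x) (by linarith [hx.2])
      (by linarith [hx.1])
    rw [liftDisplacement_of_mem_half_true hx]
    constructor <;> linarith [h.2.2.1, h.2.2.2]
  refine monotone_floor_add_comp_fract (k := fun s => 2 * s - liftDisplacement α s)
    (monotone_half_cases (fun b x hx y hy hxy => ?_) (fun x hx => (hF x hx).2)
    fun x hx => (hT x hx).1) fun x hx => ?_
  · have := (liftDisplacement_sub_bounds hα0 hα1 hx hy hxy).2
    linarith
  · have hb := mem_half_halfSymbol hx
    cases h : halfSymbol x <;> rw [h] at hb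
    · exact ⟨(hF x hb).1, by linarith [(hF x hb).2]⟩
    · exact ⟨by linarith [(hT x hb).1], (hT x hb).2⟩

/-- The lift of the intermittent map to the real line. -/
def intermittentLift (α t : ℝ) : ℝ := t + (⌊t⌋ + liftDisplacement α (Int.fract t))

theorem intermittentMap_coe (α t : ℝ) :
    intermittentMap α (t : Circle1) = (intermittentLift α t : Circle1) := by
  have h : intermittentLift α t = intermittentFormula α (Int.fract t)
      + ((2 * ⌊t⌋ + (if Int.fract t < 1 / 2 then 0 else 1) : ℤ) : ℝ) := by
    rw [intermittentLift, liftDisplacement]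
    nth_rewrite 1 [← Int.floor_add_fract t]
    split_ifs <;> push_cast <;> ring
  have hz : ∀ n : ℤ, ((n : ℝ) : Circle1) = 0 := fun n =>
    AddCircle.coe_eq_zero_iff 1 |>.2 ⟨n, by simp⟩
  rw [intermittentMap_eq, circleRep_coe_eq_fract, h, AddCircle.coe_add, hz, add_zero]

theorem intermittentLift_sub_bounds (hα0 : 0 < α) (hα1 : α < 1) {s t : ℝ} (hst : s ≤ t) :
    t - s ≤ intermittentLift α t - intermittentLift α s ∧
      intermittentLift α t - intermittentLift α s ≤ 3 * (t - s) := by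
  have h1 := monotone_floor_add_liftDisplacement hα0 hα1 hst
  have h2 := monotone_floor_add_two_mul_sub_liftDisplacement hα0 hα1 hst
  simp only at h1 h2
  have e1 := Int.floor_add_fract s
  have e2 := Int.floor_add_fract t
  unfold intermittentLift
  constructor <;> linarith

theorem abs_intermittentLift_sub_bounds (hα0 : 0 < α) (hα1 : α < 1) (s t : ℝ) :
    |t - s| ≤ |intermittentLift α t - intermittentLift α s| ∧
      |intermittentLift α t - intermittentLift α s| ≤ 3 * |t - s| := by
  wlog hst : s ≤ t generalizing s t
  · rw [abs_sub_comm, abs_sub_comm (intermittentLift α t)]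
    exact this t s (not_le.1 hst).le
  obtain ⟨h1, h2⟩ := intermittentLift_sub_bounds hα0 hα1 hst
  rw [abs_of_nonneg (sub_nonneg.2 hst), abs_of_nonneg (by linarith)]
  exact ⟨h1, h2⟩

theorem exists_coe_eq_dist_eq (x y : Circle1) :
    ∃ s t : ℝ, (s : Circle1) = x ∧ (t : Circle1) = y ∧ dist x y = |s - t| := by
  refine ⟨circleRep x - round (circleRep x - circleRep y), circleRep y, ?_, coe_circleRep y, ?_⟩
  · rw [AddCircle.coe_sub, coe_circleRep, sub_eq_self]
    exact AddCircle.coe_eq_zero_iff 1 |>.2 ⟨round (circleRep x - circleRep y), by simp⟩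
  · have h : x - y = ((circleRep x - circleRep y : ℝ) : Circle1) := by
      rw [AddCircle.coe_sub, coe_circleRep, coe_circleRep]
    rw [dist_eq_norm, h, UnitAddCircle.norm_eq]
    congr 1
    ring

theorem dist_coe_le (s t : ℝ) : dist (s : Circle1) t ≤ |s - t| := by
  rw [dist_eq_norm, ← AddCircle.coe_sub]
  rw [UnitAddCircle.norm_eq]
  simpa using round_le (s - t) 0

theorem dist_coe_eq {s t : ℝ} (h : |s - t| ≤ 1 / 2) : dist (s : Circle1) t = |s - t| := by
  rw [dist_eq_norm, ← AddCircle.coe_sub]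
  exact (AddCircle.norm_coe_eq_abs_iff 1 one_ne_zero).2 (by simpa using h)

theorem dist_intermittentMap_le (hα0 : 0 < α) (hα1 : α < 1) (x y : Circle1) :
    dist (intermittentMap α x) (intermittentMap α y) ≤ 3 * dist x y := by
  obtain ⟨s, t, rfl, rfl, h⟩ := exists_coe_eq_dist_eq x y
  rw [intermittentMap_coe, intermittentMap_coe, h]
  exact (dist_coe_le _ _).trans (abs_intermittentLift_sub_bounds hα0 hα1 t s).2

/-- Lifts of points within `1/6` have images within `3 · 1/6 = 1/2`, where distance on the circle is
distance on the line, and the lift does not contract. -/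
theorem dist_le_dist_intermittentMap (hα0 : 0 < α) (hα1 : α < 1) {x y : Circle1}
    (hxy : dist x y ≤ 1 / 6) : dist x y ≤ dist (intermittentMap α x) (intermittentMap α y) := by
  obtain ⟨s, t, rfl, rfl, h⟩ := exists_coe_eq_dist_eq x y
  have hb := abs_intermittentLift_sub_bounds hα0 hα1 t s
  rw [h] at hxy
  rw [intermittentMap_coe, intermittentMap_coe, h, dist_coe_eq (by linarith [hb.2])]
  exact hb.1

end Lift

/-! ### The solenoid map -/

/-- The point `exp (2 π i x)` of the unit circle. -/
def circleExp (x : Circle1) : ℂ := ⟨circleCos x, circleSin x⟩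

theorem circleCos_eq (x : Circle1) : circleCos x = Real.cos (2 * Real.pi * circleRep x) := rfl

theorem circleSin_eq (x : Circle1) : circleSin x = Real.sin (2 * Real.pi * circleRep x) := rfl

theorem circleExp_coe (t : ℝ) :
    circleExp (t : Circle1) = Complex.exp (Complex.I * (2 * Real.pi * t : ℝ)) := by
  have h : 2 * Real.pi * t = 2 * Real.pi * Int.fract t + ⌊t⌋ * (2 * Real.pi) := by
    nth_rewrite 1 [← Int.floor_add_fract t]; ring
  rw [circleExp, circleCos_eq, circleSin_eq, circleRep_coe_eq_fract, mul_comm Complex.I,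
    ← Real.cos_add_int_mul_two_pi _ ⌊t⌋, ← Real.sin_add_int_mul_two_pi _ ⌊t⌋, ← h]
  exact Complex.ext (Complex.exp_ofReal_mul_I_re _).symm (Complex.exp_ofReal_mul_I_im _).symm

theorem norm_circleExp (x : Circle1) : ‖circleExp x‖ = 1 := by
  rw [← coe_circleRep x, circleExp_coe, Complex.norm_exp_I_mul_ofReal]

theorem norm_exp_I_mul_sub_le (s t : ℝ) :
    ‖Complex.exp (Complex.I * s) - Complex.exp (Complex.I * t)‖ ≤ |s - t| := by
  have h : Complex.exp (Complex.I * s) - Complex.exp (Complex.I * t) =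
      Complex.exp (Complex.I * t) * (Complex.exp (Complex.I * (s - t : ℝ)) - 1) := by
    rw [mul_sub, ← Complex.exp_add, mul_one]
    push_cast
    ring_nf
  rw [h, norm_mul, Complex.norm_exp_I_mul_ofReal, one_mul]
  exact Real.norm_exp_I_mul_ofReal_sub_one_le

theorem norm_circleExp_sub_le (x y : Circle1) :
    ‖circleExp x - circleExp y‖ ≤ 2 * Real.pi * dist x y := by
  obtain ⟨s, t, rfl, rfl, h⟩ := exists_coe_eq_dist_eq x y
  rw [circleExp_coe, circleExp_coe, h]
  refine (norm_exp_I_mul_sub_le _ _).trans_eq ?_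
  rw [← mul_sub, abs_mul, abs_of_pos Real.two_pi_pos]

theorem fibreFormula_eq (x : Circle1) (w : ℂ) :
    fibreFormula x w = (1 / 2 : ℝ) • circleExp x + (1 / 5 : ℝ) • w := by
  apply Complex.ext <;> simp [fibreFormula, circleExp]

theorem norm_fibreFormula_sub_le (x y : Circle1) (w z : ℂ) :
    ‖fibreFormula x w - fibreFormula y z‖ ≤ Real.pi * dist x y + 1 / 5 * ‖w - z‖ := by
  have h : fibreFormula x w - fibreFormula y z =
      (1 / 2 : ℝ) • (circleExp x - circleExp y) + (1 / 5 : ℝ) • (w - z) := by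
    rw [fibreFormula_eq, fibreFormula_eq, smul_sub, smul_sub]; abel
  rw [h]
  refine (norm_add_le _ _).trans ?_
  rw [norm_smul, norm_smul, Real.norm_of_nonneg (by norm_num), Real.norm_of_nonneg (by norm_num)]
  linarith [norm_circleExp_sub_le x y]

section Solenoid

variable {α : ℝ}

theorem dist_solenoidMap_snd_le (α : ℝ) (p q : SolidTorus) :
    dist (solenoidMap α p).2 (solenoidMap α q).2 ≤
      Real.pi * dist p.1 q.1 + 1 / 5 * dist p.2 q.2 := by
  rw [Subtype.dist_eq, dist_eq_norm, Subtype.dist_eq p.2, dist_eq_norm (p.2 : ℂ)]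
  exact norm_fibreFormula_sub_le _ _ _ _

theorem lipschitzWith_solenoidMap (hα0 : 0 < α) (hα1 : α < 1) :
    LipschitzWith 4 (solenoidMap α) := by
  refine LipschitzWith.of_dist_le_mul fun p q => ?_
  have h1 : dist p.1 q.1 ≤ dist p q := le_max_left _ _
  have h2 : dist p.2 q.2 ≤ dist p q := le_max_right _ _
  have h0 : 0 ≤ dist p q := dist_nonneg
  refine max_le ?_ ?_
  · have := dist_intermittentMap_le hα0 hα1 p.1 q.1
    change dist (intermittentMap α p.1) (intermittentMap α q.1) ≤ _
    push_cast
    linarith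
  · refine (dist_solenoidMap_snd_le α p q).trans ?_
    push_cast
    nlinarith [Real.pi_lt_d2, Real.pi_pos]

theorem continuous_solenoidMap (hα0 : 0 < α) (hα1 : α < 1) : Continuous (solenoidMap α) :=
  (lipschitzWith_solenoidMap hα0 hα1).continuous

theorem dist_unitDisk_le (w z : UnitDisk) : dist w z ≤ 2 := by
  have hw : ‖(w : ℂ)‖ ≤ 1 := mem_closedBall_zero_iff.mp w.2
  have hz : ‖(z : ℂ)‖ ≤ 1 := mem_closedBall_zero_iff.mp z.2
  rw [Subtype.dist_eq, dist_eq_norm]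
  linarith [norm_sub_le (w : ℂ) (z : ℂ)]

/-- Two preimages of a point under the intermittent map are far apart on the circle. -/
theorem sub_mem_of_intermittentFormula_eq (hα0 : 0 < α) (hα1 : α < 1) {x y : ℝ}
    (hx : x ∈ half false) (hy : y ∈ half true)
    (h : intermittentFormula α x = intermittentFormula α y) :
    1 / 4 ≤ y - x ∧ y - x ≤ 3 / 4 := by
  rw [intermittentFormula_of_mem_half_false hα0 hx, intermittentFormula_of_mem_half_true hy] at h
  -- Since `2u ≤ 1` and `α < 1`, `(2u)^α ≥ 2u`. With `s = x + (1 - y)` this gives `s + s² ≤ 1`, so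
  -- `s ≤ 3/4`; the upper bound `3u` gives `s ≥ 1/3`.
  have low : ∀ u : ℝ, 0 ≤ u → u ≤ 1 / 2 → u + 2 * u ^ 2 ≤ neutralBranch α u := by
    intro u h0 h1
    have h2 : 2 * u ≤ (2 * u) ^ α := Real.self_le_rpow_of_le_one (by linarith) (by linarith) hα1.le
    rw [Real.mul_rpow (by norm_num) h0] at h2
    rw [neutralBranch, Real.rpow_add_one' h0 (by linarith)]
    nlinarith
  have hy0 : 0 ≤ 1 - y := by linarith [hy.2]
  have hy1 : 1 - y ≤ 1 / 2 := by linarith [hy.1]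
  have l1 := low x hx.1 hx.2.le
  have l2 := low (1 - y) hy0 hy1
  have u1 := (neutralBranch_sub_self_bounds hα0 hα1 hx.1 hx.2.le).2.2.1
  have u2 := (neutralBranch_sub_self_bounds hα0 hα1 hy0 hy1).2.2.1
  constructor
  · nlinarith [sq_nonneg (x - (1 - y))]
  · linarith

/-- Preimages of a base point in different branches are at least a quarter turn apart, so the
centres of the two image disks are at distance at least `√2 / 2`, more than the sum `2/5` of the
radii. -/
theorem injective_solenoidMap (hα0 : 0 < α) (hα1 : α < 1) :
    Function.Injective (solenoidMap α) := by
  have key : ∀ p q : SolidTorus, solenoidMap α p = solenoidMap α q →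
      circleRep p.1 ∈ half false → circleRep q.1 ∈ half true → False := by
    intro p q h hp hq
    have h1 : intermittentFormula α (circleRep p.1) = intermittentFormula α (circleRep q.1) := by
      rw [← circleRep_intermittentMap hα0, ← circleRep_intermittentMap hα0]
      exact congrArg circleRep (congrArg Prod.fst h)
    obtain ⟨d1, d2⟩ := sub_mem_of_intermittentFormula_eq hα0 hα1 hp hq h1
    have h2 : fibreFormula p.1 p.2 = fibreFormula q.1 q.2 :=
      congrArg Subtype.val (congrArg Prod.snd h)
    have hre := congrArg Complex.re h2
    have him := congrArg Complex.im h2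
    simp only [fibreFormula, circleCos_eq, circleSin_eq] at hre him
    set a := 2 * Real.pi * circleRep p.1
    set b := 2 * Real.pi * circleRep q.1
    have hcos : Real.cos (b - a) ≤ 0 := by
      have e : b - a = 2 * Real.pi * (circleRep q.1 - circleRep p.1) := by ring
      have hpi := Real.pi_pos
      apply Real.cos_nonpos_of_pi_div_two_le_of_le <;> rw [e] <;> nlinarith
    rw [Real.cos_sub] at hcos
    have hnorm : ((q.2 : ℂ).re - (p.2 : ℂ).re) ^ 2 + ((q.2 : ℂ).im - (p.2 : ℂ).im) ^ 2 ≤ 4 := by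
      have h3 := dist_unitDisk_le q.2 p.2
      rw [Subtype.dist_eq, dist_eq_norm] at h3
      have h4 := Complex.sq_norm ((q.2 : ℂ) - p.2)
      rw [Complex.normSq_apply, Complex.sub_re, Complex.sub_im] at h4
      nlinarith [norm_nonneg ((q.2 : ℂ) - p.2)]
    have s1 := Real.sin_sq_add_cos_sq a
    have s2 := Real.sin_sq_add_cos_sq b
    have e1 : Real.cos a - Real.cos b = 2 / 5 * ((q.2 : ℂ).re - (p.2 : ℂ).re) := by linarith
    have e2 : Real.sin a - Real.sin b = 2 / 5 * ((q.2 : ℂ).im - (p.2 : ℂ).im) := by linarith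
    have e3 : (Real.cos a - Real.cos b) ^ 2 + (Real.sin a - Real.sin b) ^ 2 ≤ 4 / 25 * 4 := by
      rw [e1, e2]; nlinarith
    nlinarith
  intro p q h
  have hp := mem_half_halfSymbol (circleRep_mem p.1)
  have hq := mem_half_halfSymbol (circleRep_mem q.1)
  have hb : halfSymbol (circleRep p.1) = halfSymbol (circleRep q.1) := by
    cases hb : halfSymbol (circleRep p.1) <;> cases hb' : halfSymbol (circleRep q.1)
    · rfl
    · rw [hb] at hp; rw [hb'] at hq; exact (key p q h hp hq).elim
    · rw [hb] at hp; rw [hb'] at hq; exact (key q p h.symm hq hp).elim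
    · rfl
  rw [← hb] at hq
  have h1 : p.1 = q.1 := by
    apply circleRep_injective
    refine (strictMonoOn_intermittentFormula hα0 _).injOn hp hq ?_
    rw [← circleRep_intermittentMap hα0, ← circleRep_intermittentMap hα0]
    exact congrArg circleRep (congrArg Prod.fst h)
  have h2 : fibreFormula p.1 p.2 = fibreFormula q.1 q.2 :=
    congrArg Subtype.val (congrArg Prod.snd h)
  rw [fibreFormula_eq, fibreFormula_eq, h1] at h2
  exact Prod.ext h1 (Subtype.ext (smul_right_injective ℂ (by norm_num : (1 / 5 : ℝ) ≠ 0)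
    (add_left_cancel h2)))

theorem measurableEmbedding_solenoidMap (hα0 : 0 < α) (hα1 : α < 1) :
    MeasurableEmbedding (solenoidMap α) :=
  (continuous_solenoidMap hα0 hα1).measurableEmbedding (injective_solenoidMap hα0 hα1)

theorem iterate_solenoidMap_fst (α : ℝ) (n : ℕ) (p : SolidTorus) :
    ((solenoidMap α)^[n] p).1 = (intermittentMap α)^[n] p.1 :=
  Function.Semiconj.iterate_right (f := Prod.fst) (fun _ => rfl) n p

/-- Orbits that stay close in the base are close in the fibre. -/
theorem le_four_mul_of_le_add {D W : ℕ → ℝ} {d : ℝ} (hd : 0 ≤ d) (hD : ∀ n, D n ≤ d) (hW : ∀ n, W n ≤ 2)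
    (h : ∀ n, W n ≤ Real.pi * D (n + 1) + 1 / 5 * W (n + 1)) : W 0 ≤ 4 * d := by
  -- Partial sums of the geometric series with ratio `1/5`; in the limit the bound is `(5π/4) d`,
  -- and `5π/4 < 4`.
  have h0 : ∀ n : ℕ, W 0 ≤ 5 / 4 * (Real.pi * d) * (1 - (1 / 5) ^ n) + (1 / 5) ^ n * W n := by
    intro n
    induction n with
    | zero => simp
    | succ n ih =>
      have hp : (0 : ℝ) < (1 / 5) ^ n := by positivity
      have h1 := mul_le_mul_of_nonneg_left (h n) hp.le
      have h2 := mul_le_mul_of_nonneg_left (mul_le_mul_of_nonneg_left (hD (n + 1))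
        Real.pi_pos.le) hp.le
      rw [pow_succ]
      nlinarith
  have hq : Tendsto (fun n : ℕ => (1 / 5 : ℝ) ^ n) atTop (𝓝 0) :=
    tendsto_pow_atTop_nhds_zero_of_lt_one (by norm_num) (by norm_num)
  have hlim : Tendsto (fun n : ℕ => 5 / 4 * (Real.pi * d) * (1 - (1 / 5 : ℝ) ^ n)
      + (1 / 5) ^ n * 2) atTop (𝓝 (5 / 4 * (Real.pi * d) * (1 - 0) + 0 * 2)) :=
    ((hq.const_sub 1).const_mul _).add (hq.mul_const 2)
  have h1 := ge_of_tendsto' hlim fun n => (h0 n).trans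
    (add_le_add le_rfl (mul_le_mul_of_nonneg_left (hW n) (by positivity)))
  nlinarith [Real.pi_lt_d2]

end Solenoid

/-! ### Invariant lifts are unique -/

section Lifts

variable {α : ℝ}

theorem dist_iterate_solenoidMap_snd_le (α : ℝ) {p q : SolidTorus} (h : p.1 = q.1) (n : ℕ) :
    dist ((solenoidMap α)^[n] p).2 ((solenoidMap α)^[n] q).2 ≤ (1 / 5) ^ n * 2 := by
  induction n with
  | zero => simpa using dist_unitDisk_le p.2 q.2
  | succ n ih =>
    rw [Function.iterate_succ_apply', Function.iterate_succ_apply']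
    refine (dist_solenoidMap_snd_le α _ _).trans ?_
    rw [iterate_solenoidMap_fst, iterate_solenoidMap_fst, h, dist_self, mul_zero, zero_add,
      pow_succ', mul_assoc]
    exact mul_le_mul_of_nonneg_left ih (by norm_num)

/-- An invariant measure of the solenoid map is determined by its projection to the circle. -/
theorem eq_of_map_fst_eq (hα0 : 0 < α) (hα1 : α < 1) {η ν : Measure SolidTorus}
    [IsFiniteMeasure η] [IsFiniteMeasure ν] (hη : MeasurePreserving (solenoidMap α) η η)
    (hν : MeasurePreserving (solenoidMap α) ν ν) (h : ν.map Prod.fst = η.map Prod.fst) : ν = η := by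
  refine ext_of_forall_integral_eq_of_IsFiniteMeasure fun f => ?_
  have hFc := continuous_solenoidMap hα0 hα1
  let z : UnitDisk := ⟨0, by simp⟩
  -- Take `g x = f (F^n (x, 0))`: after `n` steps the fibre over `x` has diameter at most `2 ·
  -- 5^(-n)`. The same `g` serves all invariant measures.
  have key : ∀ ε > 0, ∃ g : Circle1 → ℝ, Continuous g ∧ ∀ m : Measure SolidTorus,
      IsFiniteMeasure m → MeasurePreserving (solenoidMap α) m m →
      |∫ p, f p ∂m - ∫ x, g x ∂(m.map Prod.fst)| ≤ ε * m.real univ := by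
    intro ε hε
    have huc : UniformContinuous f := CompactSpace.uniformContinuous_of_continuous f.continuous
    obtain ⟨δ, hδ, hf⟩ := Metric.uniformContinuous_iff.1 huc ε hε
    obtain ⟨n, hn⟩ := exists_pow_lt_of_lt_one (half_pos hδ) (by norm_num : (1 / 5 : ℝ) < 1)
    have hg : Continuous fun x : Circle1 => f ((solenoidMap α)^[n] (x, z)) :=
      f.continuous.comp ((hFc.iterate n).comp (by fun_prop))
    refine ⟨_, hg, fun m _ hm => ?_⟩
    have hFn : Continuous fun p => f ((solenoidMap α)^[n] p) := f.continuous.comp (hFc.iterate n)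
    have e1 : ∫ p, f p ∂m = ∫ p, f ((solenoidMap α)^[n] p) ∂m := by
      have := integral_map (μ := m) (hm.measurable.iterate n).aemeasurable (f := f)
        f.continuous.aestronglyMeasurable
      rwa [(hm.iterate n).map_eq] at this
    have e2 := integral_map (μ := m) measurable_fst.aemeasurable
      (f := fun x : Circle1 => f ((solenoidMap α)^[n] (x, z))) hg.aestronglyMeasurable
    have i1 : Integrable (fun p => f ((solenoidMap α)^[n] p)) m :=
      hFn.integrable_of_hasCompactSupport (HasCompactSupport.of_compactSpace _)
    have hg' : Continuous fun p : SolidTorus => f ((solenoidMap α)^[n] (p.1, z)) :=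
      hg.comp continuous_fst
    have i2 : Integrable (fun p : SolidTorus => f ((solenoidMap α)^[n] (p.1, z))) m :=
      hg'.integrable_of_hasCompactSupport (HasCompactSupport.of_compactSpace _)
    rw [e1, e2, ← integral_sub i1 i2, ← Real.norm_eq_abs]
    refine norm_integral_le_of_norm_le_const (ae_of_all _ fun p => ?_)
    rw [← dist_eq_norm]
    refine (hf ?_).le
    have h1 : ((solenoidMap α)^[n] p).1 = ((solenoidMap α)^[n] (p.1, z)).1 := by
      rw [iterate_solenoidMap_fst, iterate_solenoidMap_fst]
    have h2 := dist_iterate_solenoidMap_snd_le α (p := p) (q := (p.1, z)) rfl n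
    rw [Prod.dist_eq, h1, dist_self]
    exact max_lt hδ (h2.trans_lt (by linarith))
  have hbound : ∀ ε > 0, |∫ p, f p ∂ν - ∫ p, f p ∂η| ≤ ε * (ν.real univ + η.real univ) := by
    intro ε hε
    obtain ⟨g, -, hg⟩ := key ε hε
    have h1 := hg ν inferInstance hν
    have h2 := hg η inferInstance hη
    rw [h] at h1
    rw [abs_sub_comm] at h2
    calc _ ≤ _ := abs_sub_le _ (∫ x, g x ∂(η.map Prod.fst)) _
      _ ≤ _ := add_le_add h1 h2
      _ = _ := by ring
  have hlim : Tendsto (fun ε : ℝ => ε * (ν.real univ + η.real univ)) (𝓝[>] 0) (𝓝 0) := by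
    have : Tendsto (fun ε : ℝ => ε * (ν.real univ + η.real univ)) (𝓝 0)
        (𝓝 (0 * (ν.real univ + η.real univ))) := tendsto_id.mul_const _
    rw [zero_mul] at this
    exact this.mono_left nhdsWithin_le_nhds
  have := ge_of_tendsto hlim
    (by filter_upwards [self_mem_nhdsWithin] with ε hε using hbound ε hε)
  exact sub_eq_zero.1 (abs_eq_zero.1 (le_antisymm this (abs_nonneg _)))

end Lifts

/-! ### Null sets on the circle -/

theorem circleRep_image_subset (N : Set Circle1) :
    circleRep '' N ⊆ ((↑) : ℝ → Circle1) ⁻¹' N ∩ Ico 0 1 := by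
  rintro _ ⟨x, hx, rfl⟩
  exact ⟨by rwa [mem_preimage, coe_circleRep], circleRep_mem x⟩

/-- The projection from the line is 1-Lipschitz. The measurable hull is needed because `N` is
arbitrary. -/
theorem hausdorffMeasure_eq_zero_of_volume_eq_zero {N : Set Circle1} (hN : volume N = 0) :
    μH[1] N = 0 := by
  have h1 : volume (circleRep '' N) = 0 := by
    refine measure_mono_null ((image_mono (subset_toMeasurable volume N)).trans
      (circleRep_image_subset _)) ?_
    rw [← measure_toMeasurable, ← map_coe_restrict_volume, Measure.map_apply
      AddCircle.measurable_mk' (measurableSet_toMeasurable _ _), Measure.restrict_apply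
      (AddCircle.measurable_mk' (measurableSet_toMeasurable _ _))] at hN
    rwa [map_coe_restrict_volume] at hN
  have hl : LipschitzWith 1 ((↑) : ℝ → Circle1) := LipschitzWith.of_dist_le_mul fun s t => by
    rw [NNReal.coe_one, one_mul, Real.dist_eq]; exact dist_coe_le s t
  have h2 := hl.hausdorffMeasure_image_le zero_le_one (circleRep '' N)
  rw [hausdorffMeasure_real, h1, mul_zero, image_image] at h2
  simpa using h2

theorem volume_eq_zero_of_hausdorffMeasure_eq_zero {N : Set Circle1} (hN : μH[1] N = 0) :
    volume N = 0 := by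
  -- On each half of the fundamental domain `circleRep` is an isometry, although it is discontinuous
  -- on the circle.
  have hhalf : ∀ b, volume (circleRep '' (N ∩ circleRep ⁻¹' half b)) = 0 := by
    intro b
    have hl : LipschitzOnWith 1 circleRep (N ∩ circleRep ⁻¹' half b) :=
      LipschitzOnWith.of_dist_le_mul fun x hx y hy => by
        rw [NNReal.coe_one, one_mul, Real.dist_eq]
        have h : |circleRep x - circleRep y| ≤ 1 / 2 := by
          have h1 := hx.2
          have h2 := hy.2
          rw [abs_le]
          cases b
          · constructor <;> linarith [h1.1, h1.2, h2.1, h2.2]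
          · constructor <;> linarith [h1.1, h1.2, h2.1, h2.2]
        rw [← dist_coe_eq h, coe_circleRep, coe_circleRep]
    have := hl.hausdorffMeasure_image_le zero_le_one
    rw [measure_mono_null inter_subset_left hN, mul_zero, hausdorffMeasure_real] at this
    exact nonpos_iff_eq_zero.1 this
  have himg : volume (circleRep '' N) = 0 := by
    refine measure_mono_null ?_ (measure_iUnion_null hhalf)
    rintro _ ⟨x, hx, rfl⟩
    exact mem_iUnion.2 ⟨_, x, ⟨hx, mem_half_halfSymbol (circleRep_mem x)⟩, rfl⟩
  have h1 := Measure.le_map_apply (μ := (volume : Measure Circle1))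
    measurable_circleRep.aemeasurable (circleRep '' N)
  rw [preimage_image_eq _ circleRep_injective, map_circleRep_volume] at h1
  exact nonpos_iff_eq_zero.1 (h1.trans ((Measure.restrict_apply_le _ _).trans himg.le))

/-- The preimage of a null set is the union of its images under two 1-Lipschitz inverse branches.
This is needed to pull null sets back along the forward images that cover an unstable manifold. -/
theorem quasiMeasurePreserving_intermittentMap {α : ℝ} (hα0 : 0 < α) :
    Measure.QuasiMeasurePreserving (intermittentMap α) volume volume := by
  refine ⟨measurable_intermittentMap α, Measure.AbsolutelyContinuous.mk fun N hN hN0 => ?_⟩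
  rw [Measure.map_apply (measurable_intermittentMap α) hN]
  have hmap : ∀ S : Set Circle1, MeasurableSet S →
      volume S = volume (((↑) : ℝ → Circle1) ⁻¹' S ∩ Ico 0 1) := fun S hS => by
    rw [← map_coe_restrict_volume, Measure.map_apply AddCircle.measurable_mk' hS,
      Measure.restrict_apply (AddCircle.measurable_mk' hS)]
  rw [hmap N hN] at hN0
  rw [hmap _ (measurable_intermittentMap α hN)]
  set A := ((↑) : ℝ → Circle1) ⁻¹' N ∩ Ico 0 1
  have hsub : ((↑) : ℝ → Circle1) ⁻¹' (intermittentMap α ⁻¹' N) ∩ Ico 0 1 ⊆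
      ⋃ b : Bool, invBranches α (fun _ => b) 1 '' A := by
    rintro t ⟨ht, ht01⟩
    refine mem_iUnion.2 ⟨halfSymbol t, intermittentFormula α t,
      ⟨?_, intermittentFormula_mem hα0 ht01⟩, ?_⟩
    · have : intermittentMap α (t : Circle1) ∈ N := ht
      rwa [intermittentMap_eq, circleRep_coe ht01] at this
    · exact invBranch_intermittentFormula hα0 (mem_half_halfSymbol ht01)
  refine measure_mono_null hsub (measure_iUnion_null fun b => ?_)
  refine nonpos_iff_eq_zero.1 ((volume_image_le_of_sub_le (C := 1) ?_).trans
    (by rw [hN0, mul_zero]))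
  intro x hx y hy
  wlog hxy : y ≤ x generalizing x y
  · rw [abs_sub_comm, abs_sub_comm x]; exact this y hy x hx (not_le.1 hxy).le
  rw [one_mul, abs_of_nonneg (sub_nonneg.2 hxy), abs_of_nonneg (sub_nonneg.2
    ((strictMonoOn_invBranches (fun _ => b) hα0 1).monotoneOn hy.2 hx.2 hxy))]
  exact invBranches_sub_le (fun _ => b) hα0 1 hy.2 hx.2 hxy

/-! ### Unstable manifolds are countable unions of Lipschitz graphs -/

section UnstableGraphs

variable {α : ℝ}

theorem IsBackwardOrbit.eq_of_injective {X : Type*} [MetricSpace X] {T : X → X}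
    (hT : Function.Injective T) {x : X} {u v : ℕ → X} (hu : IsBackwardOrbit T x u)
    (hv : IsBackwardOrbit T x v) : u = v := by
  ext n
  induction n with
  | zero => rw [hu.1, hv.1]
  | succ n ih => exact hT (by rw [hu.2, hv.2, ih])

theorem IsBackwardOrbit.iterate {X : Type*} [MetricSpace X] {T : X → X} {x : X} {u : ℕ → X}
    (hu : IsBackwardOrbit T x u) (n : ℕ) : T^[n] (u n) = x := by
  induction n with
  | zero => exact hu.1
  | succ n ih => rw [Function.iterate_succ_apply, hu.2, ih]

theorem IsBackwardOrbit.shift {X : Type*} [MetricSpace X] {T : X → X} {x : X} {u : ℕ → X}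
    (hu : IsBackwardOrbit T x u) (n : ℕ) : IsBackwardOrbit T (u n) fun k => u (k + n) :=
  ⟨by simp, fun k => by
    have := hu.2 (k + n)
    rwa [add_right_comm] at this⟩

/-- The points whose backward orbit stays uniformly close to `u` in the base. -/
def shadowSet (α : ℝ) (u : ℕ → SolidTorus) : Set SolidTorus :=
  {q | ∃ v, IsBackwardOrbit (solenoidMap α) q v ∧ ∀ n, dist (v n).1 (u n).1 ≤ 1 / 12}

theorem dist_snd_le_of_backwardOrbit {q q' : SolidTorus} {v v' : ℕ → SolidTorus}
    (hv : IsBackwardOrbit (solenoidMap α) q v) (hv' : IsBackwardOrbit (solenoidMap α) q' v')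
    {d : ℝ} (hd : ∀ n, dist (v n).1 (v' n).1 ≤ d) : dist q.2 q'.2 ≤ 4 * d := by
  have h := le_four_mul_of_le_add (D := fun n => dist (v n).1 (v' n).1)
    (W := fun n => dist (v n).2 (v' n).2) (dist_nonneg.trans (hd 0)) hd
    (fun n => dist_unitDisk_le _ _) fun n => by
      have := dist_solenoidMap_snd_le α (v (n + 1)) (v' (n + 1))
      rwa [hv.2, hv'.2] at this
  simpa only [hv.1, hv'.1] using h

/-- Two backward orbits within `1/12` of `u` are within `1/6` of each other, where `f` does not
contract, so their base distance never exceeds the initial one. The fibre contraction then yields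
the factor 4: a shadow set is a Lipschitz graph over part of the circle. -/
theorem dist_le_of_mem_shadowSet (hα0 : 0 < α) (hα1 : α < 1) {u : ℕ → SolidTorus}
    {q q' : SolidTorus} (hq : q ∈ shadowSet α u) (hq' : q' ∈ shadowSet α u) :
    dist q q' ≤ 4 * dist q.1 q'.1 := by
  obtain ⟨v, hv, hvu⟩ := hq
  obtain ⟨v', hv', hvu'⟩ := hq'
  have hd : ∀ n, dist (v n).1 (v' n).1 ≤ dist q.1 q'.1 := by
    intro n
    induction n with
    | zero => rw [hv.1, hv'.1]
    | succ n ih =>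
      refine le_trans ?_ ih
      have hlt : dist (v (n + 1)).1 (v' (n + 1)).1 ≤ 1 / 6 := by
        have := dist_triangle_right (v (n + 1)).1 (v' (n + 1)).1 (u (n + 1)).1
        linarith [hvu (n + 1), hvu' (n + 1)]
      have := dist_le_dist_intermittentMap hα0 hα1 hlt
      rwa [show intermittentMap α (v (n + 1)).1 = (v n).1 from congrArg Prod.fst (hv.2 n),
        show intermittentMap α (v' (n + 1)).1 = (v' n).1 from congrArg Prod.fst (hv'.2 n)] at this
  refine max_le ?_ (dist_snd_le_of_backwardOrbit hv hv' hd)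
  have : 0 ≤ dist q.1 q'.1 := dist_nonneg
  linarith

theorem hausdorffMeasure_shadowSet_inter_eq_zero (hα0 : 0 < α) (hα1 : α < 1)
    (u : ℕ → SolidTorus) {N : Set Circle1} (hN : volume N = 0) :
    μH[1] (shadowSet α u ∩ Prod.fst ⁻¹' N) = 0 := by
  rcases (shadowSet α u).eq_empty_or_nonempty with he | ⟨q0, -⟩
  · simp [he]
  have : Nonempty SolidTorus := ⟨q0⟩
  set s := Function.invFunOn Prod.fst (shadowSet α u) with hs
  have hs1 : ∀ x ∈ Prod.fst '' shadowSet α u, s x ∈ shadowSet α u ∧ (s x).1 = x := fun x hx =>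
    ⟨Function.invFunOn_mem hx, Function.invFunOn_eq hx⟩
  have hl : LipschitzOnWith 4 s (Prod.fst '' shadowSet α u ∩ N) :=
    LipschitzOnWith.of_dist_le_mul fun x hx y hy => by
      have := dist_le_of_mem_shadowSet hα0 hα1 (hs1 x hx.1).1 (hs1 y hy.1).1
      rw [(hs1 x hx.1).2, (hs1 y hy.1).2] at this
      exact_mod_cast this
  have h1 := hl.hausdorffMeasure_image_le zero_le_one
  rw [measure_mono_null inter_subset_right (hausdorffMeasure_eq_zero_of_volume_eq_zero hN),
    mul_zero, nonpos_iff_eq_zero] at h1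
  refine measure_mono_null ?_ h1
  rintro q ⟨hq, hqN⟩
  have hx : q.1 ∈ Prod.fst '' shadowSet α u := ⟨q, hq, rfl⟩
  refine ⟨q.1, ⟨hx, hqN⟩, ?_⟩
  have := dist_le_of_mem_shadowSet hα0 hα1 (hs1 _ hx).1 hq
  rw [(hs1 _ hx).2, dist_self, mul_zero] at this
  exact dist_le_zero.1 this

/-- Backward orbits that converge to each other are eventually within `1/12`; `F^n` carries the
shifted points back. -/
theorem unstableManifold_subset_iUnion (hα0 : 0 < α) (hα1 : α < 1) {p : SolidTorus}
    {u : ℕ → SolidTorus} (hu : IsBackwardOrbit (solenoidMap α) p u) :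
    unstableManifold (solenoidMap α) p ⊆
      ⋃ n, (solenoidMap α)^[n] '' shadowSet α fun k => u (k + n) := by
  rintro q ⟨u', v, hu', hv, C, r, hr0, hr1, hd⟩
  obtain rfl := hu.eq_of_injective (injective_solenoidMap hα0 hα1) hu'
  have hlim : Tendsto (fun n : ℕ => C * r ^ n) atTop (𝓝 (C * 0)) :=
    (tendsto_pow_atTop_nhds_zero_of_lt_one hr0.le hr1).const_mul C
  rw [mul_zero] at hlim
  obtain ⟨n, hn⟩ := eventually_atTop.1 (hlim.eventually_le_const (by norm_num : (0 : ℝ) < 1 / 12))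
  refine mem_iUnion.2 ⟨n, v n, ⟨_, hv.shift n, fun k => ?_⟩, hv.iterate n⟩
  rw [dist_comm]
  exact (le_max_left _ _).trans ((hd (k + n)).trans (hn (k + n) (by omega)))

/-- The projection of an unstable manifold to the circle pulls back Lebesgue null sets to sets
of zero length. -/
theorem hausdorffMeasure_unstableManifold_inter_eq_zero (hα0 : 0 < α) (hα1 : α < 1)
    (p : SolidTorus) {N : Set Circle1} (hN : volume N = 0) :
    μH[1] (unstableManifold (solenoidMap α) p ∩ Prod.fst ⁻¹' N) = 0 := by
  rcases (unstableManifold (solenoidMap α) p).eq_empty_or_nonempty with he | ⟨q, u, v, hu, -⟩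
  · simp [he]
  refine measure_mono_null (t := ⋃ n, (solenoidMap α)^[n] '' ((shadowSet α fun k => u (k + n))
    ∩ Prod.fst ⁻¹' ((intermittentMap α)^[n] ⁻¹' N))) ?_ (measure_iUnion_null fun n => ?_)
  · rintro q ⟨hq, hqN⟩
    obtain ⟨n, w, hw, rfl⟩ := mem_iUnion.1 (unstableManifold_subset_iUnion hα0 hα1 hu hq)
    refine mem_iUnion.2 ⟨n, w, ⟨hw, ?_⟩, rfl⟩
    rwa [mem_preimage, iterate_solenoidMap_fst] at hqN
  · have h1 := hausdorffMeasure_shadowSet_inter_eq_zero hα0 hα1 (fun k => u (k + n))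
      (((quasiMeasurePreserving_intermittentMap hα0).iterate n).preimage_null hN)
    have h2 := ((lipschitzWith_solenoidMap hα0 hα1).iterate n).hausdorffMeasure_image_le
      zero_le_one ((shadowSet α fun k => u (k + n)) ∩
        Prod.fst ⁻¹' ((intermittentMap α)^[n] ⁻¹' N))
    rwa [h1, mul_zero, nonpos_iff_eq_zero] at h2

/-- The projection of an SRB measure of the solenoid map is an SRB measure of the circle map. -/
theorem IsSRB.isCircleSRB_map_fst (hα0 : 0 < α) (hα1 : α < 1) {ν : Measure SolidTorus}
    (hν : IsSRB (solenoidMap α) ν) : IsCircleSRB (intermittentMap α) (ν.map Prod.fst) := by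
  have := hν.isProb
  refine ⟨Measure.isProbabilityMeasure_map measurable_fst.aemeasurable, ?_, ?_⟩
  · refine ⟨measurable_intermittentMap α, ?_⟩
    rw [Measure.map_map (measurable_intermittentMap α) measurable_fst]
    have : intermittentMap α ∘ Prod.fst = Prod.fst ∘ solenoidMap α := rfl
    rw [this, ← Measure.map_map measurable_fst hν.invariant.measurable, hν.invariant.map_eq]
  · obtain ⟨φ, κ, hφ, hκ, hac⟩ := hν.absCont
    refine Measure.AbsolutelyContinuous.mk fun N hN hN0 => ?_
    rw [Measure.map_apply measurable_fst hN]
    have hms : MeasurableSet (Prod.fst ⁻¹' N : Set SolidTorus) := measurable_fst hN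
    -- The measure of the preimage of `N` is the average of its conditional measures, each of which
    -- vanishes because the preimage meets the unstable manifold in zero length.
    rw [← hκ.disintegrates, Measure.bind_apply hms κ.aemeasurable,
      lintegral_map (κ.measurable_coe hms) hφ.measurable]
    refine (lintegral_eq_zero_iff ((κ.measurable_coe hms).comp hφ.measurable)).2 ?_
    filter_upwards [hac] with p hp
    refine hp ?_
    rw [Measure.restrict_apply hms, inter_comm]
    exact hausdorffMeasure_unstableManifold_inter_eq_zero hα0 hα1 p hN0

theorem IsSRB.eq_of_map_fst_isCircleSRB (hα0 : 0 < α) (hα1 : α < 1) {η ν : Measure SolidTorus}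
    [IsFiniteMeasure η] (hη : MeasurePreserving (solenoidMap α) η η)
    (hμ : IsCircleSRB (intermittentMap α) (η.map Prod.fst)) (hν : IsSRB (solenoidMap α) ν) :
    ν = η := by
  have := hν.isProb
  exact eq_of_map_fst_eq hα0 hα1 hη hν.invariant
    (hμ.unique hα0 hα1 (hν.isCircleSRB_map_fst hα0 hα1))

end UnstableGraphs

/-! ### The joint law of the past symbols and the base point -/

/-- The set of pairs of a sequence and a real number that depends on the first `n` symbols of the
sequence only. -/
def DependsOnFirst (n : ℕ) (E : Set ((ℕ → Bool) × ℝ)) : Prop :=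
  ∀ ω ω' : ℕ → Bool, (∀ i < n, ω i = ω' i) → ∀ z, (ω, z) ∈ E ↔ (ω', z) ∈ E

theorem DependsOnFirst.mono {n k : ℕ} {E : Set ((ℕ → Bool) × ℝ)} (h : DependsOnFirst n E)
    (hnk : n ≤ k) : DependsOnFirst k E :=
  fun ω ω' hω => h ω ω' fun i hi => hω i (by omega)

/-- The measurable sets that depend on finitely many symbols. -/
def finiteDependenceAlgebra : Set (Set ((ℕ → Bool) × ℝ)) :=
  {E | MeasurableSet E ∧ ∃ n, DependsOnFirst n E}

theorem isSetAlgebra_finiteDependenceAlgebra : IsSetAlgebra finiteDependenceAlgebra where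
  empty_mem := ⟨MeasurableSet.empty, 0, fun _ _ _ _ => Iff.rfl⟩
  compl_mem := fun _ ⟨hm, n, hn⟩ => ⟨hm.compl, n, fun ω ω' h z => not_congr (hn ω ω' h z)⟩
  union_mem := fun _ _ ⟨hm, n, hn⟩ ⟨hm', n', hn'⟩ => ⟨hm.union hm', max n n', fun ω ω' h z =>
    or_congr (hn.mono (le_max_left _ _) ω ω' h z) (hn'.mono (le_max_right _ _) ω ω' h z)⟩

theorem generateFrom_finiteDependenceAlgebra :
    (inferInstance : MeasurableSpace ((ℕ → Bool) × ℝ)) =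
      MeasurableSpace.generateFrom finiteDependenceAlgebra := by
  refine le_antisymm (sup_le ?_ ?_) (MeasurableSpace.generateFrom_le fun E hE => hE.1)
  · rw [← measurable_iff_comap_le]
    refine @measurable_pi_lambda _ _ _ (MeasurableSpace.generateFrom finiteDependenceAlgebra) _ _
      fun i => ?_
    refine @measurable_to_bool _ (MeasurableSpace.generateFrom finiteDependenceAlgebra) _ ?_
    refine MeasurableSpace.measurableSet_generateFrom ⟨?_, i + 1, fun ω ω' h z => ?_⟩
    · exact ((measurable_pi_apply i).comp measurable_fst) (measurableSet_singleton true)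
    · simp only [mem_preimage, mem_singleton_iff, h i (Nat.lt_succ_self i)]
  · rw [← measurable_iff_comap_le]
    intro S hS
    exact MeasurableSpace.measurableSet_generateFrom
      ⟨measurable_snd hS, 0, fun _ _ _ _ => Iff.rfl⟩

section Symbols

variable {α : ℝ} {G : SolidTorus → SolidTorus}

/-- The itinerary of the backward orbit of a point under a left inverse `G` of the solenoid map. -/
def pastSymbols (G : SolidTorus → SolidTorus) (p : SolidTorus) : ℕ → Bool :=
  fun i => halfSymbol (circleRep (G^[i + 1] p).1)

theorem measurable_pastSymbols (hG : Measurable G) : Measurable (pastSymbols G) :=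
  measurable_pi_lambda _ fun i => measurable_halfSymbol.comp
    (measurable_circleRep.comp (measurable_fst.comp (hG.iterate (i + 1))))

/-- The recent past of `F^n q` is the future of the base point of `q`. This turns statements about
the past under `η` into statements about the projected measure. -/
theorem pastSymbols_iterate (hα0 : 0 < α) (hGF : Function.LeftInverse G (solenoidMap α)) {n i : ℕ}
    (hi : i < n) (q : SolidTorus) : pastSymbols G ((solenoidMap α)^[n] q) i =
      extendWord (pastWord α n (circleRep q.1)) i := by
  have h : G^[i + 1] ((solenoidMap α)^[n] q) = (solenoidMap α)^[n - 1 - i] q := by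
    obtain ⟨j, rfl⟩ : ∃ j, n = (i + 1) + j := ⟨n - 1 - i, by omega⟩
    rw [Function.iterate_add_apply (solenoidMap α), hGF.iterate (i + 1),
      show i + 1 + j - 1 - i = j by omega]
  rw [pastSymbols, h, iterate_solenoidMap_fst, circleRep_iterate_intermittentMap hα0,
    extendWord_of_lt _ hi, pastWord]

theorem measurable_pastSymbols_prodMk (hG : Measurable G) :
    Measurable fun p : SolidTorus => (pastSymbols G p, circleRep p.1) :=
  (measurable_pastSymbols hG).prodMk (measurable_circleRep.comp measurable_fst)

theorem map_pastSymbols_prodMk_apply_le (hα0 : 0 < α) (hα1 : α < 1) (hG : Measurable G)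
    (hGF : Function.LeftInverse G (solenoidMap α)) {η : Measure SolidTorus} [IsFiniteMeasure η]
    (hη : MeasurePreserving (solenoidMap α) η η) (hac : η.map Prod.fst ≪ volume) {ε : ℝ}
    (hε : 0 < ε) {E : Set ((ℕ → Bool) × ℝ)} (hE : MeasurableSet E) {k : ℕ}
    (hk : DependsOnFirst k E) (hK : E ⊆ univ ×ˢ Icc ε (1 - ε)) :
    η.map (fun p => (pastSymbols G p, circleRep p.1)) E ≤
      ENNReal.ofReal (4 / ε ^ 2) * ((η.map (pastSymbols G)).prod volume) E := by
  refine ENNReal_le_of_forall_ofReal_le (K := ENNReal.ofReal (4 / ε ^ 2) + 1) (by finiteness)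
    fun δ hδ => ?_
  have hm := map_circleRep_absolutelyContinuous hac
  obtain ⟨N, hN⟩ := measure_pastWord_iterate_le hα0 hα1 hm hε hδ
  -- Replace `p` by `F^n q`, which has the same law. As `n ≥ k`, the first `k` past symbols are then
  -- read off the base point of `q`, and `n ≥ N` makes the distortion estimate available.
  set n := max N k
  have hdep := hk.mono (le_max_right N k)
  let E' : (Fin n → Bool) → Set ℝ := fun a => Prod.mk (extendWord a) ⁻¹' E
  have hE' : ∀ a, MeasurableSet (E' a) := fun a => measurable_prodMk_left hE
  have h := hN n (le_max_left N k) E' hE' fun a z hz => (hK hz).2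
  have hpi := measurable_pastSymbols hG
  have hslice : ∀ q : SolidTorus, Prod.mk (pastSymbols G ((solenoidMap α)^[n] q)) ⁻¹' E =
      E' (pastWord α n (circleRep q.1)) := fun q => by
    ext z
    exact hdep _ _ (fun i hi => pastSymbols_iterate hα0 hGF hi q) z
  have hrf : Measurable (circleRep ∘ (Prod.fst : SolidTorus → Circle1)) :=
    measurable_circleRep.comp measurable_fst
  have e1 : η.map (fun p => (pastSymbols G p, circleRep p.1)) E = ((η.map Prod.fst).map circleRep)
      {x | (intermittentFormula α)^[n] x ∈ E' (pastWord α n x)} := by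
    have hmeas : MeasurableSet {x | (intermittentFormula α)^[n] x ∈ E' (pastWord α n x)} := by
      have : {x | (intermittentFormula α)^[n] x ∈ E' (pastWord α n x)} =
          ⋃ a, (pastWord α n ⁻¹' {a} ∩ (intermittentFormula α)^[n] ⁻¹' E' a) := by
        ext x; simp
      rw [this]
      exact MeasurableSet.iUnion fun a =>
        ((measurable_pastWord α n) (measurableSet_singleton a)).inter
          (((measurable_intermittentFormula α).iterate n) (hE' a))
    rw [Measure.map_map measurable_circleRep measurable_fst, Measure.map_apply hrf hmeas,
      Measure.map_apply (measurable_pastSymbols_prodMk hG) hE,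
      ← (hη.iterate n).measure_preimage (measurable_pastSymbols_prodMk hG hE).nullMeasurableSet]
    congr 1
    ext q
    simp only [mem_preimage, mem_ofPred_eq, Function.comp]
    rw [iterate_solenoidMap_fst, circleRep_iterate_intermittentMap hα0, ← hslice q]
    rfl
  have e2 : ∫⁻ x, volume (E' (pastWord α n x)) ∂((η.map Prod.fst).map circleRep) =
      ((η.map (pastSymbols G)).prod volume) E := by
    have hm1 : Measurable fun ω : ℕ → Bool => volume (Prod.mk ω ⁻¹' E) :=
      measurable_measure_prodMk_left hE
    have hm2 : Measurable fun x => volume (E' (pastWord α n x)) :=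
      (Measurable.of_discrete (f := fun a => volume (E' a))).comp (measurable_pastWord α n)
    have hinv := (hη.iterate n).lintegral_comp (hm1.comp hpi)
    rw [Measure.prod_apply hE, lintegral_map hm1 hpi,
      Measure.map_map measurable_circleRep measurable_fst, lintegral_map hm2 hrf]
    refine Eq.trans (lintegral_congr fun q => ?_) hinv
    simp only [Function.comp]
    rw [hslice q]
  rw [e1, ← e2]
  exact h

/-- The joint law of the past symbols and the base point is absolutely continuous with respect
to the product of the law of the symbols and Lebesgue measure. -/
theorem map_pastSymbols_prodMk_absolutelyContinuous (hα0 : 0 < α) (hα1 : α < 1)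
    (hG : Measurable G) (hGF : Function.LeftInverse G (solenoidMap α)) {η : Measure SolidTorus}
    [IsFiniteMeasure η] (hη : MeasurePreserving (solenoidMap α) η η)
    (hac : η.map Prod.fst ≪ volume) :
    η.map (fun p => (pastSymbols G p, circleRep p.1)) ≪
      (η.map (pastSymbols G)).prod (volume.restrict (Ico 0 1)) := by
  set J := η.map (fun p => (pastSymbols G p, circleRep p.1))
  set P := η.map (pastSymbols G)
  have hJ := measurable_pastSymbols_prodMk hG
  -- The constant does not depend on the number of symbols, so the inequality extends from the
  -- algebra of sets of finite dependence to all measurable sets.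
  have hle : ∀ ε : ℝ, 0 < ε → J.restrict (univ ×ˢ Icc ε (1 - ε)) ≤
      ENNReal.ofReal (4 / ε ^ 2) • P.prod (volume.restrict (Icc ε (1 - ε))) := by
    intro ε hε
    have : IsFiniteMeasure (ENNReal.ofReal (4 / ε ^ 2) •
        P.prod (volume.restrict (Icc ε (1 - ε)))) := Measure.smul_finite _ ENNReal.ofReal_ne_top
    refine measure_le_of_forall_isSetAlgebra isSetAlgebra_finiteDependenceAlgebra
      generateFrom_finiteDependenceAlgebra fun E hE => ?_
    obtain ⟨hEm, k, hk⟩ := hE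
    have hKm : MeasurableSet ((univ : Set (ℕ → Bool)) ×ˢ Icc ε (1 - ε)) :=
      MeasurableSet.univ.prod measurableSet_Icc
    have hdep : DependsOnFirst k (E ∩ univ ×ˢ Icc ε (1 - ε)) := fun ω ω' h z =>
      and_congr (hk ω ω' h z) (by simp)
    have h := map_pastSymbols_prodMk_apply_le hα0 hα1 hG hGF hη hac hε (hEm.inter hKm) hdep
      inter_subset_right
    rw [Measure.restrict_apply hEm, Measure.smul_apply, smul_eq_mul]
    refine h.trans_eq ?_
    rw [← Measure.restrict_apply hEm, ← Measure.prod_restrict, Measure.restrict_univ]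
  refine Measure.AbsolutelyContinuous.mk fun E hE hE0 => ?_
  have hcover : E ⊆ (⋃ k : ℕ, E ∩ univ ×ˢ Icc (1 / ((k : ℝ) + 1)) (1 - 1 / ((k : ℝ) + 1)))
      ∪ univ ×ˢ (Ioo 0 1)ᶜ := by
    rintro ⟨ω, z⟩ hz
    by_cases hz01 : z ∈ Ioo (0 : ℝ) 1
    · left
      obtain ⟨k, hk⟩ := exists_nat_one_div_lt (lt_min hz01.1 (sub_pos.2 hz01.2))
      exact mem_iUnion.2 ⟨k, hz, mem_univ _, (hk.le.trans (min_le_left _ _)),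
        by linarith [hk.le.trans (min_le_right z (1 - z))]⟩
    · exact Or.inr ⟨mem_univ _, hz01⟩
  refine measure_mono_null hcover (measure_union_null (measure_iUnion_null fun k => ?_) ?_)
  · have hk : (0 : ℝ) < 1 / ((k : ℝ) + 1) := by positivity
    rw [← Measure.restrict_apply hE]
    refine nonpos_iff_eq_zero.1 ((hle _ hk E).trans (le_of_eq ?_))
    rw [Measure.smul_apply, smul_eq_mul]
    have hsub : volume.restrict (Icc (1 / ((k : ℝ) + 1)) (1 - 1 / ((k : ℝ) + 1))) ≤
        volume.restrict (Ico (0 : ℝ) 1) :=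
      Measure.restrict_mono (Icc_subset_Ico_right (by linarith) |>.trans
        (Ico_subset_Ico_left hk.le)) le_rfl
    have h0 : P.prod (volume.restrict (Icc (1 / ((k : ℝ) + 1)) (1 - 1 / ((k : ℝ) + 1)))) E = 0 :=
      (Measure.AbsolutelyContinuous.rfl.prod (Measure.absolutelyContinuous_of_le hsub)) hE0
    rw [h0, mul_zero]
  · rw [Measure.map_apply hJ (MeasurableSet.univ.prod measurableSet_Ioo.compl)]
    have h0 : ((η.map Prod.fst).map circleRep) (Ioo 0 1)ᶜ = 0 := by
      apply map_circleRep_absolutelyContinuous hac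
      rw [← restrict_Ioo_eq_restrict_Ico, Measure.restrict_apply measurableSet_Ioo.compl,
        compl_inter_self, measure_empty]
    rw [Measure.map_map measurable_circleRep measurable_fst, Measure.map_apply
      (measurable_circleRep.comp measurable_fst) measurableSet_Ioo.compl] at h0
    refine measure_mono_null ?_ h0
    rintro p ⟨-, hp⟩
    exact hp

end Symbols

/-! ### Backward orbits of typical points -/

/-- `G` pushes `η = T_* η` to `η`, and `η` is carried by the range of `T`. So almost surely all `G^n
p` are in that range, where `G` is a right inverse as well. -/
theorem ae_isBackwardOrbit {X : Type*} [MetricSpace X] [MeasurableSpace X] {T G : X → X}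
    (hT : MeasurableEmbedding T) (hG : Measurable G) (hGT : Function.LeftInverse G T)
    {η : Measure X} (hη : MeasurePreserving T η η) :
    MeasurePreserving G η η ∧ ∀ᵐ p ∂η, IsBackwardOrbit T p fun n => G^[n] p := by
  have hGη : MeasurePreserving G η η := by
    refine ⟨hG, ?_⟩
    conv_lhs => rw [← hη.map_eq]
    rw [Measure.map_map hG hη.measurable, hGT.comp_eq_id, Measure.map_id]
  refine ⟨hGη, ?_⟩
  have hrange : ∀ᵐ p ∂η, p ∈ range T := by
    rw [← hη.map_eq]
    exact ae_map_mem_range T hT.measurableSet_range η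
  have h : ∀ᵐ p ∂η, ∀ n, G^[n] p ∈ range T :=
    ae_all_iff.2 fun n => (hGη.iterate n).quasiMeasurePreserving.ae hrange
  filter_upwards [h] with p hp
  refine ⟨rfl, fun n => ?_⟩
  obtain ⟨q, hq⟩ := hp n
  simp only [Function.iterate_succ_apply', ← hq, hGT q]

section Backward

variable {α : ℝ} {G : SolidTorus → SolidTorus}

theorem circleRep_iterate_eq_invBranches (hα0 : 0 < α) {p : SolidTorus}
    (hp : IsBackwardOrbit (solenoidMap α) p fun n => G^[n] p) (n : ℕ) :
    circleRep (G^[n] p).1 = invBranches α (pastSymbols G p) n (circleRep p.1) := by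
  induction n with
  | zero => rfl
  | succ n ih =>
    rw [invBranches_succ_apply, ← ih, ← show solenoidMap α (G^[n + 1] p) = G^[n] p from hp.2 n,
      show (solenoidMap α (G^[n + 1] p)).1 = intermittentMap α (G^[n + 1] p).1 from rfl,
      circleRep_intermittentMap hα0]
    exact (invBranch_intermittentFormula hα0 (mem_half_halfSymbol (circleRep_mem _))).symm

/-- Only the orbit of `x` has to be away from the neutral point, while `y` is arbitrary: the
expansion bound needs just one endpoint, whichever way `x` and `y` are ordered. -/
theorem abs_invBranches_sub_le (ω : ℕ → Bool) (hα0 : 0 < α) (n : ℕ) {m x y : ℝ}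
    (hx : x ∈ Ico (0 : ℝ) 1) (hy : y ∈ Ico (0 : ℝ) 1) (hm : 0 ≤ m)
    (h : invBranches α ω (n + 1) x ∈ Icc m (1 - m)) :
    (1 + 2 ^ α * m ^ α) * |invBranches α ω (n + 1) x - invBranches α ω (n + 1) y| ≤
      |invBranches α ω n x - invBranches α ω n y| := by
  have hmono := (strictMonoOn_invBranches ω hα0 (n + 1)).monotoneOn
  have hmono' := (strictMonoOn_invBranches ω hα0 n).monotoneOn
  rcases le_total x y with hxy | hxy
  · rw [abs_sub_comm, abs_sub_comm (invBranches α ω n x),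
      abs_of_nonneg (sub_nonneg.2 (hmono hx hy hxy)),
      abs_of_nonneg (sub_nonneg.2 (hmono' hx hy hxy))]
    exact invBranches_succ_sub_le ω hα0 n hx hy hxy hm (h.1.trans (hmono hx hy hxy))
      (by linarith [h.2])
  · rw [abs_of_nonneg (sub_nonneg.2 (hmono hy hx hxy)),
      abs_of_nonneg (sub_nonneg.2 (hmono' hy hx hxy))]
    exact invBranches_succ_sub_le ω hα0 n hy hx hxy hm h.1
      (by linarith [h.2, hmono hy hx hxy])

theorem antitone_abs_invBranches_sub (ω : ℕ → Bool) (hα0 : 0 < α) {x y : ℝ}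
    (hx : x ∈ Ico (0 : ℝ) 1) (hy : y ∈ Ico (0 : ℝ) 1) :
    Antitone fun n => |invBranches α ω n x - invBranches α ω n y| := by
  refine antitone_nat_of_succ_le fun n => ?_
  have hx' := invBranches_mem ω hα0 (n + 1) hx
  have h := abs_invBranches_sub_le ω hα0 n hx hy le_rfl (by simpa using ⟨hx'.1, hx'.2.le⟩)
  rwa [Real.zero_rpow hα0.ne', mul_zero, add_zero, one_mul] at h

/-- The distance of two backward orbits with the same symbols is controlled by the distance of
their base points. -/
theorem dist_iterate_le_of_pastSymbols_eq (hα0 : 0 < α) {p q : SolidTorus}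
    (hp : IsBackwardOrbit (solenoidMap α) p fun n => G^[n] p)
    (hq : IsBackwardOrbit (solenoidMap α) q fun n => G^[n] q)
    (hpq : pastSymbols G q = pastSymbols G p) (n : ℕ) :
    dist (G^[n] p) (G^[n] q) ≤ 4 * |invBranches α (pastSymbols G p) n (circleRep p.1) -
      invBranches α (pastSymbols G p) n (circleRep q.1)| := by
  have h : ∀ k, dist (G^[k] p).1 (G^[k] q).1 ≤
      |invBranches α (pastSymbols G p) k (circleRep p.1) -
        invBranches α (pastSymbols G p) k (circleRep q.1)| := fun k => by
    conv_rhs => rw [← circleRep_iterate_eq_invBranches hα0 hp k]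
    conv_rhs => rw [← hpq, ← circleRep_iterate_eq_invBranches hα0 hq k]
    refine le_trans (le_of_eq ?_) (dist_coe_le _ _)
    rw [coe_circleRep, coe_circleRep]
  have hn := h n
  refine max_le (hn.trans (le_mul_of_one_le_left (abs_nonneg _) (by norm_num))) ?_
  exact dist_snd_le_of_backwardOrbit (hp.shift n) (hq.shift n) fun k =>
    (h _).trans (antitone_abs_invBranches_sub _ hα0 (circleRep_mem _) (circleRep_mem _)
      (by omega))

/-- Each visit of the backward orbit to the region away from the neutral point contracts by `l = 1 +
2^α δ^α`; with at least `ρ n` visits the rate is `l^(-ρ)`. The constants are uniform in the second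
point `y`. -/
theorem exists_abs_invBranches_sub_le (hα0 : 0 < α) {p : SolidTorus}
    (hp : IsBackwardOrbit (solenoidMap α) p fun n => G^[n] p) {δ ρ : ℝ} (hδ : 0 < δ) (hρ : 0 < ρ)
    {N : ℕ} (hN : ∀ n ≥ N, ρ * n ≤ birkhoffSum G
      ({q : SolidTorus | circleRep q.1 ∈ Icc δ (1 - δ)}.indicator fun _ => (1 : ℝ)) n p) :
    ∃ C r : ℝ, 0 < r ∧ r < 1 ∧ ∀ y ∈ Ico (0 : ℝ) 1, ∀ n,
      |invBranches α (pastSymbols G p) n (circleRep p.1) -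
        invBranches α (pastSymbols G p) n y| ≤ C * r ^ n := by
  set B := {q : SolidTorus | circleRep q.1 ∈ Icc δ (1 - δ)}
  set S : ℕ → ℝ := fun n => birkhoffSum G (B.indicator fun _ => (1 : ℝ)) n p
  set l : ℝ := 1 + 2 ^ α * δ ^ α
  have hl : 1 < l := by
    have : 0 < (2 : ℝ) ^ α * δ ^ α := by positivity
    simp only [l]; linarith
  have hl0 : 0 < l := zero_lt_one.trans hl
  have hr0 : 0 < l ^ (-ρ) := Real.rpow_pos_of_pos hl0 _
  have hr1 : l ^ (-ρ) < 1 := Real.rpow_lt_one_of_one_lt_of_neg hl (neg_lt_zero.2 hρ)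
  -- The second summand covers the times up to `N`, where only the trivial bound 1 is available.
  refine ⟨l + ((l ^ (-ρ)) ^ N)⁻¹, l ^ (-ρ), hr0, hr1, fun y hy n => ?_⟩
  set D : ℕ → ℝ := fun n => |invBranches α (pastSymbols G p) n (circleRep p.1) -
    invBranches α (pastSymbols G p) n y|
  have hx := circleRep_mem p.1
  have hD : Antitone D := antitone_abs_invBranches_sub _ hα0 hx hy
  have hD0 : D 0 ≤ 1 := by
    refine abs_le.2 ⟨?_, ?_⟩ <;> simp only [invBranches, id] <;> linarith [hx.1, hx.2, hy.1, hy.2]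
  -- `S (n + 1)` counts visits at times `0` to `n`. The visit at time 0 contracts nothing, hence the
  -- bound `l` instead of 1.
  have hprod : ∀ n, D n * l ^ S (n + 1) ≤ l := by
    intro n
    induction n with
    | zero =>
      have h1 : S 1 ≤ 1 := by
        simp only [S, birkhoffSum_one]
        exact indicator_le_self' (fun _ _ => zero_le_one) p
      calc D 0 * l ^ S 1 ≤ 1 * l ^ (1 : ℝ) :=
            mul_le_mul hD0 (Real.rpow_le_rpow_of_exponent_le hl.le h1) (by positivity) zero_le_one
        _ = l := by rw [one_mul, Real.rpow_one]
    | succ n ih =>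
      have hS : S (n + 1 + 1) = S (n + 1) + B.indicator (fun _ => (1 : ℝ)) (G^[n + 1] p) :=
        birkhoffSum_succ _ _ _ _
      refine le_trans ?_ ih
      by_cases hB : G^[n + 1] p ∈ B
      · rw [hS, indicator_of_mem hB, Real.rpow_add hl0, Real.rpow_one, mul_comm (l ^ _), ← mul_assoc]
        refine mul_le_mul_of_nonneg_right ?_ (by positivity)
        rw [mul_comm]
        refine abs_invBranches_sub_le _ hα0 n hx hy hδ.le ?_
        rw [← circleRep_iterate_eq_invBranches hα0 hp]
        exact hB
      · rw [hS, indicator_of_notMem hB, add_zero]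
        exact mul_le_mul_of_nonneg_right (hD n.le_succ) (by positivity)
  have hrn : 0 < (l ^ (-ρ)) ^ n := pow_pos hr0 n
  rcases le_total N n with hn | hn
  · have h1 : ((l ^ (-ρ)) ^ n)⁻¹ ≤ l ^ S (n + 1) := by
      rw [← Real.rpow_natCast, ← Real.rpow_mul hl0.le, ← Real.rpow_neg hl0.le]
      refine Real.rpow_le_rpow_of_exponent_le hl.le ?_
      have := hN (n + 1) (by omega)
      push_cast at this
      simp only [S]
      linarith
    have h2 : D n * ((l ^ (-ρ)) ^ n)⁻¹ ≤ l :=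
      (mul_le_mul_of_nonneg_left h1 (abs_nonneg _)).trans (hprod n)
    rw [← div_eq_mul_inv, div_le_iff₀ hrn] at h2
    refine h2.trans (mul_le_mul_of_nonneg_right ?_ hrn.le)
    exact le_add_of_nonneg_right (by positivity)
  · refine ((hD n.zero_le).trans hD0).trans ?_
    have h1 : 1 ≤ ((l ^ (-ρ)) ^ N)⁻¹ * (l ^ (-ρ)) ^ n := by
      rw [inv_mul_eq_div, one_le_div (pow_pos hr0 N)]
      exact pow_le_pow_of_le_one hr0.le hr1.le hn
    rw [add_mul]
    have := mul_pos hl0 hrn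
    linarith

theorem ae_circleRep_fst_mem_Ioo {η : Measure SolidTorus} (hac : η.map Prod.fst ≪ volume) :
    ∀ᵐ p ∂η, circleRep p.1 ∈ Ioo (0 : ℝ) 1 := by
  have h : ∀ᵐ t ∂((η.map Prod.fst).map circleRep), t ∈ Ioo (0 : ℝ) 1 := by
    refine (map_circleRep_absolutelyContinuous hac).ae_le ?_
    rw [← restrict_Ioo_eq_restrict_Ico]
    exact ae_restrict_mem measurableSet_Ioo
  exact ae_of_ae_map measurable_fst.aemeasurable
    (ae_of_ae_map measurable_circleRep.aemeasurable h)

/-- For almost every point, all points with the same past symbols lie in its unstable manifold. -/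
theorem ae_mem_unstableManifold (hα0 : 0 < α) {η : Measure SolidTorus} [IsFiniteMeasure η]
    (hG : MeasurePreserving G η η)
    (hΛ : ∀ᵐ p ∂η, IsBackwardOrbit (solenoidMap α) p fun n => G^[n] p)
    (hac : η.map Prod.fst ≪ volume) :
    ∀ᵐ p ∂η, ∀ q, (IsBackwardOrbit (solenoidMap α) q fun n => G^[n] q) →
      pastSymbols G q = pastSymbols G p → q ∈ unstableManifold (solenoidMap α) p := by
  have hB : ∀ k : ℕ, MeasurableSet {q : SolidTorus | circleRep q.1 ∈
      Icc (1 / ((k : ℝ) + 1)) (1 - 1 / ((k : ℝ) + 1))} := fun k =>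
    (measurable_circleRep.comp measurable_fst) measurableSet_Icc
  have hrec := ae_all_iff.2 fun k : ℕ => ae_exists_le_birkhoffSum_indicator hG (hB k)
  filter_upwards [hΛ, hrec, ae_circleRep_fst_mem_Ioo hac] with p hp hr h0 q hq hqp
  -- The region is chosen to contain `p` itself, so that recurrence applies to it.
  obtain ⟨k, hk⟩ := exists_nat_one_div_lt (lt_min h0.1 (sub_pos.2 h0.2))
  obtain ⟨ρ, hρ, N, hN⟩ := hr k ⟨hk.le.trans (min_le_left _ _),
    by linarith [hk.le.trans (min_le_right (circleRep p.1) (1 - circleRep p.1))]⟩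
  obtain ⟨C, r, hr0, hr1, hC⟩ := exists_abs_invBranches_sub_le hα0 hp (by positivity) hρ hN
  refine ⟨_, _, hp, hq, 4 * C, r, hr0, hr1, fun n => ?_⟩
  refine (dist_iterate_le_of_pastSymbols_eq hα0 hp hq hqp n).trans ?_
  rw [mul_assoc]
  exact mul_le_mul_of_nonneg_left (hC _ (circleRep_mem _) n) (by norm_num)

end Backward

/-! ### Arcs of points with given past symbols -/

section Arcs

variable {α : ℝ} {G : SolidTorus → SolidTorus}

/-- The terms of the series for the fibre coordinate of the point with past symbols `ω` over `x`. -/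
def fibreTerm (α : ℝ) (ω : ℕ → Bool) (k : ℕ) (x : ℝ) : ℂ :=
  ((1 / 2 : ℝ) * (1 / 5) ^ k) • circleExp (invBranches α ω (k + 1) x : Circle1)

theorem norm_fibreTerm (α : ℝ) (ω : ℕ → Bool) (k : ℕ) (x : ℝ) :
    ‖fibreTerm α ω k x‖ = 1 / 2 * (1 / 5) ^ k := by
  rw [fibreTerm, norm_smul, norm_circleExp, mul_one, Real.norm_of_nonneg (by positivity)]

theorem hasSum_norm_fibreTerm : HasSum (fun k : ℕ => (1 / 2 : ℝ) * (1 / 5) ^ k) (5 / 8) := by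
  have h := (hasSum_geometric_of_lt_one (by norm_num : (0 : ℝ) ≤ 1 / 5) (by norm_num)).mul_left
    (1 / 2)
  norm_num at h ⊢
  exact h

/-- The fibre coordinate of the point with past symbols `ω` over `x`. -/
def fibreSeries (α : ℝ) (ω : ℕ → Bool) (x : ℝ) : ℂ := ∑' k, fibreTerm α ω k x

theorem summable_fibreTerm (α : ℝ) (ω : ℕ → Bool) (x : ℝ) : Summable fun k => fibreTerm α ω k x :=
  .of_norm_bounded hasSum_norm_fibreTerm.summable fun k => (norm_fibreTerm α ω k x).le

theorem fibreSeries_mem (α : ℝ) (ω : ℕ → Bool) (x : ℝ) :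
    fibreSeries α ω x ∈ Metric.closedBall (0 : ℂ) 1 := by
  rw [mem_closedBall_zero_iff]
  exact (tsum_of_norm_bounded hasSum_norm_fibreTerm fun k => (norm_fibreTerm α ω k x).le).trans
    (by norm_num)

/-- The fibre equation `w = e/2 + w'/5` along a backward orbit, whose solution by iteration is the
series. -/
theorem fibreFormula_fibreSeries (α : ℝ) (ω : ℕ → Bool) (x : ℝ) :
    fibreFormula (invBranch α (ω 0) x : Circle1)
      (fibreSeries α (fun i => ω (i + 1)) (invBranch α (ω 0) x)) = fibreSeries α ω x := by
  have hs := (summable_fibreTerm α (fun i => ω (i + 1)) (invBranch α (ω 0) x)).tsum_const_smul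
    (1 / 5 : ℝ)
  rw [fibreFormula_eq, fibreSeries, fibreSeries, (summable_fibreTerm α ω x).tsum_eq_zero_add, ← hs]
  congr 1
  · simp [fibreTerm, invBranches]
  · refine tsum_congr fun k => ?_
    rw [fibreTerm, fibreTerm, smul_smul, invBranches_succ_apply' ω α (k + 1) x]
    congr 1
    ring

theorem continuousOn_fibreSeries (hα0 : 0 < α) (ω : ℕ → Bool) :
    ContinuousOn (fibreSeries α ω) (Ico 0 1) := by
  have hexp : Continuous fun t : ℝ => circleExp (t : Circle1) := by
    simp only [circleExp_coe]
    fun_prop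
  refine continuousOn_tsum (fun k => ?_) hasSum_norm_fibreTerm.summable
    fun k x _ => (norm_fibreTerm α ω k x).le
  exact (hexp.comp_continuousOn (continuousOn_invBranches ω hα0 (k + 1))).const_smul
    ((1 / 2 : ℝ) * (1 / 5) ^ k)

/-- The point of the attractor with past symbols `ω` over `x`. -/
def attractorPoint (α : ℝ) (ω : ℕ → Bool) (x : ℝ) : SolidTorus :=
  ((x : Circle1), ⟨fibreSeries α ω x, fibreSeries_mem α ω x⟩)

theorem solenoidMap_attractorPoint (hα0 : 0 < α) (ω : ℕ → Bool) {x : ℝ} (hx : x ∈ Ico (0 : ℝ) 1) :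
    solenoidMap α (attractorPoint α (fun i => ω (i + 1)) (invBranch α (ω 0) x)) =
      attractorPoint α ω x := by
  refine Prod.ext ?_ (Subtype.ext (fibreFormula_fibreSeries α ω x))
  change intermittentMap α _ = (x : Circle1)
  rw [intermittentMap_eq, attractorPoint,
    circleRep_coe (half_subset _ (invBranch_mem hα0 (ω 0) hx)),
    intermittentFormula_invBranch hα0 _ hx]

theorem continuousOn_attractorPoint (hα0 : 0 < α) (ω : ℕ → Bool) :
    ContinuousOn (attractorPoint α ω) (Ico 0 1) :=
  (AddCircle.continuous_mk' 1).continuousOn.prodMk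
    (IsInducing.subtypeVal.continuousOn_iff.2 (continuousOn_fibreSeries hα0 ω))

theorem injOn_attractorPoint (α : ℝ) (ω : ℕ → Bool) : InjOn (attractorPoint α ω) (Ico 0 1) := by
  intro x hx y hy h
  rw [← circleRep_coe hx, ← circleRep_coe hy]
  exact congrArg (fun p : SolidTorus => circleRep p.1) h

theorem iterate_attractorPoint (hα0 : 0 < α) (hGF : Function.LeftInverse G (solenoidMap α))
    (n : ℕ) (ω : ℕ → Bool) {x : ℝ} (hx : x ∈ Ico (0 : ℝ) 1) :
    G^[n] (attractorPoint α ω x) =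
      attractorPoint α (fun i => ω (i + n)) (invBranches α ω n x) := by
  induction n with
  | zero => rfl
  | succ n ih =>
    have h := solenoidMap_attractorPoint hα0 (fun i => ω (i + n)) (invBranches_mem ω hα0 n hx)
    rw [Function.iterate_succ_apply', ih, ← h, hGF, invBranches_succ_apply]
    simp only [zero_add, add_right_comm _ 1 n, add_assoc]

theorem isBackwardOrbit_attractorPoint (hα0 : 0 < α)
    (hGF : Function.LeftInverse G (solenoidMap α)) (ω : ℕ → Bool) {x : ℝ}
    (hx : x ∈ Ico (0 : ℝ) 1) :
    IsBackwardOrbit (solenoidMap α) (attractorPoint α ω x)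
      fun n => G^[n] (attractorPoint α ω x) := by
  refine ⟨rfl, fun n => ?_⟩
  have h := solenoidMap_attractorPoint hα0 (fun i => ω (i + n)) (invBranches_mem ω hα0 n hx)
  simp only [Function.iterate_succ_apply', iterate_attractorPoint hα0 hGF n ω hx]
  rw [← h, hGF]

theorem pastSymbols_attractorPoint (hα0 : 0 < α) (hGF : Function.LeftInverse G (solenoidMap α))
    (ω : ℕ → Bool) {x : ℝ} (hx : x ∈ Ico (0 : ℝ) 1) :
    pastSymbols G (attractorPoint α ω x) = ω := by
  ext i
  rw [pastSymbols, iterate_attractorPoint hα0 hGF _ ω hx, attractorPoint,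
    circleRep_coe (invBranches_mem ω hα0 (i + 1) hx), halfSymbol_invBranches_succ ω hα0 i hx]

/-- Both points have full backward orbits, the same past symbols and the same base point, so their
distance estimate at time 0 is zero. -/
theorem attractorPoint_pastSymbols (hα0 : 0 < α) (hGF : Function.LeftInverse G (solenoidMap α))
    {p : SolidTorus} (hp : IsBackwardOrbit (solenoidMap α) p fun n => G^[n] p) :
    attractorPoint α (pastSymbols G p) (circleRep p.1) = p := by
  have hx := circleRep_mem p.1
  have h := dist_iterate_le_of_pastSymbols_eq hα0 hp
    (isBackwardOrbit_attractorPoint hα0 hGF (pastSymbols G p) hx)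
    (pastSymbols_attractorPoint hα0 hGF _ hx) 0
  have e : circleRep (attractorPoint α (pastSymbols G p) (circleRep p.1)).1 = circleRep p.1 :=
    circleRep_coe hx
  rw [e, sub_self, abs_zero, mul_zero] at h
  exact (dist_le_zero.1 h).symm

/-- A point of the attractor over an interior point of the fundamental domain is an interior
point of an arc of points with the same past symbols. -/
theorem containsArcThrough_of_pastSymbols (hα0 : 0 < α)
    (hGF : Function.LeftInverse G (solenoidMap α)) {p : SolidTorus}
    (hp : IsBackwardOrbit (solenoidMap α) p fun n => G^[n] p)
    (h0 : circleRep p.1 ∈ Ioo (0 : ℝ) 1) {S : Set SolidTorus}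
    (hS : ∀ q, (IsBackwardOrbit (solenoidMap α) q fun n => G^[n] q) →
      pastSymbols G q = pastSymbols G p → circleRep q.1 ∈ Ioo (0 : ℝ) 1 → q ∈ S) :
    ContainsArcThrough S p := by
  set x := circleRep p.1
  set ω := pastSymbols G p
  obtain ⟨ε, hε, hball⟩ := Metric.isOpen_iff.1 (isOpen_Ioo (a := (0 : ℝ)) (b := 1)) x h0
  have hmem : ∀ t ∈ Icc (-1 : ℝ) 1, x + ε / 2 * t ∈ Ioo (0 : ℝ) 1 := fun t ht => by
    refine hball ?_
    rw [Metric.mem_ball, Real.dist_eq, add_sub_cancel_left, abs_mul, abs_of_pos (half_pos hε)]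
    nlinarith [abs_le.2 ⟨ht.1, ht.2⟩]
  have hmem' : MapsTo (fun t => x + ε / 2 * t) (Icc (-1 : ℝ) 1) (Ico 0 1) :=
    fun t ht => Ioo_subset_Ico_self (hmem t ht)
  refine ⟨fun t => attractorPoint α ω (x + ε / 2 * t),
    (continuousOn_attractorPoint hα0 ω).comp (by fun_prop) hmem', ?_, ?_, fun t ht => ?_⟩
  · intro s hs t ht h
    have := injOn_attractorPoint α ω (hmem' hs) (hmem' ht) h
    simp only [add_right_inj] at this
    exact mul_left_cancel₀ (half_pos hε).ne' this
  · simp only [mul_zero, add_zero]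
    exact attractorPoint_pastSymbols hα0 hGF hp
  · refine hS _ (isBackwardOrbit_attractorPoint hα0 hGF ω (hmem' ht))
      (pastSymbols_attractorPoint hα0 hGF ω (hmem' ht)) ?_
    change circleRep ((x + ε / 2 * t : ℝ) : Circle1) ∈ _
    rw [circleRep_coe (hmem' ht)]
    exact hmem t ht

end Arcs

/-! ### Conditional measures along the unstable manifolds -/

section Conditional

variable {X : Type*} [MeasurableSpace X] [StandardBorelSpace X] [Nonempty X] {η : Measure X}
  [IsProbabilityMeasure η] {φ : X → ℝ}

/-- The joint law of `(φ x, x)` is carried by the graph of `φ`, and almost every slice inherits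
this. -/
theorem ae_condDistrib_id_compl_eq_zero (hφ : Measurable φ) :
    ∀ᵐ x ∂η, condDistrib id φ η (φ x) (φ ⁻¹' {φ x})ᶜ = 0 := by
  have h : ∀ᵐ z ∂(η.map φ ⊗ₘ condDistrib id φ η), φ z.2 = z.1 := by
    rw [compProd_map_condDistrib aemeasurable_id]
    exact (ae_map_iff (hφ.prodMk measurable_id).aemeasurable
      (measurableSet_eq_fun (hφ.comp measurable_snd) measurable_fst)).2 (ae_of_all _ fun _ => rfl)
  exact ae_of_ae_map hφ.aemeasurable (Measure.ae_ae_of_ae_compProd h)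

theorem isConditionalSystem_condDistrib {X : Type*} [MetricSpace X] [MeasurableSpace X]
    [StandardBorelSpace X] [Nonempty X] {η : Measure X} [IsProbabilityMeasure η] {φ : X → ℝ}
    (hφ : Measurable φ) : IsConditionalSystem η φ (condDistrib id φ η) where
  isMarkov := inferInstance
  disintegrates := by
    have := condDistrib_comp_map (μ := η) hφ.aemeasurable aemeasurable_id
    rwa [Measure.map_id] at this
  concentrated := ae_condDistrib_id_compl_eq_zero hφ

/-- The image under `f` of the conditional measure is the conditional law of `f` given `φ`, and
absolute continuity with respect to a product passes to almost every slice. -/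
theorem ae_map_condDistrib_id_absolutelyContinuous {Y : Type*} [MeasurableSpace Y]
    [StandardBorelSpace Y] [Nonempty Y] (hφ : Measurable φ) {f : X → Y} (hf : Measurable f)
    {m : Measure Y} [IsFiniteMeasure m] (h : η.map (fun x => (φ x, f x)) ≪ (η.map φ).prod m) :
    ∀ᵐ x ∂η, (condDistrib id φ η (φ x)).map f ≪ m := by
  have h1 : ∀ᵐ t ∂(η.map φ), condDistrib f φ η t ≪ m := by
    rw [← compProd_map_condDistrib hf.aemeasurable, ← Measure.compProd_const] at h
    exact h.kernel_of_compProd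
  have h2 := condDistrib_comp (mβ := inferInstance) (μ := η) φ aemeasurable_id hf
  suffices h3 : ∀ᵐ t ∂(η.map φ), (condDistrib id φ η t).map f ≪ m from
    ae_of_ae_map hφ.aemeasurable h3
  filter_upwards [h1, h2] with t ht1 ht2
  rw [Function.comp_id, Kernel.map_apply _ hf] at ht2
  rwa [← ht2]

end Conditional

/-! ### The SRB property of the lift, and the proposition -/

section Solenoid

variable {α : ℝ}

/-- The projection is 1-Lipschitz, so a set of zero length has a null projection, whose whole
preimage is `m`-null. -/
theorem absolutelyContinuous_hausdorffMeasure_of_map_fst {m : Measure SolidTorus}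
    (hm : m.map Prod.fst ≪ volume) {W : Set SolidTorus} (hW : m Wᶜ = 0) :
    m ≪ (μH[1]).restrict W := by
  refine Measure.AbsolutelyContinuous.mk fun S hS hS0 => ?_
  rw [Measure.restrict_apply hS] at hS0
  have h1 := LipschitzWith.prod_fst.hausdorffMeasure_image_le
    (zero_le_one (α := ℝ)) (S ∩ W)
  rw [hS0, mul_zero] at h1
  have h2 := hm (volume_eq_zero_of_hausdorffMeasure_eq_zero (nonpos_iff_eq_zero.1 h1))
  have h3 := measure_mono_null (subset_preimage_image Prod.fst (S ∩ W))
    (nonpos_iff_eq_zero.1 ((Measure.le_map_apply measurable_fst.aemeasurable _).trans h2.le))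
  refine measure_mono_null (fun p hp => ?_) (measure_union_null h3 hW)
  by_cases hpW : p ∈ W
  · exact Or.inl ⟨hp, hpW⟩
  · exact Or.inr hpW

/-- An invariant probability measure of the solenoid map with absolutely continuous projection is
an SRB measure. -/
theorem isSRB_solenoidMap (hα0 : 0 < α) (hα1 : α < 1) {η : Measure SolidTorus}
    [IsProbabilityMeasure η] (hη : MeasurePreserving (solenoidMap α) η η)
    (hac : η.map Prod.fst ≪ volume) : IsSRB (solenoidMap α) η := by
  have hemb := measurableEmbedding_solenoidMap hα0 hα1
  obtain ⟨G, hG, hGF⟩ := hemb.exists_measurable_extend measurable_id fun _ => inferInstance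
  replace hGF : Function.LeftInverse G (solenoidMap α) := congrFun hGF
  obtain ⟨hGη, hΛ⟩ := ae_isBackwardOrbit hemb hG hGF hη
  have hpast := measurable_pastSymbols hG
  set A : Set SolidTorus := {p | (IsBackwardOrbit (solenoidMap α) p fun n => G^[n] p) ∧
    circleRep p.1 ∈ Ioo (0 : ℝ) 1} with hAdef
  have hA : MeasurableSet A := by
    have h1 : MeasurableSet {p | IsBackwardOrbit (solenoidMap α) p fun n => G^[n] p} := by
      simp only [IsBackwardOrbit, Function.iterate_zero, id, true_and, ofPred_forall]
      exact MeasurableSet.iInter fun n => measurableSet_eq_fun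
        (hη.measurable.comp (hG.iterate (n + 1))) (hG.iterate n)
    exact h1.inter ((measurable_circleRep.comp measurable_fst) measurableSet_Ioo)
  have hAae : ∀ᵐ p ∂η, p ∈ A := by
    filter_upwards [hΛ, ae_circleRep_fst_mem_Ioo hac] with p h1 h2 using ⟨h1, h2⟩
  -- The exponential makes the code of a past positive, so that `-1` is free to label the null set
  -- outside `A`.
  let c : (ℕ → Bool) → ℝ := fun ω => Real.exp (embeddingReal (ℕ → Bool) ω)
  have hc : Measurable c :=
    Real.measurable_exp.comp (measurableEmbedding_embeddingReal (ℕ → Bool)).measurable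
  have hcinj : Function.Injective c :=
    Real.exp_injective.comp (measurableEmbedding_embeddingReal (ℕ → Bool)).injective
  classical
  let φ : SolidTorus → ℝ := A.piecewise (c ∘ pastSymbols G) fun _ => -1
  have hφ : Measurable φ := (hc.comp hpast).piecewise hA measurable_const
  have hφA : ∀ p ∈ A, φ p = c (pastSymbols G p) := fun p hp => piecewise_eq_of_mem _ _ _ hp
  have hlevel : ∀ p ∈ A, ∀ q, q ∈ φ ⁻¹' {φ p} ↔ q ∈ A ∧ pastSymbols G q = pastSymbols G p := by
    intro p hp q
    rw [mem_preimage, mem_singleton_iff, hφA p hp]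
    by_cases hq : q ∈ A
    · rw [hφA q hq, hcinj.eq_iff]
      exact (and_iff_right hq).symm
    · have : φ q = -1 := piecewise_eq_of_notMem _ _ _ hq
      rw [this]
      exact iff_of_false (neg_one_lt_zero.trans (Real.exp_pos _)).ne fun h => hq h.1
  have hsub : ∀ᵐ p ∂η, φ ⁻¹' {φ p} ⊆ unstableManifold (solenoidMap α) p := by
    filter_upwards [ae_mem_unstableManifold hα0 hGη hΛ hac, hAae] with p hp hpA q hq
    obtain ⟨hqA, hqp⟩ := (hlevel p hpA q).1 hq
    exact hp q hqA.1 hqp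
  have hφc : φ =ᵐ[η] c ∘ pastSymbols G := hAae.mono hφA
  have hjoint : η.map (fun p => (φ p, p.1)) ≪ (η.map φ).prod volume := by
    have h := map_pastSymbols_prodMk_absolutelyContinuous hα0 hα1 hG hGF hη hac
    have hcoe : Measurable ((↑) : ℝ → Circle1) := AddCircle.measurable_mk'
    have h' := h.map (hc.prodMap hcoe)
    rw [← Measure.map_prod_map _ _ hc hcoe, map_coe_restrict_volume, Measure.map_map hc hpast,
      Measure.map_map (hc.prodMap hcoe) (measurable_pastSymbols_prodMk hG)] at h'
    rw [Measure.map_congr hφc]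
    convert! h' using 1
    refine Measure.map_congr ?_
    filter_upwards [hφc] with p hp
    simp [hp]
  have hcond := isConditionalSystem_condDistrib (η := η) hφ
  refine ⟨inferInstance, hη, φ, condDistrib id φ η, ⟨hφ, hsub, ?_⟩, hcond, ?_⟩
  · filter_upwards [hAae] with p hp
    exact containsArcThrough_of_pastSymbols hα0 hGF hp.1 hp.2 fun q hq hqp hq0 =>
      (hlevel p hp q).2 ⟨⟨hq, hq0⟩, hqp⟩
  · filter_upwards [hsub, hcond.concentrated,
      ae_map_condDistrib_id_absolutelyContinuous hφ measurable_fst hjoint] with p h1 h2 h3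
    exact absolutelyContinuous_hausdorffMeasure_of_map_fst h3
      (measure_mono_null (compl_subset_compl.2 h1) h2)

end Solenoid

theorem mainTheorem3 (α : ℝ) (hα0 : 0 < α) (hα1 : α < 1)
    (μ : Measure Circle1) (hμ : IsCircleSRB (intermittentMap α) μ)
    (η : Measure SolidTorus) (hη : MeasurePreserving (solenoidMap α) η η)
    (hπ : η.map Prod.fst = μ) :
    IsSRB (solenoidMap α) η ∧
      ∀ ν : Measure SolidTorus, IsSRB (solenoidMap α) ν → ν = η := by
  subst hπ
  have := hμ.isProb
  have hprob : IsProbabilityMeasure η := Measure.isProbabilityMeasure_of_map Prod.fst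
  exact ⟨isSRB_solenoidMap hα0 hα1 hη hμ.absCont,
    fun ν hν => hν.eq_of_map_fst_isCircleSRB hα0 hα1 hη hμ⟩
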